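/- **System.** Two servers $S_1,S_2$ transmit status packets to a monitor in slotted time. The service time of $S_m$ is discrete phase-type, $\mathrm{DPH}(\alpha^{(m)},B^{(m)})$ of order $N_m$: $\alpha^{(m)}$ is a probability vector, $B^{(m)}$ is a sub-stochastic matrix all of whose phases are transient ($(B^{(m)})^n\to0$), and $b^{(m)}=(I-B^{(m)})\mathbf 1$ is the exit vector. In each slot a busy server in phase $i$ delivers its packet with probability $b^{(m)}_i$ or moves to phase $i'$ with probability $B^{(m)}_{ii'}$, independently of the other server. Let $k\ge 1$ be the freezing parameter. A new packet is sampled as soon as at least $k$ slots have elapsed since the last sampling and some server is idle; it starts service on an idle server $S_m$ with initial phase distributed as $\alpha^{(m)}$. If both servers are idle, a fixed one of them (priority of $S_1$ or priority of $S_2$) is used. The age of information is $\Delta(t)=t-g$, where $g$ is the generation instant of the freshest packet received by time $t$. A received packet is up to date if it was generated later than every other packet received before it or at the same instant. If $r_n$ is the instant of the $n$-th reception of an up-to-date packet, the peak age is $\Phi_n=\Delta(r_n-1)$. The initial law of the system is arbitrary. **Occupancy chain.** Let $W$ be the finite Markov chain that records which servers are busy, their phases, and the freezing clock $l\in\{0,\dots,k-1\}$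 (slots since the last sampling, stopped at $k-1$). Assume that $W$ has a unique stationary distribution $p$. **Absorbing chain.** Let $Y$ be the absorbing chain started at the generation of a packet $P^*$, which evolves with the dynamics of the system and has the following transient states ($i,j$ are the phases on $S_1,S_2$; $\tau_1,\tau_2$ are the generation instants of the packets in service there; $P_1,P_2$ are these packets once $P^*$ has been received; "up to date" and "obsolete" mean generated later and earlier than $P^*$): 1. $(1,i,j,l)$: $P^*$ on $S_1$, $\tau_1>\tau_2$; $(2,i,j,l)$: $P^*$ on $S_1$, $\tau_1<\tau_2$; $(3,i,j,l)$: $P^*$ on $S_2$, $\tau_1>\tau_2$; $(4,i,j,l)$: $P^*$ on $S_2$, $\tau_1<\tau_2$; $(5,i,l)$: $P^*$ on $S_1$, $S_2$ idle; $(6,j,l)$: $P^*$ on $S_2$, $S_1$ idle; 2. after the reception of $P^*$: $(7,l)$: both servers idle; $(8,i,j)$: $P_1,P_2$ up to date; $(9,i,l)$: $P_1$ obsolete, $S_2$ idle; $(10,j,l)$: $P_2$ obsolete, $S_1$ idle; $(11,i,j,l)$: $P_1$ up to date, $P_2$ obsolete; $(12,i,j,l)$: $P_2$ up to date, $P_1$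 obsolete; $(13,i,l)$: $P_1$ up to date, $S_2$ idle; $(14,j,l)$: $P_2$ up to date, $S_1$ idle. $Y$ is absorbed successfully when, after the reception of $P^*$, a packet newer than $P^*$ is received, and unsuccessfully when a packet newer than $P^*$ is received before or together with $P^*$. Let $A$ be the matrix of transition probabilities among the transient states, $c_s$ the vector of transition probabilities into the successful absorbing state, and $v$ the indicator vector of the states of classes 7–14. Let $\sigma$ be the initial probability vector of $Y$, obtained from $p$: for a state $y$ of class 1, 4, 5 or 6 with $l=0$, $\sigma_y$ is proportional to the probability, when $W$ is distributed as $p$, that the next transition samples a packet whose chain $Y$ starts in $y$; all other entries are $0$, and $\sum_y\sigma_y=1$. **Claim.** The matrix $I-A$ is invertible, $\sigma A(I-A)^{-1}v>0$ and $\sigma A(I-A)^{-1}c_s>0$. The age $\Delta(t)$ and the peak age $\Phi_n$ have steady-state laws $$u_\Delta(h)=\lim_{K\to\infty}\frac1K\sum_{t=0}^{K-1}\Pr(\Delta(t)=h)=\frac{\sigma A^hv}{\sigma A(I-A)^{-1}v},\qquad u_\Phi(h)=\lim_{K\to\infty}\frac1K\sum_{n=0}^{K-1}\Pr(\Phi_n=h)=\frac{\sigma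 A^hc_s}{\sigma A(I-A)^{-1}c_s}$$ for $h=0,1,2,\dots$ (so these are the limits of $\Pr(\Delta(t)=h)$ and $\Pr(\Phi_n=h)$ whenever the latter exist). Both are probability mass functions, and random variables $\Delta\sim u_\Delta$, $\Phi\sim u_\Phi$ have the finite moments $$\mathbb E[\Delta]=\sum_h h\,u_\Delta(h)=\frac{\sigma A(I-A)^{-2}v}{\sigma A(I-A)^{-1}v},\qquad \mathbb E[\Delta^2]=\sum_h h^2u_\Delta(h)=\frac{\sigma A(I-A)^{-3}(A+I)v}{\sigma A(I-A)^{-1}v},\qquad \mathbb E[\Phi]=\sum_h h\,u_\Phi(h)=\frac{\sigma A(I-A)^{-2}c_s}{\sigma A(I-A)^{-1}c_s}.$$ -/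

import Mathlib

open Filter Topology MeasureTheory Matrix

noncomputable section

namespace DTDQ

/-- A discrete phase-type law `DPH(α, B)` of order `N`: the time until absorption of a Markov chain
with transient phases `Fin N`, initial probability vector `α` and sub-stochastic matrix `B` of
transition probabilities among the phases. -/
structure DPH (N : ℕ) where
  α : Fin N → ℝ
  B : Matrix (Fin N) (Fin N) ℝ
  α_nonneg : ∀ i, 0 ≤ α i
  α_sum : ∑ i, α i = 1
  B_nonneg : ∀ i j, 0 ≤ B i j
  B_sum_le : ∀ i, ∑ j, B i j ≤ 1
  transient : ∀ i j, Tendsto (fun n : ℕ => (B ^ n) i j) atTop (𝓝 0)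

/-- The exit vector `b = (I - B) 1`. -/
def DPH.b {N : ℕ} (D : DPH N) : Fin N → ℝ := (1 - D.B) *ᵥ 1

/-- The server that samples when both servers are idle. -/
inductive Priority where
  | server1
  | server2

/-- Indicator of the policy "server 1 has priority". -/
def Priority.ind1 : Priority → ℝ
  | .server1 => 1
  | .server2 => 0

/-- Indicator of the policy "server 2 has priority". -/
def Priority.ind2 : Priority → ℝ
  | .server1 => 0
  | .server2 => 1

/-! ### The status update system -/

/-- State of the system at an instant `t`: for each server, `none` if it is idle, and otherwise
the service phase and the age `t - g` of the packet in service (`g` its generation instant); the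
freezing clock (number of slots since the last sampling, stopped at `k - 1`); the age of
information `Δ(t)`, that is, `t - g` for the freshest packet received up to `t`. -/
@[ext] structure SysState (N₁ N₂ k : ℕ) where
  srv1 : Option (Fin N₁ × ℕ)
  srv2 : Option (Fin N₂ × ℕ)
  clock : Fin k
  aoi : ℕ
  deriving DecidableEq

/-- Probability of the outcome of one slot of service: `some i'` if the packet stays in service in
phase `i'`, `none` if it is received (or if the server was idle). -/
def serveProb {N : ℕ} (D : DPH N) : Option (Fin N × ℕ) → Option (Fin N) → ℝ
  | none, none => 1
  | none, some _ => 0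
  | some (i, _), none => D.b i
  | some (i, _), some i' => D.B i i'

/-- Content of a server after one slot of service, before any new sampling. -/
def afterSlot {N : ℕ} : Option (Fin N × ℕ) → Option (Fin N) → Option (Fin N × ℕ)
  | some (_, a), some i' => some (i', a + 1)
  | _, _ => none

/-- `received s o δ` is the age of the freshest received packet if it was `δ` without the server
with content `s`, whose slot of service has outcome `o`. -/
def received {N : ℕ} : Option (Fin N × ℕ) → Option (Fin N) → ℕ → ℕ
  | some (_, a), none, δ => min δ (a + 1)
  | _, _, δ => δ

/-- State after one slot, given the outcomes `o₁`, `o₂` of the two services and the initial phases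
`i`, `j` that a packet sampled now would get on server 1 and on server 2. A packet is sampled if
`k` slots have elapsed since the last sampling and a server is idle. -/
def next {N₁ N₂ k : ℕ} (π : Priority) (x : SysState N₁ N₂ k)
    (o₁ : Option (Fin N₁)) (o₂ : Option (Fin N₂)) (i : Fin N₁) (j : Fin N₂) : SysState N₁ N₂ k :=
  let δ := received x.srv1 o₁ (received x.srv2 o₂ (x.aoi + 1))
  if h : (x.clock : ℕ) + 1 < k then
    ⟨afterSlot x.srv1 o₁, afterSlot x.srv2 o₂, ⟨x.clock + 1, h⟩, δ⟩
  else
    match afterSlot x.srv1 o₁, afterSlot x.srv2 o₂ with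
    | some s₁, some s₂ => ⟨some s₁, some s₂, x.clock, δ⟩
    | some s₁, none => ⟨some s₁, some (j, 0), ⟨0, x.clock.pos⟩, δ⟩
    | none, some s₂ => ⟨some (i, 0), some s₂, ⟨0, x.clock.pos⟩, δ⟩
    | none, none =>
      match π with
      | .server1 => ⟨some (i, 0), none, ⟨0, x.clock.pos⟩, δ⟩
      | .server2 => ⟨none, some (j, 0), ⟨0, x.clock.pos⟩, δ⟩

/-- One-slot transition probabilities of the system. -/
def sysProb {N₁ N₂ k : ℕ} (D₁ : DPH N₁) (D₂ : DPH N₂) (π : Priority)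
    (x y : SysState N₁ N₂ k) : ℝ :=
  ∑ o₁ : Option (Fin N₁), ∑ o₂ : Option (Fin N₂), ∑ i : Fin N₁, ∑ j : Fin N₂,
    if next π x o₁ o₂ i j = y then
      serveProb D₁ x.srv1 o₁ * serveProb D₂ x.srv2 o₂ * D₁.α i * D₂.α j
    else 0

/-- `X` is a random evolution of the system: a Markov chain with the above transition
probabilities, with an arbitrary initial law. -/
structure IsDTDQ {N₁ N₂ k : ℕ} (D₁ : DPH N₁) (D₂ : DPH N₂) (π : Priority)
    {Ω : Type*} [MeasurableSpace Ω] (μ : Measure Ω) (X : ℕ → Ω → SysState N₁ N₂ k) : Prop where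
  measurable : ∀ t x, MeasurableSet {ω | X t ω = x}
  markov : ∀ (t : ℕ) (x : ℕ → SysState N₁ N₂ k),
    μ.real {ω | ∀ s ≤ t + 1, X s ω = x s} =
      μ.real {ω | ∀ s ≤ t, X s ω = x s} * sysProb D₁ D₂ π (x t) (x (t + 1))

/-- The age of information `Δ(t)`. -/
def age {N₁ N₂ k : ℕ} {Ω : Type*} (X : ℕ → Ω → SysState N₁ N₂ k) (t : ℕ) (ω : Ω) : ℕ :=
  (X t ω).aoi

/-- An up-to-date packet is received at the instant `t`: the generation instant `t - Δ(t)` of the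
freshest received packet is later than it was at `t - 1`. -/
def UpToDate {N₁ N₂ k : ℕ} {Ω : Type*} (X : ℕ → Ω → SysState N₁ N₂ k) (ω : Ω) (t : ℕ) : Prop :=
  1 ≤ t ∧ age X t ω < age X (t - 1) ω + 1

/-- The instant `r_n` of the `n`-th reception of an up-to-date packet (counted from `n = 0`). -/
def receptionTime {N₁ N₂ k : ℕ} {Ω : Type*} (X : ℕ → Ω → SysState N₁ N₂ k) (n : ℕ) (ω : Ω) : ℕ :=
  Nat.nth (UpToDate X ω) n

/-- The peak age `Φ_n`: the age at the last instant `r_n - 1` of the cycle that ends with the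
`n`-th reception of an up-to-date packet. -/
def peakAge {N₁ N₂ k : ℕ} {Ω : Type*} (X : ℕ → Ω → SysState N₁ N₂ k) (n : ℕ) (ω : Ω) : ℕ :=
  age X (receptionTime X n ω - 1) ω

/-- `u` is the steady-state law of the sequence `Z` of random variables: the law of `Z t`
converges to `u` as `t → ∞` in the sense of long-run averages. If the probabilities themselves
converge, then `u` is their limit; the averages make sense for periodic systems too. -/
def HasSteadyStateLaw {Ω : Type*} [MeasurableSpace Ω] (μ : Measure Ω)
    (Z : ℕ → Ω → ℕ) (u : ℕ → ℝ) : Prop :=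
  ∀ h : ℕ, Tendsto (fun K : ℕ => (K : ℝ)⁻¹ * ∑ t ∈ Finset.range K, μ.real {ω | Z t ω = h})
    atTop (𝓝 (u h))

theorem HasSteadyStateLaw.eq_of_tendsto {Ω : Type*} [MeasurableSpace Ω] {μ : Measure Ω}
    {Z : ℕ → Ω → ℕ} {u w : ℕ → ℝ} (hu : HasSteadyStateLaw μ Z u)
    (hw : ∀ h : ℕ, Tendsto (fun t : ℕ => μ.real {ω | Z t ω = h}) atTop (𝓝 (w h))) : w = u :=
  funext fun h => tendsto_nhds_unique (hw h).cesaro (hu h)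

/-! ### The recurrent chain of server occupancies -/

/-- Indicator that the freezing clock advances from `l < k - 1` to `l' = l + 1`. -/
def tick {k : ℕ} (l l' : Fin k) : ℝ := if (l' : ℕ) = l + 1 then 1 else 0

/-- Indicator that a sampling resets the freezing clock from `l = k - 1` to `l' = 0`. -/
def reset {k : ℕ} (l l' : Fin k) : ℝ := if (l : ℕ) + 1 = k ∧ (l' : ℕ) = 0 then 1 else 0

/-- Indicator that the freezing clock stays at `l = l' = k - 1`. -/
def hold {k : ℕ} (l l' : Fin k) : ℝ := if (l : ℕ) + 1 = k ∧ l' = l then 1 else 0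

/-- Indicator of `l = k - 1`. -/
def expired {k : ℕ} (l : Fin k) : ℝ := if (l : ℕ) + 1 = k then 1 else 0

/-- States of the occupancy chain: busy servers with their phases, and the freezing clock. -/
inductive WState (N₁ N₂ k : ℕ) where
  | idle (l : Fin k)
  | busy1 (i : Fin N₁) (l : Fin k)
  | busy2 (j : Fin N₂) (l : Fin k)
  | both (i : Fin N₁) (j : Fin N₂) (l : Fin k)
  deriving DecidableEq, Fintype

/-- Transition matrix of the occupancy chain. -/
def wMatrix {N₁ N₂ k : ℕ} (D₁ : DPH N₁) (D₂ : DPH N₂) (π : Priority) :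
    Matrix (WState N₁ N₂ k) (WState N₁ N₂ k) ℝ := fun w w' =>
  match w with
  | .idle l =>
    match w' with
    | .idle l' => tick l l'
    | .busy1 i' l' => π.ind1 * reset l l' * D₁.α i'
    | .busy2 j' l' => π.ind2 * reset l l' * D₂.α j'
    | .both _ _ _ => 0
  | .busy1 i l =>
    match w' with
    | .idle l' => tick l l' * D₁.b i
    | .busy1 i' l' => π.ind1 * reset l l' * (D₁.b i * D₁.α i') + tick l l' * D₁.B i i'
    | .busy2 j' l' => π.ind2 * reset l l' * (D₁.b i * D₂.α j')
    | .both i' j' l' => reset l l' * (D₁.B i i' * D₂.α j')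
  | .busy2 j l =>
    match w' with
    | .idle l' => tick l l' * D₂.b j
    | .busy1 i' l' => π.ind1 * reset l l' * (D₂.b j * D₁.α i')
    | .busy2 j' l' => π.ind2 * reset l l' * (D₂.b j * D₂.α j') + tick l l' * D₂.B j j'
    | .both i' j' l' => reset l l' * (D₂.B j j' * D₁.α i')
  | .both i j l =>
    match w' with
    | .idle l' => tick l l' * (D₁.b i * D₂.b j)
    | .busy1 i' l' =>
      π.ind1 * reset l l' * (D₁.b i * D₂.b j * D₁.α i') + tick l l' * (D₂.b j * D₁.B i i')
    | .busy2 j' l' =>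
      π.ind2 * reset l l' * (D₁.b i * D₂.b j * D₂.α j') + tick l l' * (D₁.b i * D₂.B j j')
    | .both i' j' l' =>
      reset l l' * (D₁.b i * D₂.B j j' * D₁.α i') + reset l l' * (D₂.b j * D₁.B i i' * D₂.α j') +
        (tick l l' + hold l l') * (D₁.B i i' * D₂.B j j')

/-- `p` is a stationary probability vector of the stochastic matrix `P`. -/
structure IsStationary {S : Type*} [Fintype S] (P : Matrix S S ℝ) (p : S → ℝ) : Prop where
  nonneg : ∀ s, 0 ≤ p s
  sum_eq_one : ∑ s, p s = 1
  invariant : p ᵥ* P = p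

/-! ### The absorbing chain -/

/-- Transient states of the absorbing chain that starts with the generation of a packet `P*`.
`τ₁`, `τ₂` are the generation instants of the packets in service on servers 1 and 2, and `P₁`, `P₂`
are the packets in service there once `P*` has been received; up to date or obsolete refers to the
comparison with `P*`.
* `c1`: `P*` on server 1, `τ₁ > τ₂`
* `c2`: `P*` on server 1, `τ₁ < τ₂`
* `c3`: `P*` on server 2, `τ₁ > τ₂`
* `c4`: `P*` on server 2, `τ₁ < τ₂`
* `c5`: `P*` on server 1, server 2 idle
* `c6`: `P*` on server 2, server 1 idle
* `c7`: `P*` received, both servers idle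
* `c8`: `P*` received, `P₁` and `P₂` up to date
* `c9`: `P*` received, `P₁` obsolete, server 2 idle
* `c10`: `P*` received, `P₂` obsolete, server 1 idle
* `c11`: `P*` received, `P₁` up to date, `P₂` obsolete
* `c12`: `P*` received, `P₂` up to date, `P₁` obsolete
* `c13`: `P*` received, `P₁` up to date, server 2 idle
* `c14`: `P*` received, `P₂` up to date, server 1 idle -/
inductive YState (N₁ N₂ k : ℕ) where
  | c1 (i : Fin N₁) (j : Fin N₂) (l : Fin k)
  | c2 (i : Fin N₁) (j : Fin N₂) (l : Fin k)
  | c3 (i : Fin N₁) (j : Fin N₂) (l : Fin k)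
  | c4 (i : Fin N₁) (j : Fin N₂) (l : Fin k)
  | c5 (i : Fin N₁) (l : Fin k)
  | c6 (j : Fin N₂) (l : Fin k)
  | c7 (l : Fin k)
  | c8 (i : Fin N₁) (j : Fin N₂)
  | c9 (i : Fin N₁) (l : Fin k)
  | c10 (j : Fin N₂) (l : Fin k)
  | c11 (i : Fin N₁) (j : Fin N₂) (l : Fin k)
  | c12 (i : Fin N₁) (j : Fin N₂) (l : Fin k)
  | c13 (i : Fin N₁) (l : Fin k)
  | c14 (j : Fin N₂) (l : Fin k)
  deriving DecidableEq, Fintype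

/-- The matrix `A` of transition probabilities among the transient states. -/
def yMatrix {N₁ N₂ k : ℕ} (D₁ : DPH N₁) (D₂ : DPH N₂) (π : Priority) :
    Matrix (YState N₁ N₂ k) (YState N₁ N₂ k) ℝ := fun y y' =>
  match y with
  | .c1 i j l =>
    match y' with
    | .c10 j' l' => tick l l' * (D₁.b i * D₂.B j j')
    | .c11 i' j' l' => reset l l' * (D₁.b i * D₂.B j j' * D₁.α i')
    | .c7 l' => tick l l' * (D₁.b i * D₂.b j)
    | .c13 i' l' => π.ind1 * reset l l' * (D₁.b i * D₂.b j * D₁.α i')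
    | .c14 j' l' => π.ind2 * reset l l' * (D₁.b i * D₂.b j * D₂.α j')
    | .c5 i' l' => tick l l' * (D₂.b j * D₁.B i i')
    | .c2 i' j' l' => reset l l' * (D₂.b j * D₁.B i i' * D₂.α j')
    | .c1 i' j' l' => (tick l l' + hold l l') * (D₁.B i i' * D₂.B j j')
    | _ => 0
  | .c2 i j l =>
    match y' with
    | .c14 j' l' => tick l l' * (D₁.b i * D₂.B j j')
    | .c8 i' j' => expired l * (D₁.b i * D₂.B j j' * D₁.α i')
    | .c2 i' j' l' => (tick l l' + hold l l') * (D₁.B i i' * D₂.B j j')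
    | _ => 0
  | .c3 i j l =>
    match y' with
    | .c13 i' l' => tick l l' * (D₂.b j * D₁.B i i')
    | .c8 i' j' => expired l * (D₂.b j * D₁.B i i' * D₂.α j')
    | .c3 i' j' l' => (tick l l' + hold l l') * (D₁.B i i' * D₂.B j j')
    | _ => 0
  | .c4 i j l =>
    match y' with
    | .c6 j' l' => tick l l' * (D₁.b i * D₂.B j j')
    | .c3 i' j' l' => reset l l' * (D₁.b i * D₂.B j j' * D₁.α i')
    | .c7 l' => tick l l' * (D₁.b i * D₂.b j)
    | .c13 i' l' => π.ind1 * reset l l' * (D₁.b i * D₂.b j * D₁.α i')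
    | .c14 j' l' => π.ind2 * reset l l' * (D₁.b i * D₂.b j * D₂.α j')
    | .c9 i' l' => tick l l' * (D₂.b j * D₁.B i i')
    | .c12 i' j' l' => reset l l' * (D₂.b j * D₁.B i i' * D₂.α j')
    | .c4 i' j' l' => (tick l l' + hold l l') * (D₁.B i i' * D₂.B j j')
    | _ => 0
  | .c5 i l =>
    match y' with
    | .c7 l' => tick l l' * D₁.b i
    | .c13 i' l' => π.ind1 * reset l l' * (D₁.b i * D₁.α i')
    | .c14 j' l' => π.ind2 * reset l l' * (D₁.b i * D₂.α j')
    | .c5 i' l' => tick l l' * D₁.B i i'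
    | .c2 i' j' l' => reset l l' * (D₁.B i i' * D₂.α j')
    | _ => 0
  | .c6 j l =>
    match y' with
    | .c7 l' => tick l l' * D₂.b j
    | .c13 i' l' => π.ind1 * reset l l' * (D₂.b j * D₁.α i')
    | .c14 j' l' => π.ind2 * reset l l' * (D₂.b j * D₂.α j')
    | .c6 j' l' => tick l l' * D₂.B j j'
    | .c3 i' j' l' => reset l l' * (D₂.B j j' * D₁.α i')
    | _ => 0
  | .c7 l =>
    match y' with
    | .c7 l' => tick l l'
    | .c13 i' l' => π.ind1 * reset l l' * D₁.α i'
    | .c14 j' l' => π.ind2 * reset l l' * D₂.α j'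
    | _ => 0
  | .c8 i j =>
    match y' with
    | .c8 i' j' => D₁.B i i' * D₂.B j j'
    | _ => 0
  | .c9 i l =>
    match y' with
    | .c7 l' => tick l l' * D₁.b i
    | .c13 i' l' => π.ind1 * reset l l' * (D₁.b i * D₁.α i')
    | .c14 j' l' => π.ind2 * reset l l' * (D₁.b i * D₂.α j')
    | .c9 i' l' => tick l l' * D₁.B i i'
    | .c12 i' j' l' => reset l l' * (D₁.B i i' * D₂.α j')
    | _ => 0
  | .c10 j l =>
    match y' with
    | .c7 l' => tick l l' * D₂.b j
    | .c13 i' l' => π.ind1 * reset l l' * (D₂.b j * D₁.α i')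
    | .c14 j' l' => π.ind2 * reset l l' * (D₂.b j * D₂.α j')
    | .c10 j' l' => tick l l' * D₂.B j j'
    | .c11 i' j' l' => reset l l' * (D₂.B j j' * D₁.α i')
    | _ => 0
  | .c11 i j l =>
    match y' with
    | .c13 i' l' => tick l l' * (D₂.b j * D₁.B i i')
    | .c8 i' j' => expired l * (D₂.b j * D₁.B i i' * D₂.α j')
    | .c11 i' j' l' => (tick l l' + hold l l') * (D₁.B i i' * D₂.B j j')
    | _ => 0
  | .c12 i j l =>
    match y' with
    | .c14 j' l' => tick l l' * (D₁.b i * D₂.B j j')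
    | .c8 i' j' => expired l * (D₁.b i * D₂.B j j' * D₁.α i')
    | .c12 i' j' l' => (tick l l' + hold l l') * (D₁.B i i' * D₂.B j j')
    | _ => 0
  | .c13 i l =>
    match y' with
    | .c13 i' l' => tick l l' * D₁.B i i'
    | .c8 i' j' => expired l * (D₁.B i i' * D₂.α j')
    | _ => 0
  | .c14 j l =>
    match y' with
    | .c14 j' l' => tick l l' * D₂.B j j'
    | .c8 i' j' => expired l * (D₂.B j j' * D₁.α i')
    | _ => 0

/-- The vector `c_s` of transition probabilities into the successful absorbing state, entered when
`P*` has been received and the next up-to-date packet is received. (The missing mass of the states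
`c2` and `c3` goes to the unsuccessful absorbing state: a newer packet overtakes `P*`.) -/
def successVec {N₁ N₂ k : ℕ} (D₁ : DPH N₁) (D₂ : DPH N₂) : YState N₁ N₂ k → ℝ
  | .c8 i j => D₁.b i + D₂.b j - D₁.b i * D₂.b j
  | .c11 i _ _ => D₁.b i
  | .c12 _ j _ => D₂.b j
  | .c13 i _ => D₁.b i
  | .c14 j _ => D₂.b j
  | _ => 0

/-- The indicator vector `v` of the states in which `P*` has left the system. -/
def leftVec {N₁ N₂ k : ℕ} : YState N₁ N₂ k → ℝ
  | .c1 _ _ _ => 0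
  | .c2 _ _ _ => 0
  | .c3 _ _ _ => 0
  | .c4 _ _ _ => 0
  | .c5 _ _ => 0
  | .c6 _ _ => 0
  | _ => 1

/-- Given the stationary probabilities `p` of the occupancy chain, the probability per slot that a
packet is sampled and the absorbing chain of that packet starts in the given state. -/
def startWeight {N₁ N₂ k : ℕ} (D₁ : DPH N₁) (D₂ : DPH N₂) (π : Priority)
    (p : WState N₁ N₂ k → ℝ) : YState N₁ N₂ k → ℝ
  | .c1 i' j' l' =>
    ∑ l, reset l l' *
      (∑ j, D₂.B j j' * D₁.α i' * p (.busy2 j l) +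
        ∑ i, ∑ j, D₁.b i * D₂.B j j' * D₁.α i' * p (.both i j l))
  | .c4 i' j' l' =>
    ∑ l, reset l l' *
      (∑ i, D₁.B i i' * D₂.α j' * p (.busy1 i l) +
        ∑ i, ∑ j, D₂.b j * D₁.B i i' * D₂.α j' * p (.both i j l))
  | .c5 i' l' =>
    π.ind1 * ∑ l, reset l l' *
      (D₁.α i' * p (.idle l) + ∑ i, D₁.b i * D₁.α i' * p (.busy1 i l) +
        ∑ j, D₂.b j * D₁.α i' * p (.busy2 j l) +
        ∑ i, ∑ j, D₁.b i * D₂.b j * D₁.α i' * p (.both i j l))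
  | .c6 j' l' =>
    π.ind2 * ∑ l, reset l l' *
      (D₂.α j' * p (.idle l) + ∑ i, D₁.b i * D₂.α j' * p (.busy1 i l) +
        ∑ j, D₂.b j * D₂.α j' * p (.busy2 j l) +
        ∑ i, ∑ j, D₁.b i * D₂.b j * D₂.α j' * p (.both i j l))
  | _ => 0

/-- The initial probability vector `σ` of the absorbing chain. -/
def startVec {N₁ N₂ k : ℕ} (D₁ : DPH N₁) (D₂ : DPH N₂) (π : Priority)
    (p : WState N₁ N₂ k → ℝ) : YState N₁ N₂ k → ℝ := fun y =>
  startWeight D₁ D₂ π p y / ∑ y', startWeight D₁ D₂ π p y'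

end DTDQ

end

/-!
The system is a Markov chain on a countable state space. Its long-run averages are computed by
martingale differences and the Poisson equation, so that no coupling or regeneration of the chain is
needed.

**The absorbing chain follows a packet through the system.** For every `h` the map `track h` reads
the state of the absorbing chain of the packet of age `h` off the state of the system. On the
relevant states this is an exact intertwining (`op_trackVal`): the conditional expectation of
`f (track (h + 1))` one slot earlier is `(A f) (track h)`. The freshest received packet has age `h`
exactly when its chain is in the support of `v` (`trackVal_leftVec`), and a newer packet is received
in the next slot with the probability `c_s` of that state (`op_upToDate`). Iterating `h` times and
going one further slot back, to the sampling of the packet, shows that the conditional probability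
of the event `Δ = h`, given the state `h + 1` slots earlier, is a function of the occupancies at
that time only (`op_trackVal_zero`), whose mean under `p` is `s A ^ h v` (`startWeight_dotProduct`),
where `s` is the vector of sampling probabilities of which `σ` is the normalization. For the
reception of an up-to-date packet at the peak age `h` it is `s A ^ h c_s`.

**Averages.** For a bounded function `F` of a Markov chain with one-step operator `P`, the averages
of `F (X t) - (P F) (X t)` tend to `0` in mean (`IsPath.negligible_sub_op`): up to a telescoping
term they are averages of martingale increments, which are orthogonal. So a bounded function may be
replaced by its conditional expectation any number of slots earlier. A function `g` of the
occupancies has the average `p g`, since `g - p g = u - W u` has a solution `u` when `p` is the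
unique stationary vector (`exists_poisson_solution`). Hence `1{Δ(t) = h}` has the average
`s A ^ h v`, for every initial law (`negligible_age_eq`), and the receptions at the peak age `h`
have the frequency `s A ^ h c_s` (`negligible_reception_eq`).

**No mass escapes.** The absorbing chain is transient (`isTransient_yMatrix`), so `A ^ n 1` decays
geometrically and the power series converge. The same decay bounds the probability that the age is
at least `n` after `n` slots, uniformly in the state (`exists_op_iterate_aoi_le`): a packet in
service, or the freshest received one if there is none, may be regarded as just sampled, and its
absorbing chain has to survive. Therefore `∑ s A ^ h v = 1` (`dotProduct_leftVec_eq_one`), and the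
receptions have the total frequency `c = s (1 - A)⁻¹ c_s` (`negligible_reception`). It is positive,
because otherwise `s A ^ h v` would increase with `h` (`dotProduct_successVec_pos`). The number of
receptions up to `T` being close to `c T`, frequencies per slot become frequencies per reception
after division by `c` (`tendsto_average_nth`), so that the peak age has the law `s A ^ h c_s / c`.
Since `s v = 0` and `s c_s = 0`, the normalizing constants are also `s A (1 - A)⁻¹ v` and
`s A (1 - A)⁻¹ c_s`, and the normalization of `σ` cancels. The moments are derived series of the
geometric series of `A`.
-/

/-! ### Averages along a Markov chain on a countable space -/

namespace DTDQ

/-- A Markov kernel on `S` presented by finite noise: from the state `x`, the noise takes the value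
`e` with probability `weight x e`, and then the next state is `move x e`. -/
structure NoiseChain (S E : Type*) [Fintype E] where
  weight : S → E → ℝ
  move : S → E → S
  weight_nonneg : ∀ x e, 0 ≤ weight x e
  weight_sum : ∀ x, ∑ e, weight x e = 1

namespace NoiseChain

section Operator

variable {S E : Type*} [Fintype E] (C : NoiseChain S E)

/-- The one-step operator: the conditional expectation of `F` at the next state. -/
def op (F : S → ℝ) (x : S) : ℝ := ∑ e, C.weight x e * F (C.move x e)

theorem op_const (c : ℝ) (x : S) : C.op (fun _ => c) x = c := by
  simp [op, ← Finset.sum_mul, C.weight_sum]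

theorem op_mono {F G : S → ℝ} {x : S} (h : ∀ e, F (C.move x e) ≤ G (C.move x e)) :
    C.op F x ≤ C.op G x :=
  Finset.sum_le_sum fun e _ => mul_le_mul_of_nonneg_left (h e) (C.weight_nonneg x e)

theorem op_congr {F G : S → ℝ} {x : S} (h : ∀ e, F (C.move x e) = G (C.move x e)) :
    C.op F x = C.op G x :=
  Finset.sum_congr rfl fun e _ => by rw [h e]

theorem op_add (F G : S → ℝ) (x : S) : C.op (fun y => F y + G y) x = C.op F x + C.op G x := by
  simp [op, mul_add, Finset.sum_add_distrib]

theorem abs_op_le {F : S → ℝ} {c : ℝ} (h : ∀ y, |F y| ≤ c) (x : S) : |C.op F x| ≤ c := by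
  rw [abs_le]
  constructor
  · rw [← C.op_const (-c) x]
    exact C.op_mono fun e => (abs_le.1 (h _)).1
  · rw [← C.op_const c x]
    exact C.op_mono fun e => (abs_le.1 (h _)).2

theorem abs_op_iterate_le {F : S → ℝ} {c : ℝ} (h : ∀ y, |F y| ≤ c) (n : ℕ) (x : S) :
    |C.op^[n] F x| ≤ c := by
  induction n generalizing x with
  | zero => exact h x
  | succ n ih =>
    rw [Function.iterate_succ_apply']
    exact C.abs_op_le ih x

end Operator

end NoiseChain

/-- `Z` is a bounded real-valued process whose running averages tend to `0` in mean. -/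
structure Negligible {Ω : Type*} [MeasurableSpace Ω] (μ : Measure Ω) (Z : ℕ → Ω → ℝ) : Prop where
  measurable : ∀ t, Measurable (Z t)
  bounded : ∃ c, ∀ t ω, |Z t ω| ≤ c
  tendsto : Tendsto (fun T : ℕ => ∫ ω, |(T : ℝ)⁻¹ * ∑ t ∈ Finset.range T, Z t ω| ∂μ) atTop (𝓝 0)

theorem measurable_comp {S : Type*} [Countable S] {Ω : Type*} [MeasurableSpace Ω] {X : ℕ → Ω → S}
    (hm : ∀ t x, MeasurableSet {ω | X t ω = x}) {β : Type*}
    [MeasurableSpace β] (f : S → β) (t : ℕ) : Measurable fun ω => f (X t ω) := by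
  let _ : MeasurableSpace S := ⊤
  have : MeasurableSingletonClass S := ⟨fun _ => trivial⟩
  have h : Measurable (X t) := measurable_to_countable' fun x => hm t x
  exact (measurable_of_countable f).comp h

theorem measurable_comp₂ {S : Type*} [Countable S] {Ω : Type*} [MeasurableSpace Ω] {X : ℕ → Ω → S}
    (hm : ∀ t x, MeasurableSet {ω | X t ω = x}) {β : Type*}
    [MeasurableSpace β] (f : S → S → β) (s t : ℕ) : Measurable fun ω => f (X s ω) (X t ω) := by
  let _ : MeasurableSpace S := ⊤
  have : MeasurableSingletonClass S := ⟨fun _ => trivial⟩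
  have h : ∀ t, Measurable (X t) := fun t => measurable_to_countable' fun x => hm t x
  exact (measurable_of_countable (Function.uncurry f)).comp ((h s).prodMk (h t))

theorem integrable_of_abs_le {Ω : Type*} [MeasurableSpace Ω] {μ : Measure Ω} [IsFiniteMeasure μ]
    {f : Ω → ℝ} (hf : Measurable f) {c : ℝ} (h : ∀ ω, |f ω| ≤ c) : Integrable f μ :=
  Integrable.of_bound hf.aestronglyMeasurable c (Eventually.of_forall h)

theorem abs_sum_range_le {a : ℕ → ℝ} {c : ℝ} (h : ∀ t, |a t| ≤ c) (T : ℕ) :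
    |∑ t ∈ Finset.range T, a t| ≤ T * c := by
  refine (Finset.abs_sum_le_sum_abs _ _).trans ?_
  simpa using Finset.sum_le_card_nsmul (Finset.range T) (fun t => |a t|) c fun t _ => h t

theorem abs_average_le {a : ℕ → ℝ} {c : ℝ} (h : ∀ t, |a t| ≤ c) (T : ℕ) :
    |(T : ℝ)⁻¹ * ∑ t ∈ Finset.range T, a t| ≤ c := by
  have hc : 0 ≤ c := (abs_nonneg _).trans (h 0)
  rw [abs_mul, abs_of_nonneg (by positivity : (0 : ℝ) ≤ (T : ℝ)⁻¹)]
  rcases Nat.eq_zero_or_pos T with rfl | hT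
  · simpa using hc
  · have hT' : (0 : ℝ) < T := by exact_mod_cast hT
    rw [inv_mul_le_iff₀ hT']
    exact abs_sum_range_le h T

namespace Negligible

theorem neg {Ω : Type*} [MeasurableSpace Ω] {μ : Measure Ω} {Z : ℕ → Ω → ℝ}
    (hZ : Negligible μ Z) : Negligible μ fun t ω => -Z t ω where
  measurable t := (hZ.measurable t).neg
  bounded := by simpa using hZ.bounded
  tendsto := by simpa using hZ.tendsto

theorem congr {Ω : Type*} [MeasurableSpace Ω] {μ : Measure Ω} {Z Z' : ℕ → Ω → ℝ}
    (hZ : Negligible μ Z) (h : ∀ t ω, Z' t ω = Z t ω) : Negligible μ Z' := by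
  have : Z' = Z := funext fun t => funext fun ω => h t ω
  rwa [this]

section

variable {Ω : Type*} [MeasurableSpace Ω] {μ : Measure Ω} [IsProbabilityMeasure μ]
  {Z Z' : ℕ → Ω → ℝ}

theorem integrable_average (hm : ∀ t, Measurable (Z t)) (hb : ∃ c, ∀ t ω, |Z t ω| ≤ c) (T : ℕ) :
    Integrable (fun ω => (T : ℝ)⁻¹ * ∑ t ∈ Finset.range T, Z t ω) μ := by
  obtain ⟨c, hc⟩ := hb
  exact integrable_of_abs_le
    ((Finset.measurable_fun_sum _ fun t _ => hm t).const_mul _) fun ω => abs_average_le (hc · ω) T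

theorem add (hZ : Negligible μ Z) (hZ' : Negligible μ Z') :
    Negligible μ fun t ω => Z t ω + Z' t ω where
  measurable t := (hZ.measurable t).add (hZ'.measurable t)
  bounded := by
    obtain ⟨c, hc⟩ := hZ.bounded
    obtain ⟨c', hc'⟩ := hZ'.bounded
    exact ⟨c + c', fun t ω => (abs_add_le _ _).trans (add_le_add (hc t ω) (hc' t ω))⟩
  tendsto := by
    have h := hZ.tendsto.add hZ'.tendsto
    rw [add_zero] at h
    refine squeeze_zero (fun T => integral_nonneg fun ω => abs_nonneg _) (fun T => ?_) h
    have h1 := (integrable_average (μ := μ) hZ.measurable hZ.bounded T).abs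
    have h2 := (integrable_average (μ := μ) hZ'.measurable hZ'.bounded T).abs
    rw [← integral_add h1 h2]
    refine integral_mono_of_nonneg (Eventually.of_forall fun ω => abs_nonneg _) (h1.add h2)
      (Eventually.of_forall fun ω => ?_)
    simp only [Finset.sum_add_distrib, mul_add]
    exact abs_add_le _ _

theorem sum {ι : Type*} (I : Finset ι) {Y : ι → ℕ → Ω → ℝ} (h : ∀ i ∈ I, Negligible μ (Y i)) :
    Negligible μ fun t ω => ∑ i ∈ I, Y i t ω := by
  classical
  induction I using Finset.induction_on with
  | empty =>
    refine ⟨fun t => by simp, ⟨0, by simp⟩, by simp⟩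
  | insert i I hi ih =>
    have := (h i (Finset.mem_insert_self i I)).add
      (ih fun j hj => h j (Finset.mem_insert_of_mem hj))
    exact this.congr fun t ω => by rw [Finset.sum_insert hi]

/-- Running averages that tend to `0` in mean have expectations tending to `0`. -/
theorem tendsto_integral (hZ : Negligible μ Z) :
    Tendsto (fun T : ℕ => (T : ℝ)⁻¹ * ∑ t ∈ Finset.range T, ∫ ω, Z t ω ∂μ) atTop (𝓝 0) := by
  refine squeeze_zero_norm (fun T => ?_) hZ.tendsto
  obtain ⟨c, hc⟩ := hZ.bounded
  rw [← integral_finsetSum _ fun t _ => integrable_of_abs_le (hZ.measurable t) (hc t),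
    ← integral_const_mul]
  exact norm_integral_le_integral_norm _

theorem nonpos_of_le (hZ : Negligible μ Z) {δ : ℝ} (h : ∀ t ω, δ ≤ Z t ω) : δ ≤ 0 := by
  refine le_of_tendsto_of_tendsto tendsto_const_nhds hZ.tendsto_integral ?_
  filter_upwards [eventually_gt_atTop 0] with T hT
  have hT' : (0 : ℝ) < T := by exact_mod_cast hT
  rw [le_inv_mul_iff₀ hT']
  obtain ⟨c, hc⟩ := hZ.bounded
  have : ∀ t, δ ≤ ∫ ω, Z t ω ∂μ := fun t => by
    simpa using integral_mono (μ := μ) (integrable_const δ)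
      (integrable_of_abs_le (hZ.measurable t) (hc t)) (h t)
  simpa using Finset.card_nsmul_le_sum (Finset.range T) _ δ fun t _ => this t

end

end Negligible

namespace NoiseChain

section Path

variable {S E : Type*} [Fintype E] [DecidableEq S] (C : NoiseChain S E)

/-- `X` is a Markov chain with the transition probabilities of `C`. -/
structure IsPath {Ω : Type*} [MeasurableSpace Ω] (μ : Measure Ω) (X : ℕ → Ω → S) : Prop where
  measurable : ∀ t x, MeasurableSet {ω | X t ω = x}
  markov : ∀ (t : ℕ) (x : ℕ → S),
    μ.real {ω | ∀ s ≤ t + 1, X s ω = x s} =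
      μ.real {ω | ∀ s ≤ t, X s ω = x s} *
        ∑ e, if C.move (x t) e = x (t + 1) then C.weight (x t) e else 0

variable {C} {Ω : Type*} [MeasurableSpace Ω] {μ : Measure Ω} [IsProbabilityMeasure μ]
  [Countable S] {X : ℕ → Ω → S}

/-- On the event that the path up to time `T` is a given one, the mean of a function of the next
state is given by the one-step operator. -/
theorem IsPath.setIntegral_next (hX : C.IsPath μ X) (T : ℕ) (x : ℕ → S) {F : S → ℝ} {c : ℝ}
    (hF : ∀ y, |F y| ≤ c) :
    ∫ ω in {ω | ∀ s ≤ T, X s ω = x s}, F (X (T + 1) ω) ∂μ =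
      μ.real {ω | ∀ s ≤ T, X s ω = x s} * C.op F (x T) := by
  classical
  set H : Set Ω := {ω | ∀ s ≤ T, X s ω = x s} with hH
  let _ : MeasurableSpace S := ⊤
  have : MeasurableSingletonClass S := ⟨fun _ => trivial⟩
  have hmX : Measurable (X (T + 1)) := measurable_to_countable' fun y => hX.measurable _ y
  have h1 : ∫ ω in H, F (X (T + 1) ω) ∂μ = ∫ y, F y ∂((μ.restrict H).map (X (T + 1))) :=
    (integral_map hmX.aemeasurable (measurable_of_countable F).aestronglyMeasurable).symm
  have hint : Integrable F ((μ.restrict H).map (X (T + 1))) :=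
    integrable_of_abs_le (measurable_of_countable F) hF
  rw [h1, integral_countable hint]
  have h2 : ∀ y, ((μ.restrict H).map (X (T + 1))).real {y} =
      μ.real H * ∑ e, if C.move (x T) e = y then C.weight (x T) e else 0 := by
    intro y
    rw [map_measureReal_apply hmX trivial,
      measureReal_restrict_apply (hmX trivial)]
    have h3 := hX.markov T (fun s => if s ≤ T then x s else y)
    have e1 : {ω | ∀ s ≤ T + 1, X s ω = if s ≤ T then x s else y} = X (T + 1) ⁻¹' {y} ∩ H := by
      ext ω
      simp only [Set.mem_ofPred_eq, Set.mem_inter_iff, Set.mem_preimage, Set.mem_singleton_iff, hH]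
      constructor
      · intro h
        refine ⟨by simpa using h (T + 1) le_rfl, fun s hs => by simpa [hs] using h s (by omega)⟩
      · rintro ⟨h, h'⟩ s hs
        by_cases hsT : s ≤ T
        · simpa [hsT] using h' s hsT
        · obtain rfl : s = T + 1 := by omega
          simpa using h
    have e2 : {ω | ∀ s ≤ T, X s ω = if s ≤ T then x s else y} = H := by
      ext ω
      exact forall₂_congr fun s hs => by simp [hs]
    rw [e1, e2] at h3
    simpa using h3
  simp only [h2, smul_eq_mul]
  have h4 : HasSum (fun y => μ.real H *
      (∑ e, if C.move (x T) e = y then C.weight (x T) e else 0) * F y)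
      (∑ e, μ.real H * (C.weight (x T) e * F (C.move (x T) e))) := by
    have : (fun y => μ.real H *
      (∑ e, if C.move (x T) e = y then C.weight (x T) e else 0) * F y) = fun y =>
        ∑ e, if y = C.move (x T) e then
          μ.real H * (C.weight (x T) e * F (C.move (x T) e)) else 0 := by
      funext y
      rw [Finset.mul_sum, Finset.sum_mul]
      refine Finset.sum_congr rfl fun e _ => ?_
      by_cases h : C.move (x T) e = y
      · subst h; simp [mul_assoc]
      · simp [h, Ne.symm h]
    rw [this]
    exact hasSum_sum fun e _ => hasSum_ite_eq _ _
  rw [h4.tsum_eq, op, Finset.mul_sum]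

/-- The increments `f (X T) (X (T + 1)) - E[f (X T) (X (T + 1)) | X T]` are orthogonal to every
bounded function `G` of the path up to the time `T`. -/
theorem IsPath.integral_mul_increment (hX : C.IsPath μ X) (T : ℕ) {G : Ω → ℝ} {b : ℝ}
    (hGm : Measurable G) (hGb : ∀ ω, |G ω| ≤ b)
    (hG : ∀ ω ω', (∀ s ≤ T, X s ω = X s ω') → G ω = G ω') {f : S → S → ℝ} {c : ℝ}
    (hf : ∀ x y, |f x y| ≤ c) :
    ∫ ω, G ω * (f (X T ω) (X (T + 1) ω) - C.op (f (X T ω)) (X T ω)) ∂μ = 0 := by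
  set ψ : Ω → ℝ := fun ω => G ω * (f (X T ω) (X (T + 1) ω) - C.op (f (X T ω)) (X T ω)) with hψ
  have hm1 : Measurable fun ω => f (X T ω) (X (T + 1) ω) :=
    measurable_comp₂ hX.measurable f T (T + 1)
  have hm2 : Measurable fun ω => C.op (f (X T ω)) (X T ω) :=
    measurable_comp hX.measurable (fun x => C.op (f x) x) T
  have hψi : Integrable ψ μ := by
    refine integrable_of_abs_le (c := b * (c + c)) (hGm.mul (hm1.sub hm2)) fun ω => ?_
    rw [hψ, abs_mul]
    refine mul_le_mul (hGb ω) ((abs_sub _ _).trans (add_le_add (hf _ _) ?_)) (abs_nonneg _)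
      ((abs_nonneg _).trans (hGb ω))
    exact C.abs_op_le (hf _) _
  -- decompose the sample space according to the path up to the time `T`
  let H : (Fin (T + 1) → S) → Set Ω := fun x => {ω | ∀ s : Fin (T + 1), X s ω = x s}
  have hHm : ∀ x, MeasurableSet (H x) := fun x => by
    have : H x = ⋂ s : Fin (T + 1), {ω | X s ω = x s} := by ext; simp [H]
    rw [this]
    exact MeasurableSet.iInter fun s => hX.measurable _ _
  have hHd : Pairwise (Function.onFun Disjoint H) := by
    intro x y hxy
    refine Set.disjoint_left.2 fun ω hx hy => hxy (funext fun s => ?_)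
    rw [← hx s, ← hy s]
  have hHu : ⋃ x, H x = Set.univ :=
    Set.eq_univ_of_forall fun ω => Set.mem_iUnion.2 ⟨fun s => X s ω, fun s => rfl⟩
  have hsum := hasSum_integral_iUnion (μ := μ) hHm hHd hψi.integrableOn
  rw [hHu, setIntegral_univ] at hsum
  refine hsum.unique ?_
  have hz : (fun x => ∫ ω in H x, ψ ω ∂μ) = fun _ => 0 := by
    funext x
    rcases (H x).eq_empty_or_nonempty with h0 | ⟨ω₀, hω₀⟩
    · simp [h0]
    have hHe : H x = {ω | ∀ s ≤ T, X s ω = X s ω₀} := by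
      ext ω
      constructor
      · intro h s hs
        exact (h ⟨s, by omega⟩).trans (hω₀ ⟨s, by omega⟩).symm
      · intro h s
        exact (h s (by omega)).trans (hω₀ s)
    have hcongr : ∫ ω in H x, ψ ω ∂μ = ∫ ω in H x, G ω₀ *
        (f (X T ω₀) (X (T + 1) ω) - C.op (f (X T ω₀)) (X T ω₀)) ∂μ := by
      refine setIntegral_congr_fun (hHm x) fun ω hω => ?_
      rw [hHe] at hω
      simp only [hψ, hG ω ω₀ hω, hω T le_rfl]
    have hmf : Measurable fun ω => f (X T ω₀) (X (T + 1) ω) :=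
      measurable_comp hX.measurable (f (X T ω₀)) (T + 1)
    rw [hcongr, integral_const_mul, integral_sub
      (integrable_of_abs_le hmf fun ω => hf _ _) (integrable_const _), hHe,
      hX.setIntegral_next T (fun s => X s ω₀) (hf (X T ω₀))]
    simp
  rw [hz]
  exact hasSum_zero

/-- The law of large numbers for the martingale increments of a chain, from the orthogonality of
the increments. -/
theorem IsPath.negligible_increment (hX : C.IsPath μ X) {f : S → S → ℝ} {c : ℝ}
    (hf : ∀ x y, |f x y| ≤ c) :
    Negligible μ fun t ω => f (X t ω) (X (t + 1) ω) - C.op (f (X t ω)) (X t ω) := by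
  set ξ : ℕ → Ω → ℝ := fun t ω => f (X t ω) (X (t + 1) ω) - C.op (f (X t ω)) (X t ω) with hξ
  have hm : ∀ t, Measurable (ξ t) := fun t =>
    (measurable_comp₂ hX.measurable f t (t + 1)).sub
      (measurable_comp hX.measurable (fun x => C.op (f x) x) t)
  have hb : ∀ t ω, |ξ t ω| ≤ c + c := fun t ω =>
    (abs_sub _ _).trans (add_le_add (hf _ _) (C.abs_op_le (hf _) _))
  set D : ℕ → Ω → ℝ := fun T ω => ∑ t ∈ Finset.range T, ξ t ω with hD
  have hDm : ∀ T, Measurable (D T) := fun T => Finset.measurable_fun_sum _ fun t _ => hm t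
  have hDb : ∀ T ω, |D T ω| ≤ T * (c + c) := fun T ω => abs_sum_range_le (fun t => hb t ω) T
  have hsq : ∀ {g : Ω → ℝ} {b : ℝ}, Measurable g → (∀ ω, |g ω| ≤ b) →
      Integrable (fun ω => g ω ^ 2) μ := fun {g b} hg hgb =>
    integrable_of_abs_le (c := b ^ 2) (hg.pow_const 2) fun ω => by
      rw [abs_pow]; exact pow_le_pow_left₀ (abs_nonneg _) (hgb ω) 2
  have hvar : ∀ T : ℕ, ∫ ω, D T ω ^ 2 ∂μ ≤ T * (c + c) ^ 2 := by
    intro T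
    induction T with
    | zero => simp [hD]
    | succ T ih =>
      have horth : ∫ ω, D T ω * ξ T ω ∂μ = 0 := by
        refine hX.integral_mul_increment T (hDm T) (hDb T) (fun ω ω' h => ?_) hf
        refine Finset.sum_congr rfl fun t ht => ?_
        have ht' := Finset.mem_range.1 ht
        simp only [hξ, h t (by omega), h (t + 1) (by omega)]
      have hDξ : Integrable (fun ω => D T ω * ξ T ω) μ :=
        integrable_of_abs_le (c := T * (c + c) * (c + c)) ((hDm T).mul (hm T)) fun ω => by
          rw [abs_mul]
          exact mul_le_mul (hDb T ω) (hb T ω) (abs_nonneg _) ((abs_nonneg _).trans (hDb T ω))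
      have hexp : ∀ ω, D (T + 1) ω ^ 2 = D T ω ^ 2 + 2 * (D T ω * ξ T ω) + ξ T ω ^ 2 := by
        intro ω
        simp only [hD, Finset.sum_range_succ]
        ring
      simp only [hexp]
      have hi1 := hsq (hDm T) (hDb T)
      have hi2 : Integrable (fun ω => 2 * (D T ω * ξ T ω)) μ := hDξ.const_mul 2
      have hi12 : Integrable (fun ω => D T ω ^ 2 + 2 * (D T ω * ξ T ω)) μ := hi1.add hi2
      rw [integral_add hi12 (hsq (hm T) (hb T)), integral_add hi1 hi2, integral_const_mul, horth]
      have hlast : ∫ ω, ξ T ω ^ 2 ∂μ ≤ (c + c) ^ 2 := by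
        have := integral_mono (μ := μ) (hsq (hm T) (hb T)) (integrable_const ((c + c) ^ 2))
          fun ω => by
            have := pow_le_pow_left₀ (abs_nonneg _) (hb T ω) 2
            rwa [sq_abs] at this
        simpa using this
      push_cast
      linarith
  refine ⟨hm, ⟨_, hb⟩, ?_⟩
  -- Jensen's inequality turns the variance bound into a bound in mean
  have hjensen : ∀ T : ℕ, ∫ ω, |D T ω| ∂μ ≤ √(T * (c + c) ^ 2) := by
    intro T
    refine Real.le_sqrt_of_sq_le (le_trans ?_ (hvar T))
    have hi := hsq (hDm T) (hDb T)
    have hi1 : Integrable (fun ω => |D T ω|) μ := (integrable_of_abs_le (hDm T) (hDb T)).abs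
    set m := ∫ ω, |D T ω| ∂μ with hmdef
    have h0 : 0 ≤ ∫ ω, (|D T ω| - m) ^ 2 ∂μ := integral_nonneg fun ω => sq_nonneg _
    have h1 : ∀ ω, (|D T ω| - m) ^ 2 = D T ω ^ 2 - 2 * m * |D T ω| + m ^ 2 := fun ω => by
      rw [sub_sq, sq_abs]; ring
    simp only [h1] at h0
    have hi2 : Integrable (fun ω => 2 * m * |D T ω|) μ := hi1.const_mul _
    have hi12 : Integrable (fun ω => D T ω ^ 2 - 2 * m * |D T ω|) μ := hi.sub hi2
    rw [integral_add hi12 (integrable_const _), integral_sub hi hi2, integral_const_mul,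
      ← hmdef] at h0
    simp only [integral_const, probReal_univ, smul_eq_mul, one_mul] at h0
    linarith
  have hlim : Tendsto (fun T : ℕ => |c + c| * (√(T : ℝ))⁻¹) atTop (𝓝 0) := by
    rw [← mul_zero |c + c|]
    exact ((Real.tendsto_sqrt_atTop.comp tendsto_natCast_atTop_atTop).inv_tendsto_atTop).const_mul _
  refine squeeze_zero (fun T => integral_nonneg fun ω => abs_nonneg _) (fun T => ?_) hlim
  simp only [abs_mul, abs_of_nonneg (inv_nonneg.2 (Nat.cast_nonneg (α := ℝ) T))]
  rw [integral_const_mul]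
  refine (mul_le_mul_of_nonneg_left (hjensen T) (by positivity)).trans (le_of_eq ?_)
  rw [Real.sqrt_mul (Nat.cast_nonneg T), Real.sqrt_sq_eq_abs]
  rcases Nat.eq_zero_or_pos T with rfl | hT
  · simp
  have hT' : (0 : ℝ) < √T := Real.sqrt_pos.2 (by exact_mod_cast hT)
  have : (T : ℝ) = √T * √T := (Real.mul_self_sqrt (Nat.cast_nonneg T)).symm
  field_simp
  rw [sq, ← this]

/-- A bounded function has the same averages as its conditional expectation one step earlier: up to
a telescoping sum, the difference consists of martingale increments. -/
theorem IsPath.negligible_sub_op (hX : C.IsPath μ X) {F : S → ℝ} {c : ℝ} (hF : ∀ x, |F x| ≤ c) :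
    Negligible μ fun t ω => F (X t ω) - C.op F (X t ω) := by
  have htel : Negligible μ fun t ω => F (X (t + 1) ω) - F (X t ω) := by
    refine ⟨fun t => (measurable_comp hX.measurable F (t + 1)).sub
      (measurable_comp hX.measurable F t),
      ⟨c + c, fun t ω => (abs_sub _ _).trans (add_le_add (hF _) (hF _))⟩, ?_⟩
    have hlim : Tendsto (fun T : ℕ => (T : ℝ)⁻¹ * (c + c)) atTop (𝓝 0) := by
      rw [← zero_mul (c + c)]
      exact tendsto_inv_atTop_nhds_zero_nat.mul_const _
    refine squeeze_zero (fun T => integral_nonneg fun ω => abs_nonneg _) (fun T => ?_) hlim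
    have h1 : ∀ ω, |(T : ℝ)⁻¹ * ∑ t ∈ Finset.range T, (F (X (t + 1) ω) - F (X t ω))| ≤
        (T : ℝ)⁻¹ * (c + c) := fun ω => by
      rw [Finset.sum_range_sub (fun t => F (X t ω)), abs_mul,
        abs_of_nonneg (by positivity : (0 : ℝ) ≤ (T : ℝ)⁻¹)]
      gcongr
      exact (abs_sub _ _).trans (add_le_add (hF _) (hF _))
    have := integral_mono_of_nonneg (μ := μ) (Eventually.of_forall fun ω => abs_nonneg _)
      (integrable_const _) (Eventually.of_forall h1)
    simpa using this
  refine ((hX.negligible_increment (f := fun _ => F) fun _ => hF).add htel.neg).congr fun t ω => ?_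
  ring

/-- Along the chain, a bounded function has the same averages as its conditional expectation `n`
steps earlier. -/
theorem IsPath.negligible_sub_op_iterate (hX : C.IsPath μ X) {F : S → ℝ} {c : ℝ}
    (hF : ∀ x, |F x| ≤ c) (n : ℕ) :
    Negligible μ fun t ω => F (X t ω) - C.op^[n] F (X t ω) := by
  induction n with
  | zero => exact ⟨fun t => by simp, ⟨0, by simp⟩, by simp⟩
  | succ n ih =>
    refine (ih.add (hX.negligible_sub_op (C.abs_op_iterate_le hF n))).congr fun t ω => ?_
    rw [Function.iterate_succ_apply']
    ring

end Path

end NoiseChain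

/-! ### The Poisson equation of a finite chain with a unique stationary law -/

section Poisson

variable {S : Type*} [Fintype S] {M : Matrix S S ℝ} {p : S → ℝ}

/-- If the stationary probability vector is unique, every signed invariant row vector is a multiple
of it: the absolute value of an invariant vector is invariant. -/
theorem eq_smul_of_vecMul_eq (hM0 : ∀ s s', 0 ≤ M s s') (hM1 : ∀ s, ∑ s', M s s' = 1)
    (hu : ∀ p' : S → ℝ, IsStationary M p' → p' = p) {ν : S → ℝ} (hν : ν ᵥ* M = ν) :
    ∃ c : ℝ, ν = c • p := by
  -- nonnegative invariant vectors first
  have hpos : ∀ q : S → ℝ, (∀ s, 0 ≤ q s) → q ᵥ* M = q → ∃ c : ℝ, q = c • p := by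
    intro q hq0 hq
    by_cases hs : ∑ s, q s = 0
    · refine ⟨0, funext fun s => ?_⟩
      simpa using (Finset.sum_eq_zero_iff_of_nonneg fun s _ => hq0 s).1 hs s (Finset.mem_univ s)
    · have hs0 : 0 ≤ ∑ s, q s := Finset.sum_nonneg fun s _ => hq0 s
      refine ⟨∑ s, q s, ?_⟩
      rw [← hu ((∑ s, q s)⁻¹ • q) ⟨fun s => mul_nonneg (inv_nonneg.2 hs0) (hq0 s), ?_, ?_⟩,
        smul_smul, mul_inv_cancel₀ hs, one_smul]
      · simp only [Pi.smul_apply, smul_eq_mul, ← Finset.mul_sum]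
        exact inv_mul_cancel₀ hs
      · rw [Matrix.smul_vecMul, hq]
  have hle : ∀ s', |ν s'| ≤ ((fun s => |ν s|) ᵥ* M) s' := by
    intro s'
    conv_lhs => rw [← hν]
    refine (Finset.abs_sum_le_sum_abs _ _).trans (le_of_eq (Finset.sum_congr rfl fun s _ => ?_))
    rw [abs_mul, abs_of_nonneg (hM0 s s')]
  have hsum : ∑ s', |ν s'| = ∑ s', ((fun s => |ν s|) ᵥ* M) s' := by
    simp only [Matrix.vecMul, dotProduct]
    rw [Finset.sum_comm]
    simp only [← Finset.mul_sum, hM1, mul_one]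
  have habs : (fun s => |ν s|) ᵥ* M = fun s => |ν s| := by
    funext s'
    exact ((Finset.sum_eq_sum_iff_of_le fun s _ => hle s).1 hsum s' (Finset.mem_univ s')).symm
  obtain ⟨c₁, h₁⟩ := hpos _ (fun s => abs_nonneg (ν s)) habs
  obtain ⟨c₂, h₂⟩ := hpos ((fun s => |ν s|) + ν) (fun s => by
    have := neg_abs_le (ν s)
    simp only [Pi.add_apply]
    linarith) (by rw [Matrix.add_vecMul, habs, hν])
  refine ⟨c₂ - c₁, ?_⟩
  rw [sub_smul, ← h₂, ← h₁, add_sub_cancel_left]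

/-- The Poisson equation `g - p g = u - M u` is solvable: a linear functional that vanishes on the
range of `1 - M` is an invariant row vector, hence a multiple of `p`. -/
theorem exists_poisson_solution (hM0 : ∀ s s', 0 ≤ M s s') (hM1 : ∀ s, ∑ s', M s s' = 1)
    (hp : IsStationary M p) (hu : ∀ p' : S → ℝ, IsStationary M p' → p' = p) (g : S → ℝ) :
    ∃ u : S → ℝ, ∀ s, g s - p ⬝ᵥ g = u s - (M *ᵥ u) s := by
  classical
  set R := LinearMap.range (Matrix.toLin' (1 - M)) with hR
  by_cases hg : (fun s => g s - p ⬝ᵥ g) ∈ R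
  · obtain ⟨u, hu'⟩ := hg
    refine ⟨u, fun s => ?_⟩
    have := congrFun hu' s
    simp only [Matrix.toLin'_apply, Matrix.sub_mulVec, Matrix.one_mulVec, Pi.sub_apply] at this
    exact this.symm
  · exfalso
    obtain ⟨φ, hφ, hφR⟩ := Submodule.exists_le_ker_of_notMem hg
    set ν : S → ℝ := fun s => φ (Pi.single s 1) with hν
    have hφν : ∀ f : S → ℝ, φ f = ν ⬝ᵥ f := by
      intro f
      have := LinearMap.pi_apply_eq_sum_univ φ f
      rw [this, dotProduct]
      refine Finset.sum_congr rfl fun s _ => ?_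
      have h1 : (fun j => if s = j then (1 : ℝ) else 0) = Pi.single s 1 := by
        funext j
        simp [Pi.single_apply, eq_comm]
      rw [smul_eq_mul, mul_comm, hν, h1]
    have hinv : ν ᵥ* M = ν := by
      funext s
      have h0 : φ (Matrix.toLin' (1 - M) (Pi.single s 1)) = 0 := hφR ⟨_, rfl⟩
      rw [hφν, Matrix.toLin'_apply, Matrix.dotProduct_mulVec, dotProduct_single, mul_one,
        Matrix.vecMul_sub, Matrix.vecMul_one, Pi.sub_apply, sub_eq_zero] at h0
      exact h0.symm
    obtain ⟨c, hc⟩ := eq_smul_of_vecMul_eq hM0 hM1 hu hinv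
    apply hφ
    rw [hφν, hc, smul_dotProduct]
    have h1 : (fun s => g s - p ⬝ᵥ g) = g - fun _ => p ⬝ᵥ g := rfl
    have h2 : p ⬝ᵥ (fun _ : S => p ⬝ᵥ g) = p ⬝ᵥ g := by
      simp only [dotProduct]
      rw [← Finset.sum_mul, hp.sum_eq_one, one_mul]
    rw [h1, dotProduct_sub, h2, sub_self, smul_zero]

end Poisson

/-! ### The one-step operator of the system -/

theorem DPH.b_eq {N : ℕ} (D : DPH N) (i : Fin N) : D.b i = 1 - ∑ j, D.B i j := by
  rw [DPH.b, Matrix.sub_mulVec, Matrix.one_mulVec]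
  simp [mulVec, dotProduct]

theorem DPH.b_nonneg {N : ℕ} (D : DPH N) (i : Fin N) : 0 ≤ D.b i := by
  rw [D.b_eq]
  linarith [D.B_sum_le i]

theorem serveProb_nonneg {N : ℕ} (D : DPH N) (s : Option (Fin N × ℕ)) (o : Option (Fin N)) :
    0 ≤ serveProb D s o := by
  rcases s with _ | ⟨i, a⟩ <;> rcases o with _ | i' <;> simp [serveProb, D.b_nonneg, D.B_nonneg]

theorem sum_serveProb {N : ℕ} (D : DPH N) (s : Option (Fin N × ℕ)) :
    ∑ o, serveProb D s o = 1 := by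
  rcases s with _ | ⟨i, a⟩ <;> simp [serveProb, Fintype.sum_option, D.b_eq]

instance {N₁ N₂ k : ℕ} : Countable (SysState N₁ N₂ k) := by
  have : Function.Injective fun x : SysState N₁ N₂ k => (x.srv1, x.srv2, x.clock, x.aoi) := by
    intro x y h
    simp only [Prod.mk.injEq] at h
    exact SysState.ext h.1 h.2.1 h.2.2.1 h.2.2.2
  exact this.countable

/-- The randomness of one slot: the outcomes of the two services, and the initial phases on offer to
a packet sampled at the end of the slot. -/
abbrev Noise (N₁ N₂ : ℕ) : Type := Option (Fin N₁) × Option (Fin N₂) × Fin N₁ × Fin N₂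

/-- The system as a Markov chain driven by `Noise`. -/
def sysChain {N₁ N₂ k : ℕ} (D₁ : DPH N₁) (D₂ : DPH N₂) (π : Priority) :
    NoiseChain (SysState N₁ N₂ k) (Noise N₁ N₂) where
  weight x e := serveProb D₁ x.srv1 e.1 * serveProb D₂ x.srv2 e.2.1 * D₁.α e.2.2.1 * D₂.α e.2.2.2
  move x e := next π x e.1 e.2.1 e.2.2.1 e.2.2.2
  weight_nonneg x e := by
    have := serveProb_nonneg D₁ x.srv1 e.1
    have := serveProb_nonneg D₂ x.srv2 e.2.1
    have := D₁.α_nonneg e.2.2.1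
    have := D₂.α_nonneg e.2.2.2
    positivity
  weight_sum x := by
    simp only [Fintype.sum_prod_type, ← Finset.mul_sum, D₂.α_sum, D₁.α_sum, mul_one,
      sum_serveProb]

theorem IsDTDQ.isPath {N₁ N₂ k : ℕ} {D₁ : DPH N₁} {D₂ : DPH N₂} {π : Priority}
    {Ω : Type*} [MeasurableSpace Ω] {μ : Measure Ω} {X : ℕ → Ω → SysState N₁ N₂ k}
    (hX : IsDTDQ D₁ D₂ π μ X) : (sysChain D₁ D₂ π).IsPath μ X where
  measurable := hX.measurable
  markov t x := by
    rw [hX.markov t x]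
    simp only [sysProb, sysChain, Fintype.sum_prod_type]
    congr!

/-- The value after the clock has moved on from `l`: `t` at the next clock reading if the freezing
period is not over, and `e` otherwise. -/
def clk {k : ℕ} (l : Fin k) (t : Fin k → ℝ) (e : ℝ) : ℝ :=
  if h : (l : ℕ) + 1 < k then t ⟨l + 1, h⟩ else e

/-- The mean of `G` at the end of a slot that leaves the servers with contents `s₁`, `s₂` before
the sampling. -/
def settle {N₁ N₂ k : ℕ} (D₁ : DPH N₁) (D₂ : DPH N₂) (π : Priority)
    (G : SysState N₁ N₂ k → ℝ) (l : Fin k) (δ : ℕ) :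
    Option (Fin N₁ × ℕ) → Option (Fin N₂ × ℕ) → ℝ
  | none, none => clk l (fun l' => G ⟨none, none, l', δ⟩)
      (π.ind1 * ∑ i, D₁.α i * G ⟨some (i, 0), none, ⟨0, l.pos⟩, δ⟩ +
        π.ind2 * ∑ j, D₂.α j * G ⟨none, some (j, 0), ⟨0, l.pos⟩, δ⟩)
  | some s, none => clk l (fun l' => G ⟨some s, none, l', δ⟩)
      (∑ j, D₂.α j * G ⟨some s, some (j, 0), ⟨0, l.pos⟩, δ⟩)
  | none, some s => clk l (fun l' => G ⟨none, some s, l', δ⟩)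
      (∑ i, D₁.α i * G ⟨some (i, 0), some s, ⟨0, l.pos⟩, δ⟩)
  | some s, some s' => clk l (fun l' => G ⟨some s, some s', l', δ⟩) (G ⟨some s, some s', l, δ⟩)

section Eval

variable {N₁ N₂ k : ℕ} (D₁ : DPH N₁) (D₂ : DPH N₂) (π : Priority)

/-- The initial phases that are on offer to a packet that is not sampled average out. -/
theorem sum_next_eq_settle (G : SysState N₁ N₂ k → ℝ) (x : SysState N₁ N₂ k)
    (o₁ : Option (Fin N₁)) (o₂ : Option (Fin N₂)) :
    ∑ i, ∑ j, D₁.α i * D₂.α j * G (next π x o₁ o₂ i j) =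
      settle D₁ D₂ π G x.clock (received x.srv1 o₁ (received x.srv2 o₂ (x.aoi + 1)))
        (afterSlot x.srv1 o₁) (afterSlot x.srv2 o₂) := by
  have h1 : ∀ F : Fin N₁ → ℝ, ∑ i, ∑ j, D₁.α i * D₂.α j * F i = ∑ i, D₁.α i * F i := fun F =>
    Finset.sum_congr rfl fun i _ => by
      rw [← Finset.sum_mul, ← Finset.mul_sum, D₂.α_sum, mul_one]
  have h2 : ∀ F : Fin N₂ → ℝ, ∑ i, ∑ j, D₁.α i * D₂.α j * F j = ∑ j, D₂.α j * F j := fun F => by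
    simp only [mul_assoc, ← Finset.mul_sum]
    rw [← Finset.sum_mul, D₁.α_sum, one_mul]
  have h3 : ∀ r : ℝ, ∑ i, ∑ j, D₁.α i * D₂.α j * r = r := fun r => by
    rw [h1, ← Finset.sum_mul, D₁.α_sum, one_mul]
  unfold next
  by_cases hl : (x.clock : ℕ) + 1 < k
  · simp only [hl, dite_true, h3]
    cases afterSlot x.srv1 o₁ <;> cases afterSlot x.srv2 o₂ <;> simp [settle, clk, hl]
  · simp only [hl, dite_false]
    cases afterSlot x.srv1 o₁ <;> cases afterSlot x.srv2 o₂ <;>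
      simp only [settle, clk, hl, dite_false]
    · cases π <;> simp only [h1, h2, Priority.ind1, Priority.ind2] <;> ring
    · exact h1 _
    · exact h2 _
    · exact h3 _

theorem op_sysChain (G : SysState N₁ N₂ k → ℝ) (x : SysState N₁ N₂ k) :
    (sysChain D₁ D₂ π).op G x = ∑ o₁, ∑ o₂, serveProb D₁ x.srv1 o₁ * serveProb D₂ x.srv2 o₂ *
      settle D₁ D₂ π G x.clock (received x.srv1 o₁ (received x.srv2 o₂ (x.aoi + 1)))
        (afterSlot x.srv1 o₁) (afterSlot x.srv2 o₂) := by
  simp only [NoiseChain.op, sysChain, Fintype.sum_prod_type, ← sum_next_eq_settle, Finset.mul_sum,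
    mul_assoc]

theorem op_idle (G : SysState N₁ N₂ k → ℝ) (l : Fin k) (δ : ℕ) :
    (sysChain D₁ D₂ π).op G ⟨none, none, l, δ⟩ = settle D₁ D₂ π G l (δ + 1) none none := by
  simp [op_sysChain, Fintype.sum_option, serveProb, received, afterSlot]

theorem op_busy1 (G : SysState N₁ N₂ k → ℝ) (i : Fin N₁) (a : ℕ) (l : Fin k) (δ : ℕ) :
    (sysChain D₁ D₂ π).op G ⟨some (i, a), none, l, δ⟩ =
      D₁.b i * settle D₁ D₂ π G l (min (δ + 1) (a + 1)) none none +
      ∑ i', D₁.B i i' * settle D₁ D₂ π G l (δ + 1) (some (i', a + 1)) none := by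
  simp [op_sysChain, Fintype.sum_option, serveProb, received, afterSlot]

theorem op_busy2 (G : SysState N₁ N₂ k → ℝ) (j : Fin N₂) (b : ℕ) (l : Fin k) (δ : ℕ) :
    (sysChain D₁ D₂ π).op G ⟨none, some (j, b), l, δ⟩ =
      D₂.b j * settle D₁ D₂ π G l (min (δ + 1) (b + 1)) none none +
      ∑ j', D₂.B j j' * settle D₁ D₂ π G l (δ + 1) none (some (j', b + 1)) := by
  simp [op_sysChain, Fintype.sum_option, serveProb, received, afterSlot]

theorem op_both (G : SysState N₁ N₂ k → ℝ) (i : Fin N₁) (a : ℕ) (j : Fin N₂) (b : ℕ) (l : Fin k)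
    (δ : ℕ) :
    (sysChain D₁ D₂ π).op G ⟨some (i, a), some (j, b), l, δ⟩ =
      D₁.b i * D₂.b j * settle D₁ D₂ π G l (min (min (δ + 1) (b + 1)) (a + 1)) none none +
      ∑ j', D₁.b i * D₂.B j j' *
        settle D₁ D₂ π G l (min (δ + 1) (a + 1)) none (some (j', b + 1)) +
      ∑ i', D₂.b j * D₁.B i i' *
        settle D₁ D₂ π G l (min (δ + 1) (b + 1)) (some (i', a + 1)) none +
      ∑ i', ∑ j', D₁.B i i' * D₂.B j j' *
        settle D₁ D₂ π G l (δ + 1) (some (i', a + 1)) (some (j', b + 1)) := by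
  simp only [op_sysChain, Fintype.sum_option, serveProb, received, afterSlot,
    Finset.sum_add_distrib]
  simp only [mul_comm (D₂.b j)]
  ring

/-! ### The occupancy chain as an image of the system -/

/-- The occupancies, phases and clock of a state of the system. -/
def occupancy : SysState N₁ N₂ k → WState N₁ N₂ k
  | ⟨none, none, l, _⟩ => .idle l
  | ⟨some (i, _), none, l, _⟩ => .busy1 i l
  | ⟨none, some (j, _), l, _⟩ => .busy2 j l
  | ⟨some (i, _), some (j, _), l, _⟩ => .both i j l

/-- `WState` as a sum type. -/
def wEquiv : WState N₁ N₂ k ≃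
    Fin k ⊕ (Fin N₁ × Fin k) ⊕ (Fin N₂ × Fin k) ⊕ (Fin N₁ × Fin N₂ × Fin k) where
  toFun
    | .idle l => .inl l
    | .busy1 i l => .inr (.inl (i, l))
    | .busy2 j l => .inr (.inr (.inl (j, l)))
    | .both i j l => .inr (.inr (.inr (i, j, l)))
  invFun
    | .inl l => .idle l
    | .inr (.inl (i, l)) => .busy1 i l
    | .inr (.inr (.inl (j, l))) => .busy2 j l
    | .inr (.inr (.inr (i, j, l))) => .both i j l
  left_inv w := by cases w <;> rfl
  right_inv w := by rcases w with _ | _ | _ | _ <;> rfl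

theorem sum_wState (g : WState N₁ N₂ k → ℝ) :
    ∑ w, g w = ∑ l, g (.idle l) + (∑ i, ∑ l, g (.busy1 i l) + (∑ j, ∑ l, g (.busy2 j l) +
      ∑ i, ∑ j, ∑ l, g (.both i j l))) := by
  rw [← wEquiv.symm.sum_comp]
  simp [Fintype.sum_sum_type, Fintype.sum_prod_type, wEquiv]

theorem tick_of_lt {l : Fin k} (h : (l : ℕ) + 1 < k) (l' : Fin k) :
    tick l l' = if l' = ⟨l + 1, h⟩ then 1 else 0 := by
  simp [tick, Fin.ext_iff]

theorem tick_of_not_lt {l : Fin k} (h : ¬(l : ℕ) + 1 < k) (l' : Fin k) : tick l l' = 0 := by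
  have := l'.isLt
  simp only [tick, ite_eq_right_iff]
  omega

theorem reset_of_lt {l : Fin k} (h : (l : ℕ) + 1 < k) (l' : Fin k) : reset l l' = 0 := by
  simp only [reset, ite_eq_right_iff]
  omega

theorem reset_of_not_lt {l : Fin k} (h : ¬(l : ℕ) + 1 < k) (l' : Fin k) :
    reset l l' = if l' = ⟨0, l.pos⟩ then 1 else 0 := by
  have := l.isLt
  have h' : (l : ℕ) + 1 = k := by omega
  simp [reset, Fin.ext_iff, h']

theorem hold_of_lt {l : Fin k} (h : (l : ℕ) + 1 < k) (l' : Fin k) : hold l l' = 0 := by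
  simp only [hold, ite_eq_right_iff]
  omega

theorem hold_of_not_lt {l : Fin k} (h : ¬(l : ℕ) + 1 < k) (l' : Fin k) :
    hold l l' = if l' = l then 1 else 0 := by
  have := l.isLt
  have h' : (l : ℕ) + 1 = k := by omega
  simp [hold, h']

theorem expired_of_lt {l : Fin k} (h : (l : ℕ) + 1 < k) : expired l = 0 := by
  simp only [expired, ite_eq_right_iff]
  omega

theorem expired_of_not_lt {l : Fin k} (h : ¬(l : ℕ) + 1 < k) : expired l = 1 := by
  have := l.isLt
  simp only [expired, ite_eq_left_iff]
  omega

theorem wMatrix_mulVec_idle (g : WState N₁ N₂ k → ℝ) (l : Fin k) :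
    (wMatrix D₁ D₂ π *ᵥ g) (.idle l) = clk l (fun l' => g (.idle l'))
      (π.ind1 * ∑ i, D₁.α i * g (.busy1 i ⟨0, l.pos⟩) +
        π.ind2 * ∑ j, D₂.α j * g (.busy2 j ⟨0, l.pos⟩)) := by
  by_cases hl : (l : ℕ) + 1 < k
  · simp [clk, hl, mulVec, dotProduct, sum_wState, wMatrix, tick_of_lt hl, reset_of_lt hl]
  · simp [clk, hl, mulVec, dotProduct, sum_wState, wMatrix, tick_of_not_lt hl,
      reset_of_not_lt hl, Finset.mul_sum, mul_assoc]

/-- If the packet in service is received, the chain continues as from the idle state. -/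
theorem wMatrix_mulVec_busy1 (g : WState N₁ N₂ k → ℝ) (i : Fin N₁) (l : Fin k) :
    (wMatrix D₁ D₂ π *ᵥ g) (.busy1 i l) = D₁.b i * (wMatrix D₁ D₂ π *ᵥ g) (.idle l) +
      ∑ i', D₁.B i i' * clk l (fun l' => g (.busy1 i' l'))
        (∑ j, D₂.α j * g (.both i' j ⟨0, l.pos⟩)) := by
  rw [wMatrix_mulVec_idle]
  by_cases hl : (l : ℕ) + 1 < k
  · simp [clk, hl, mulVec, dotProduct, sum_wState, wMatrix, tick_of_lt hl, reset_of_lt hl]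
  · simp [clk, hl, mulVec, dotProduct, sum_wState, wMatrix, tick_of_not_lt hl,
      reset_of_not_lt hl, Finset.mul_sum, mul_assoc, mul_add, mul_left_comm (D₁.b i), add_assoc]

theorem wMatrix_mulVec_busy2 (g : WState N₁ N₂ k → ℝ) (j : Fin N₂) (l : Fin k) :
    (wMatrix D₁ D₂ π *ᵥ g) (.busy2 j l) = D₂.b j * (wMatrix D₁ D₂ π *ᵥ g) (.idle l) +
      ∑ j', D₂.B j j' * clk l (fun l' => g (.busy2 j' l'))
        (∑ i, D₁.α i * g (.both i j' ⟨0, l.pos⟩)) := by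
  rw [wMatrix_mulVec_idle]
  by_cases hl : (l : ℕ) + 1 < k
  · simp [clk, hl, mulVec, dotProduct, sum_wState, wMatrix, tick_of_lt hl, reset_of_lt hl]
  · simp [clk, hl, mulVec, dotProduct, sum_wState, wMatrix, tick_of_not_lt hl,
      reset_of_not_lt hl, Finset.mul_sum, mul_assoc, mul_add, mul_left_comm (D₂.b j), add_assoc]
    exact Finset.sum_comm

theorem wMatrix_mulVec_both (g : WState N₁ N₂ k → ℝ) (i : Fin N₁) (j : Fin N₂) (l : Fin k) :
    (wMatrix D₁ D₂ π *ᵥ g) (.both i j l) =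
      D₁.b i * D₂.b j * (wMatrix D₁ D₂ π *ᵥ g) (.idle l) +
      ∑ j', D₁.b i * D₂.B j j' * clk l (fun l' => g (.busy2 j' l'))
        (∑ i, D₁.α i * g (.both i j' ⟨0, l.pos⟩)) +
      ∑ i', D₂.b j * D₁.B i i' * clk l (fun l' => g (.busy1 i' l'))
        (∑ j, D₂.α j * g (.both i' j ⟨0, l.pos⟩)) +
      ∑ i', ∑ j', D₁.B i i' * D₂.B j j' *
        clk l (fun l' => g (.both i' j' l')) (g (.both i' j' l)) := by
  rw [wMatrix_mulVec_idle]
  by_cases hl : (l : ℕ) + 1 < k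
  · simp [clk, hl, mulVec, dotProduct, sum_wState, wMatrix, tick_of_lt hl, reset_of_lt hl,
      hold_of_lt hl]
    ring
  · simp [clk, hl, mulVec, dotProduct, sum_wState, wMatrix, tick_of_not_lt hl,
      reset_of_not_lt hl, hold_of_not_lt hl, Finset.mul_sum, Finset.sum_add_distrib, add_mul,
      mul_add]
    rw [Finset.sum_comm (γ := Fin N₁) (α := Fin N₂)]
    ring_nf

/-- The occupancy chain is the image of the system under `occupancy`. -/
theorem op_comp_occupancy (g : WState N₁ N₂ k → ℝ) (x : SysState N₁ N₂ k) :
    (sysChain D₁ D₂ π).op (fun y => g (occupancy y)) x =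
      (wMatrix D₁ D₂ π *ᵥ g) (occupancy x) := by
  obtain ⟨_ | ⟨i, a⟩, _ | ⟨j, b⟩, l, δ⟩ := x
  · simp [op_idle, settle, occupancy, wMatrix_mulVec_idle]
  · simp [op_busy2, settle, occupancy, wMatrix_mulVec_busy2, wMatrix_mulVec_idle]
  · simp [op_busy1, settle, occupancy, wMatrix_mulVec_busy1, wMatrix_mulVec_idle]
  · simp [op_both, settle, occupancy, wMatrix_mulVec_both, wMatrix_mulVec_idle]

end Eval

/-! ### The matrix of the absorbing chain, row by row -/

section Eval

variable {N₁ N₂ k : ℕ} (D₁ : DPH N₁) (D₂ : DPH N₂) (π : Priority)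

/-- `YState` as a sum type. -/
def yEquiv : YState N₁ N₂ k ≃
    (Fin N₁ × Fin N₂ × Fin k) ⊕ (Fin N₁ × Fin N₂ × Fin k) ⊕ (Fin N₁ × Fin N₂ × Fin k) ⊕
      (Fin N₁ × Fin N₂ × Fin k) ⊕ (Fin N₁ × Fin k) ⊕ (Fin N₂ × Fin k) ⊕ Fin k ⊕
      (Fin N₁ × Fin N₂) ⊕ (Fin N₁ × Fin k) ⊕ (Fin N₂ × Fin k) ⊕ (Fin N₁ × Fin N₂ × Fin k) ⊕
      (Fin N₁ × Fin N₂ × Fin k) ⊕ (Fin N₁ × Fin k) ⊕ (Fin N₂ × Fin k) where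
  toFun
    | .c1 i j l => .inl (i, j, l)
    | .c2 i j l => .inr (.inl (i, j, l))
    | .c3 i j l => .inr (.inr (.inl (i, j, l)))
    | .c4 i j l => .inr (.inr (.inr (.inl (i, j, l))))
    | .c5 i l => .inr (.inr (.inr (.inr (.inl (i, l)))))
    | .c6 j l => .inr (.inr (.inr (.inr (.inr (.inl (j, l))))))
    | .c7 l => .inr (.inr (.inr (.inr (.inr (.inr (.inl l))))))
    | .c8 i j => .inr (.inr (.inr (.inr (.inr (.inr (.inr (.inl (i, j))))))))
    | .c9 i l => .inr (.inr (.inr (.inr (.inr (.inr (.inr (.inr (.inl (i, l)))))))))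
    | .c10 j l => .inr (.inr (.inr (.inr (.inr (.inr (.inr (.inr (.inr (.inl (j, l))))))))))
    | .c11 i j l =>
      .inr (.inr (.inr (.inr (.inr (.inr (.inr (.inr (.inr (.inr (.inl (i, j, l)))))))))))
    | .c12 i j l =>
      .inr (.inr (.inr (.inr (.inr (.inr (.inr (.inr (.inr (.inr (.inr (.inl (i, j, l))))))))))))
    | .c13 i l =>
      .inr (.inr (.inr (.inr (.inr (.inr (.inr (.inr (.inr (.inr (.inr (.inr
        (.inl (i, l)))))))))))))
    | .c14 j l =>
      .inr (.inr (.inr (.inr (.inr (.inr (.inr (.inr (.inr (.inr (.inr (.inr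
        (.inr (j, l)))))))))))))
  invFun
    | .inl (i, j, l) => .c1 i j l
    | .inr (.inl (i, j, l)) => .c2 i j l
    | .inr (.inr (.inl (i, j, l))) => .c3 i j l
    | .inr (.inr (.inr (.inl (i, j, l)))) => .c4 i j l
    | .inr (.inr (.inr (.inr (.inl (i, l))))) => .c5 i l
    | .inr (.inr (.inr (.inr (.inr (.inl (j, l)))))) => .c6 j l
    | .inr (.inr (.inr (.inr (.inr (.inr (.inl l)))))) => .c7 l
    | .inr (.inr (.inr (.inr (.inr (.inr (.inr (.inl (i, j)))))))) => .c8 i j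
    | .inr (.inr (.inr (.inr (.inr (.inr (.inr (.inr (.inl (i, l))))))))) => .c9 i l
    | .inr (.inr (.inr (.inr (.inr (.inr (.inr (.inr (.inr (.inl (j, l)))))))))) => .c10 j l
    | .inr (.inr (.inr (.inr (.inr (.inr (.inr (.inr (.inr (.inr (.inl (i, j, l))))))))))) =>
      .c11 i j l
    | .inr (.inr (.inr (.inr (.inr (.inr (.inr (.inr (.inr (.inr (.inr (.inl (i, j, l)))))))))))) =>
      .c12 i j l
    | .inr (.inr (.inr (.inr (.inr (.inr (.inr (.inr (.inr (.inr (.inr (.inr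
        (.inl (i, l))))))))))))) => .c13 i l
    | .inr (.inr (.inr (.inr (.inr (.inr (.inr (.inr (.inr (.inr (.inr (.inr
        (.inr (j, l))))))))))))) => .c14 j l
  left_inv y := by cases y <;> rfl
  right_inv y := by rcases y with _ | _ | _ | _ | _ | _ | _ | _ | _ | _ | _ | _ | _ | _ <;> rfl

theorem sum_yState (g : YState N₁ N₂ k → ℝ) :
    ∑ y, g y = ∑ i, ∑ j, ∑ l, g (.c1 i j l) + (∑ i, ∑ j, ∑ l, g (.c2 i j l) +
      (∑ i, ∑ j, ∑ l, g (.c3 i j l) + (∑ i, ∑ j, ∑ l, g (.c4 i j l) +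
      (∑ i, ∑ l, g (.c5 i l) + (∑ j, ∑ l, g (.c6 j l) + (∑ l, g (.c7 l) +
      (∑ i, ∑ j, g (.c8 i j) + (∑ i, ∑ l, g (.c9 i l) + (∑ j, ∑ l, g (.c10 j l) +
      (∑ i, ∑ j, ∑ l, g (.c11 i j l) + (∑ i, ∑ j, ∑ l, g (.c12 i j l) +
      (∑ i, ∑ l, g (.c13 i l) + ∑ j, ∑ l, g (.c14 j l))))))))))))) := by
  rw [← yEquiv.symm.sum_comp]
  simp [Fintype.sum_sum_type, Fintype.sum_prod_type, yEquiv]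

variable (f : YState N₁ N₂ k → ℝ)

theorem yMatrix_mulVec_c7 (l : Fin k) :
    (yMatrix D₁ D₂ π *ᵥ f) (.c7 l) = clk l (fun l' => f (.c7 l'))
      (π.ind1 * ∑ i, D₁.α i * f (.c13 i ⟨0, l.pos⟩) +
        π.ind2 * ∑ j, D₂.α j * f (.c14 j ⟨0, l.pos⟩)) := by
  by_cases hl : (l : ℕ) + 1 < k
  · simp [clk, hl, mulVec, dotProduct, sum_yState, yMatrix, tick_of_lt hl, reset_of_lt hl]
  · simp [clk, hl, mulVec, dotProduct, sum_yState, yMatrix, tick_of_not_lt hl,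
      reset_of_not_lt hl, Finset.mul_sum, mul_assoc]

theorem yMatrix_mulVec_c8 (i : Fin N₁) (j : Fin N₂) :
    (yMatrix D₁ D₂ π *ᵥ f) (.c8 i j) = ∑ i', ∑ j', D₁.B i i' * D₂.B j j' * f (.c8 i' j') := by
  simp [mulVec, dotProduct, sum_yState, yMatrix]

theorem yMatrix_mulVec_c13 (i : Fin N₁) (l : Fin k) :
    (yMatrix D₁ D₂ π *ᵥ f) (.c13 i l) =
      ∑ i', D₁.B i i' * clk l (fun l' => f (.c13 i' l')) (∑ j, D₂.α j * f (.c8 i' j)) := by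
  by_cases hl : (l : ℕ) + 1 < k
  · simp [clk, hl, mulVec, dotProduct, sum_yState, yMatrix, tick_of_lt hl, expired_of_lt hl]
  · simp [clk, hl, mulVec, dotProduct, sum_yState, yMatrix, tick_of_not_lt hl,
      expired_of_not_lt hl, Finset.mul_sum, mul_assoc]

theorem yMatrix_mulVec_c14 (j : Fin N₂) (l : Fin k) :
    (yMatrix D₁ D₂ π *ᵥ f) (.c14 j l) =
      ∑ j', D₂.B j j' * clk l (fun l' => f (.c14 j' l')) (∑ i, D₁.α i * f (.c8 i j')) := by
  by_cases hl : (l : ℕ) + 1 < k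
  · simp [clk, hl, mulVec, dotProduct, sum_yState, yMatrix, tick_of_lt hl, expired_of_lt hl]
  · simp [clk, hl, mulVec, dotProduct, sum_yState, yMatrix, tick_of_not_lt hl,
      expired_of_not_lt hl, Finset.mul_sum, mul_assoc]
    exact Finset.sum_comm

theorem yMatrix_mulVec_c9 (i : Fin N₁) (l : Fin k) :
    (yMatrix D₁ D₂ π *ᵥ f) (.c9 i l) = D₁.b i * (yMatrix D₁ D₂ π *ᵥ f) (.c7 l) +
      ∑ i', D₁.B i i' * clk l (fun l' => f (.c9 i' l'))
        (∑ j, D₂.α j * f (.c12 i' j ⟨0, l.pos⟩)) := by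
  rw [yMatrix_mulVec_c7]
  by_cases hl : (l : ℕ) + 1 < k
  · simp [clk, hl, mulVec, dotProduct, sum_yState, yMatrix, tick_of_lt hl, reset_of_lt hl]
  · simp [clk, hl, mulVec, dotProduct, sum_yState, yMatrix, tick_of_not_lt hl,
      reset_of_not_lt hl, Finset.mul_sum, mul_assoc, mul_add, mul_left_comm (D₁.b i)]
    ring

theorem yMatrix_mulVec_c10 (j : Fin N₂) (l : Fin k) :
    (yMatrix D₁ D₂ π *ᵥ f) (.c10 j l) = D₂.b j * (yMatrix D₁ D₂ π *ᵥ f) (.c7 l) +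
      ∑ j', D₂.B j j' * clk l (fun l' => f (.c10 j' l'))
        (∑ i, D₁.α i * f (.c11 i j' ⟨0, l.pos⟩)) := by
  rw [yMatrix_mulVec_c7]
  by_cases hl : (l : ℕ) + 1 < k
  · simp [clk, hl, mulVec, dotProduct, sum_yState, yMatrix, tick_of_lt hl, reset_of_lt hl]
  · simp [clk, hl, mulVec, dotProduct, sum_yState, yMatrix, tick_of_not_lt hl,
      reset_of_not_lt hl, Finset.mul_sum, mul_assoc, mul_add, mul_left_comm (D₂.b j)]
    rw [Finset.sum_comm (γ := Fin N₁) (α := Fin N₂)]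
    ring

theorem yMatrix_mulVec_c5 (i : Fin N₁) (l : Fin k) :
    (yMatrix D₁ D₂ π *ᵥ f) (.c5 i l) = D₁.b i * (yMatrix D₁ D₂ π *ᵥ f) (.c7 l) +
      ∑ i', D₁.B i i' * clk l (fun l' => f (.c5 i' l'))
        (∑ j, D₂.α j * f (.c2 i' j ⟨0, l.pos⟩)) := by
  rw [yMatrix_mulVec_c7]
  by_cases hl : (l : ℕ) + 1 < k
  · simp [clk, hl, mulVec, dotProduct, sum_yState, yMatrix, tick_of_lt hl, reset_of_lt hl]
    ring
  · simp [clk, hl, mulVec, dotProduct, sum_yState, yMatrix, tick_of_not_lt hl,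
      reset_of_not_lt hl, Finset.mul_sum, mul_assoc, mul_add, mul_left_comm (D₁.b i)]
    ring

theorem yMatrix_mulVec_c6 (j : Fin N₂) (l : Fin k) :
    (yMatrix D₁ D₂ π *ᵥ f) (.c6 j l) = D₂.b j * (yMatrix D₁ D₂ π *ᵥ f) (.c7 l) +
      ∑ j', D₂.B j j' * clk l (fun l' => f (.c6 j' l'))
        (∑ i, D₁.α i * f (.c3 i j' ⟨0, l.pos⟩)) := by
  rw [yMatrix_mulVec_c7]
  by_cases hl : (l : ℕ) + 1 < k
  · simp [clk, hl, mulVec, dotProduct, sum_yState, yMatrix, tick_of_lt hl, reset_of_lt hl]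
    ring
  · simp [clk, hl, mulVec, dotProduct, sum_yState, yMatrix, tick_of_not_lt hl,
      reset_of_not_lt hl, Finset.mul_sum, mul_assoc, mul_add, mul_left_comm (D₂.b j)]
    rw [Finset.sum_comm (γ := Fin N₁) (α := Fin N₂)]
    ring

theorem yMatrix_mulVec_c11 (i : Fin N₁) (j : Fin N₂) (l : Fin k) :
    (yMatrix D₁ D₂ π *ᵥ f) (.c11 i j l) =
      ∑ i', D₂.b j * D₁.B i i' * clk l (fun l' => f (.c13 i' l')) (∑ j, D₂.α j * f (.c8 i' j)) +
      ∑ i', ∑ j', D₁.B i i' * D₂.B j j' *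
        clk l (fun l' => f (.c11 i' j' l')) (f (.c11 i' j' l)) := by
  by_cases hl : (l : ℕ) + 1 < k
  · simp [clk, hl, mulVec, dotProduct, sum_yState, yMatrix, tick_of_lt hl, expired_of_lt hl,
      hold_of_lt hl]
    ring
  · simp [clk, hl, mulVec, dotProduct, sum_yState, yMatrix, tick_of_not_lt hl,
      expired_of_not_lt hl, hold_of_not_lt hl, Finset.mul_sum, mul_assoc]

theorem yMatrix_mulVec_c3 (i : Fin N₁) (j : Fin N₂) (l : Fin k) :
    (yMatrix D₁ D₂ π *ᵥ f) (.c3 i j l) =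
      ∑ i', D₂.b j * D₁.B i i' * clk l (fun l' => f (.c13 i' l')) (∑ j, D₂.α j * f (.c8 i' j)) +
      ∑ i', ∑ j', D₁.B i i' * D₂.B j j' *
        clk l (fun l' => f (.c3 i' j' l')) (f (.c3 i' j' l)) := by
  by_cases hl : (l : ℕ) + 1 < k
  · simp [clk, hl, mulVec, dotProduct, sum_yState, yMatrix, tick_of_lt hl, expired_of_lt hl,
      hold_of_lt hl]
    ring
  · simp [clk, hl, mulVec, dotProduct, sum_yState, yMatrix, tick_of_not_lt hl,
      expired_of_not_lt hl, hold_of_not_lt hl, Finset.mul_sum, mul_assoc]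
    ring

theorem yMatrix_mulVec_c12 (i : Fin N₁) (j : Fin N₂) (l : Fin k) :
    (yMatrix D₁ D₂ π *ᵥ f) (.c12 i j l) =
      ∑ j', D₁.b i * D₂.B j j' * clk l (fun l' => f (.c14 j' l')) (∑ i, D₁.α i * f (.c8 i j')) +
      ∑ i', ∑ j', D₁.B i i' * D₂.B j j' *
        clk l (fun l' => f (.c12 i' j' l')) (f (.c12 i' j' l)) := by
  by_cases hl : (l : ℕ) + 1 < k
  · simp [clk, hl, mulVec, dotProduct, sum_yState, yMatrix, tick_of_lt hl, expired_of_lt hl,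
      hold_of_lt hl]
    ring
  · simp [clk, hl, mulVec, dotProduct, sum_yState, yMatrix, tick_of_not_lt hl,
      expired_of_not_lt hl, hold_of_not_lt hl, Finset.mul_sum, mul_assoc]
    rw [Finset.sum_comm (γ := Fin N₁) (α := Fin N₂)]

theorem yMatrix_mulVec_c2 (i : Fin N₁) (j : Fin N₂) (l : Fin k) :
    (yMatrix D₁ D₂ π *ᵥ f) (.c2 i j l) =
      ∑ j', D₁.b i * D₂.B j j' * clk l (fun l' => f (.c14 j' l')) (∑ i, D₁.α i * f (.c8 i j')) +
      ∑ i', ∑ j', D₁.B i i' * D₂.B j j' *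
        clk l (fun l' => f (.c2 i' j' l')) (f (.c2 i' j' l)) := by
  by_cases hl : (l : ℕ) + 1 < k
  · simp [clk, hl, mulVec, dotProduct, sum_yState, yMatrix, tick_of_lt hl, expired_of_lt hl,
      hold_of_lt hl]
    ring
  · simp [clk, hl, mulVec, dotProduct, sum_yState, yMatrix, tick_of_not_lt hl,
      expired_of_not_lt hl, hold_of_not_lt hl, Finset.mul_sum, mul_assoc]
    conv_rhs => rw [Finset.sum_comm (γ := Fin N₂) (α := Fin N₁)]
    ring

theorem yMatrix_mulVec_c1 (i : Fin N₁) (j : Fin N₂) (l : Fin k) :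
    (yMatrix D₁ D₂ π *ᵥ f) (.c1 i j l) =
      D₁.b i * D₂.b j * (yMatrix D₁ D₂ π *ᵥ f) (.c7 l) +
      ∑ j', D₁.b i * D₂.B j j' * clk l (fun l' => f (.c10 j' l'))
        (∑ i, D₁.α i * f (.c11 i j' ⟨0, l.pos⟩)) +
      ∑ i', D₂.b j * D₁.B i i' * clk l (fun l' => f (.c5 i' l'))
        (∑ j, D₂.α j * f (.c2 i' j ⟨0, l.pos⟩)) +
      ∑ i', ∑ j', D₁.B i i' * D₂.B j j' *
        clk l (fun l' => f (.c1 i' j' l')) (f (.c1 i' j' l)) := by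
  rw [yMatrix_mulVec_c7]
  by_cases hl : (l : ℕ) + 1 < k
  · simp [clk, hl, mulVec, dotProduct, sum_yState, yMatrix, tick_of_lt hl, reset_of_lt hl,
      hold_of_lt hl]
    ring
  · simp [clk, hl, mulVec, dotProduct, sum_yState, yMatrix, tick_of_not_lt hl,
      reset_of_not_lt hl, hold_of_not_lt hl, Finset.mul_sum, mul_add]
    conv_rhs => rw [Finset.sum_comm (γ := Fin N₂) (α := Fin N₁)]
    ring_nf

theorem yMatrix_mulVec_c4 (i : Fin N₁) (j : Fin N₂) (l : Fin k) :
    (yMatrix D₁ D₂ π *ᵥ f) (.c4 i j l) =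
      D₁.b i * D₂.b j * (yMatrix D₁ D₂ π *ᵥ f) (.c7 l) +
      ∑ j', D₁.b i * D₂.B j j' * clk l (fun l' => f (.c6 j' l'))
        (∑ i, D₁.α i * f (.c3 i j' ⟨0, l.pos⟩)) +
      ∑ i', D₂.b j * D₁.B i i' * clk l (fun l' => f (.c9 i' l'))
        (∑ j, D₂.α j * f (.c12 i' j ⟨0, l.pos⟩)) +
      ∑ i', ∑ j', D₁.B i i' * D₂.B j j' *
        clk l (fun l' => f (.c4 i' j' l')) (f (.c4 i' j' l)) := by
  rw [yMatrix_mulVec_c7]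
  by_cases hl : (l : ℕ) + 1 < k
  · simp [clk, hl, mulVec, dotProduct, sum_yState, yMatrix, tick_of_lt hl, reset_of_lt hl,
      hold_of_lt hl]
    ring
  · simp [clk, hl, mulVec, dotProduct, sum_yState, yMatrix, tick_of_not_lt hl,
      reset_of_not_lt hl, hold_of_not_lt hl, Finset.mul_sum, mul_add]
    rw [Finset.sum_comm (γ := Fin N₁) (α := Fin N₂)]
    ring_nf

end Eval

/-! ### Following a packet through the system -/

section Track

variable {N₁ N₂ k : ℕ}

/-- The state of the absorbing chain of the packet of age `h`, read off from the state of the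
system; `none` if the chain has been absorbed, or if there is no such packet. -/
def track (h : ℕ) : SysState N₁ N₂ k → Option (YState N₁ N₂ k)
  | ⟨none, none, l, δ⟩ => if δ = h then some (.c7 l) else none
  | ⟨some (i, a), none, l, δ⟩ =>
    if δ = h then (if a < h then some (.c13 i l) else some (.c9 i l))
    else if h < δ ∧ a = h then some (.c5 i l) else none
  | ⟨none, some (j, b), l, δ⟩ =>
    if δ = h then (if b < h then some (.c14 j l) else some (.c10 j l))
    else if h < δ ∧ b = h then some (.c6 j l) else none
  | ⟨some (i, a), some (j, b), l, δ⟩ =>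
    if δ = h then
      if a < h then (if b < h then some (.c8 i j) else some (.c11 i j l))
      else if b < h then some (.c12 i j l) else none
    else if h < δ then
      if a = h then
        (if b < h then some (.c2 i j l) else if h < b then some (.c1 i j l) else none)
      else if b = h then (if a < h then some (.c3 i j l) else some (.c4 i j l)) else none
    else none

/-- The condition on a state that `track h` describes the packet of age `h` correctly: if both
packets in service are at least as old, then they are not both obsolete while the packet of age `h`
is the freshest received one, and they do not both have the age `h`. It holds when a packet is
sampled (`regular_zero_next`), and it persists (`regular_next`). -/
def Regular (h : ℕ) : SysState N₁ N₂ k → Prop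
  | ⟨some (_, a), some (_, b), _, δ⟩ => h ≤ a → h ≤ b → δ ≠ h ∧ (a ≠ h ∨ b ≠ h)
  | _ => True

section Values

variable {h a b δ : ℕ} {i : Fin N₁} {j : Fin N₂} {l : Fin k}

theorem track_idle (e : δ = h) :
    track h (⟨none, none, l, δ⟩ : SysState N₁ N₂ k) = some (.c7 l) := by simp [track, e]

theorem track_idle_none (e : δ ≠ h) :
    track h (⟨none, none, l, δ⟩ : SysState N₁ N₂ k) = none := by simp [track, e]

theorem track_c13 (e : δ = h) (ea : a < h) :
    track h (⟨some (i, a), none, l, δ⟩ : SysState N₁ N₂ k) = some (.c13 i l) := by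
  simp [track, e, ea]

theorem track_c9 (e : δ = h) (ea : h ≤ a) :
    track h (⟨some (i, a), none, l, δ⟩ : SysState N₁ N₂ k) = some (.c9 i l) := by
  simp [track, e, ea]

theorem track_c5 (e : h < δ) (ea : a = h) :
    track h (⟨some (i, a), none, l, δ⟩ : SysState N₁ N₂ k) = some (.c5 i l) := by
  simp [track, e, e.ne', ea]

theorem track_busy1_none (e : δ < h ∨ h < δ ∧ a ≠ h) :
    track h (⟨some (i, a), none, l, δ⟩ : SysState N₁ N₂ k) = none := by
  simp only [track]
  split_ifs <;> first | rfl | omega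

theorem track_c14 (e : δ = h) (eb : b < h) :
    track h (⟨none, some (j, b), l, δ⟩ : SysState N₁ N₂ k) = some (.c14 j l) := by
  simp [track, e, eb]

theorem track_c10 (e : δ = h) (eb : h ≤ b) :
    track h (⟨none, some (j, b), l, δ⟩ : SysState N₁ N₂ k) = some (.c10 j l) := by
  simp [track, e, eb]

theorem track_c6 (e : h < δ) (eb : b = h) :
    track h (⟨none, some (j, b), l, δ⟩ : SysState N₁ N₂ k) = some (.c6 j l) := by
  simp [track, e, e.ne', eb]

theorem track_busy2_none (e : δ < h ∨ h < δ ∧ b ≠ h) :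
    track h (⟨none, some (j, b), l, δ⟩ : SysState N₁ N₂ k) = none := by
  simp only [track]
  split_ifs <;> first | rfl | omega

theorem track_c8 (e : δ = h) (ea : a < h) (eb : b < h) :
    track h (⟨some (i, a), some (j, b), l, δ⟩ : SysState N₁ N₂ k) = some (.c8 i j) := by
  simp [track, e, ea, eb]

theorem track_c11 (e : δ = h) (ea : a < h) (eb : h ≤ b) :
    track h (⟨some (i, a), some (j, b), l, δ⟩ : SysState N₁ N₂ k) = some (.c11 i j l) := by
  simp [track, e, ea, eb]

theorem track_c12 (e : δ = h) (ea : h ≤ a) (eb : b < h) :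
    track h (⟨some (i, a), some (j, b), l, δ⟩ : SysState N₁ N₂ k) = some (.c12 i j l) := by
  simp [track, e, ea, eb]

theorem track_c2 (e : h < δ) (ea : a = h) (eb : b < h) :
    track h (⟨some (i, a), some (j, b), l, δ⟩ : SysState N₁ N₂ k) = some (.c2 i j l) := by
  simp [track, e, e.ne', ea, eb]

theorem track_c1 (e : h < δ) (ea : a = h) (eb : h < b) :
    track h (⟨some (i, a), some (j, b), l, δ⟩ : SysState N₁ N₂ k) = some (.c1 i j l) := by
  simp [track, e, e.ne', ea, eb, eb.not_gt]

theorem track_c3 (e : h < δ) (ea : a < h) (eb : b = h) :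
    track h (⟨some (i, a), some (j, b), l, δ⟩ : SysState N₁ N₂ k) = some (.c3 i j l) := by
  simp [track, e, e.ne', ea, ea.ne, eb]

theorem track_c4 (e : h < δ) (ea : h < a) (eb : b = h) :
    track h (⟨some (i, a), some (j, b), l, δ⟩ : SysState N₁ N₂ k) = some (.c4 i j l) := by
  simp [track, e, e.ne', ea.ne', ea.not_gt, eb]

theorem track_both_none (e : δ < h ∨ h < δ ∧ a ≠ h ∧ b ≠ h) :
    track h (⟨some (i, a), some (j, b), l, δ⟩ : SysState N₁ N₂ k) = none := by
  simp only [track]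
  split_ifs <;> first | rfl | omega

end Values

/-- The function `f` of the absorbing chain of the packet of age `h`, as a function of the state of
the system; its value is `0` after absorption. -/
def trackVal (h : ℕ) (f : YState N₁ N₂ k → ℝ) (x : SysState N₁ N₂ k) : ℝ := (track h x).elim 0 f

variable (D₁ : DPH N₁) (D₂ : DPH N₂) (π : Priority)

theorem clk_const (l : Fin k) (r : ℝ) : clk l (fun _ => r) r = r := by
  simp [clk]

/-- The chain `Y` describes the fate of a packet: the conditional expectation, one slot earlier, of
a function `f` of its state is given by the matrix of `Y`. -/
theorem op_trackVal {h : ℕ} {x : SysState N₁ N₂ k} (hx : Regular h x) (f : YState N₁ N₂ k → ℝ) :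
    (sysChain D₁ D₂ π).op (trackVal (h + 1) f) x = trackVal h (yMatrix D₁ D₂ π *ᵥ f) x := by
  obtain ⟨_ | ⟨i, a⟩, _ | ⟨j, b⟩, l, δ⟩ := x
  · rcases eq_or_ne δ h with e | e <;>
    simp (disch := omega) [op_idle, settle, trackVal, track_idle, track_idle_none, track_c13,
      track_c14, track_busy1_none, track_busy2_none, clk_const, yMatrix_mulVec_c7]
  · rcases lt_trichotomy δ h with e | e | e <;> rcases lt_trichotomy b h with eb | eb | eb <;>
    simp (disch := omega) [op_busy2, settle, trackVal, track_idle, track_idle_none, track_c13,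
      track_busy1_none, track_c14, track_c10, track_c6, track_busy2_none, track_c8, track_c11,
      track_c3, track_both_none, clk_const, yMatrix_mulVec_c7, yMatrix_mulVec_c14,
      yMatrix_mulVec_c10, yMatrix_mulVec_c6]
  · rcases lt_trichotomy δ h with e | e | e <;> rcases lt_trichotomy a h with ea | ea | ea <;>
    simp (disch := omega) [op_busy1, settle, trackVal, track_idle, track_idle_none, track_c13,
      track_c9, track_c5, track_busy1_none, track_c14, track_busy2_none, track_c8, track_c12,
      track_c2, track_both_none, clk_const, yMatrix_mulVec_c7, yMatrix_mulVec_c13,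
      yMatrix_mulVec_c9, yMatrix_mulVec_c5]
  · simp only [Regular] at hx
    rcases lt_trichotomy δ h with e | e | e <;> rcases lt_trichotomy a h with ea | ea | ea <;>
      rcases lt_trichotomy b h with eb | eb | eb <;> first | omega | skip
    all_goals
    simp (disch := omega) [op_both, settle, trackVal, track_idle, track_idle_none, track_c13,
      track_c9, track_c5, track_busy1_none, track_c14, track_c10, track_c6, track_busy2_none,
      track_c8, track_c11, track_c12, track_c2, track_c1, track_c3, track_c4, track_both_none,
      clk_const, yMatrix_mulVec_c7, yMatrix_mulVec_c8, yMatrix_mulVec_c11, yMatrix_mulVec_c12,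
      yMatrix_mulVec_c1, yMatrix_mulVec_c2, yMatrix_mulVec_c3, yMatrix_mulVec_c4]

theorem regular_next {h : ℕ} {x : SysState N₁ N₂ k} (hx : Regular h x) (o₁ : Option (Fin N₁))
    (o₂ : Option (Fin N₂)) (i : Fin N₁) (j : Fin N₂) :
    Regular (h + 1) (next π x o₁ o₂ i j) := by
  obtain ⟨_ | ⟨i, a⟩, _ | ⟨j, b⟩, l, δ⟩ := x <;> cases o₁ <;> cases o₂ <;> cases π <;>
    simp only [next, afterSlot, received] <;> split_ifs <;>
    simp only [Regular] at hx ⊢ <;> omega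

/-- A packet that has just been sampled is newer than every other packet in the system. -/
theorem regular_zero_next (x : SysState N₁ N₂ k) (o₁ : Option (Fin N₁))
    (o₂ : Option (Fin N₂)) (i : Fin N₁) (j : Fin N₂) :
    Regular 0 (next π x o₁ o₂ i j) := by
  obtain ⟨_ | ⟨i, a⟩, _ | ⟨j, b⟩, l, δ⟩ := x <;> cases o₁ <;> cases o₂ <;> cases π <;>
    simp only [next, afterSlot, received] <;> split_ifs <;>
    simp only [Regular] <;> omega

theorem op_iterate_trackVal (n : ℕ) {h : ℕ} {x : SysState N₁ N₂ k} (hx : Regular h x)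
    {f : YState N₁ N₂ k → ℝ} {q : SysState N₁ N₂ k → ℝ}
    (hq : ∀ y, Regular (h + n) y → q y = trackVal (h + n) f y) :
    (sysChain D₁ D₂ π).op^[n] q x = trackVal h (yMatrix D₁ D₂ π ^ n *ᵥ f) x := by
  induction n generalizing h x with
  | zero => simpa using hq x hx
  | succ n ih =>
    rw [Function.iterate_succ_apply', pow_succ', ← Matrix.mulVec_mulVec, ← op_trackVal _ _ _ hx]
    refine NoiseChain.op_congr _ fun e => ih (regular_next π hx _ _ _ _) fun y hy => ?_
    rw [show h + 1 + n = h + (n + 1) by ring] at hy ⊢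
    exact hq y hy

/-- The mean of `f` at the start of the absorbing chain of a packet sampled in the next slot (`0` if
no packet is sampled), given the state of the occupancy chain. -/
def sampleVal (f : YState N₁ N₂ k → ℝ) : WState N₁ N₂ k → ℝ
  | .idle l => clk l (fun _ => 0) (π.ind1 * ∑ i, D₁.α i * f (.c5 i ⟨0, l.pos⟩) +
      π.ind2 * ∑ j, D₂.α j * f (.c6 j ⟨0, l.pos⟩))
  | .busy1 i l => D₁.b i * clk l (fun _ => 0) (π.ind1 * ∑ i, D₁.α i * f (.c5 i ⟨0, l.pos⟩) +
      π.ind2 * ∑ j, D₂.α j * f (.c6 j ⟨0, l.pos⟩)) +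
      ∑ i', D₁.B i i' * clk l (fun _ => 0) (∑ j, D₂.α j * f (.c4 i' j ⟨0, l.pos⟩))
  | .busy2 j l => D₂.b j * clk l (fun _ => 0) (π.ind1 * ∑ i, D₁.α i * f (.c5 i ⟨0, l.pos⟩) +
      π.ind2 * ∑ j, D₂.α j * f (.c6 j ⟨0, l.pos⟩)) +
      ∑ j', D₂.B j j' * clk l (fun _ => 0) (∑ i, D₁.α i * f (.c1 i j' ⟨0, l.pos⟩))
  | .both i j l => D₁.b i * D₂.b j *
      clk l (fun _ => 0) (π.ind1 * ∑ i, D₁.α i * f (.c5 i ⟨0, l.pos⟩) +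
        π.ind2 * ∑ j, D₂.α j * f (.c6 j ⟨0, l.pos⟩)) +
      ∑ j', D₁.b i * D₂.B j j' * clk l (fun _ => 0) (∑ i, D₁.α i * f (.c1 i j' ⟨0, l.pos⟩)) +
      ∑ i', D₂.b j * D₁.B i i' * clk l (fun _ => 0) (∑ j, D₂.α j * f (.c4 i' j ⟨0, l.pos⟩))

/-- Given the present state, the law of the initial state of the absorbing chain of a packet sampled
in the next slot depends on the occupancies only. -/
theorem op_trackVal_zero (f : YState N₁ N₂ k → ℝ) (x : SysState N₁ N₂ k) :
    (sysChain D₁ D₂ π).op (trackVal 0 f) x = sampleVal D₁ D₂ π f (occupancy x) := by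
  obtain ⟨_ | ⟨i, a⟩, _ | ⟨j, b⟩, l, δ⟩ := x
  · simp (disch := omega) [op_idle, settle, trackVal, track_idle_none, track_c5, track_c6,
      occupancy, sampleVal]
  · simp (disch := omega) [op_busy2, settle, trackVal, track_idle_none, track_busy2_none,
      track_c5, track_c6, track_c1, occupancy, sampleVal]
  · simp (disch := omega) [op_busy1, settle, trackVal, track_idle_none, track_busy1_none,
      track_c5, track_c6, track_c4, occupancy, sampleVal]
  · simp (disch := omega) [op_both, settle, trackVal, track_idle_none, track_busy1_none,
      track_busy2_none, track_both_none, track_c5, track_c6, track_c1, track_c4, clk_const,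
      occupancy, sampleVal]

theorem startWeight_add (p q : WState N₁ N₂ k → ℝ) :
    startWeight D₁ D₂ π (p + q) = startWeight D₁ D₂ π p + startWeight D₁ D₂ π q := by
  funext y
  cases y <;> simp [startWeight, mul_add, Finset.sum_add_distrib] <;> ring

theorem startWeight_smul (c : ℝ) (p : WState N₁ N₂ k → ℝ) :
    startWeight D₁ D₂ π (c • p) = c • startWeight D₁ D₂ π p := by
  funext y
  cases y <;> simp [startWeight, mul_add, Finset.mul_sum, mul_left_comm _ c]

/-- The vector of sampling probabilities is the mean under `p` of the law of the initial state of
the absorbing chain. -/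
theorem startWeight_dotProduct (p : WState N₁ N₂ k → ℝ) (f : YState N₁ N₂ k → ℝ) :
    startWeight D₁ D₂ π p ⬝ᵥ f = p ⬝ᵥ sampleVal D₁ D₂ π f := by
  let L : (WState N₁ N₂ k → ℝ) →ₗ[ℝ] ℝ :=
    { toFun := fun p => startWeight D₁ D₂ π p ⬝ᵥ f - p ⬝ᵥ sampleVal D₁ D₂ π f
      map_add' := fun p q => by
        simp only [startWeight_add, add_dotProduct]
        ring
      map_smul' := fun c p => by
        simp only [startWeight_smul, smul_dotProduct, smul_eq_mul, RingHom.id_apply]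
        ring }
  suffices L = 0 from sub_eq_zero.1 (LinearMap.congr_fun this p)
  refine LinearMap.pi_ext fun w c => ?_
  have hc : Pi.single (M := fun _ : WState N₁ N₂ k => ℝ) w c = c • Pi.single w 1 := by
    rw [← Pi.single_smul, smul_eq_mul, mul_one]
  rw [hc, map_smul]
  refine smul_eq_zero_of_right c (sub_eq_zero.2 ?_)
  rw [single_dotProduct, one_mul]
  rcases w with l | ⟨i, l⟩ | ⟨j, l⟩ | ⟨i, j, l⟩ <;> by_cases hl : (l : ℕ) + 1 < k
  · simp [dotProduct, sum_yState, startWeight, Pi.single_apply, sampleVal, clk, hl,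
      reset_of_lt hl]
  · simp [dotProduct, sum_yState, startWeight, Pi.single_apply, sampleVal, clk, hl,
      reset_of_not_lt hl, Finset.mul_sum, mul_assoc]
  · simp [dotProduct, sum_yState, startWeight, Pi.single_apply, sampleVal, clk, hl, ite_and,
      reset_of_lt hl]
  · simp [dotProduct, sum_yState, startWeight, Pi.single_apply, sampleVal, clk, hl, ite_and,
      reset_of_not_lt hl, Finset.mul_sum, mul_assoc]
    simp only [mul_add, Finset.mul_sum]
    ring_nf
  · simp [dotProduct, sum_yState, startWeight, Pi.single_apply, sampleVal, clk, hl, ite_and,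
      reset_of_lt hl]
  · simp [dotProduct, sum_yState, startWeight, Pi.single_apply, sampleVal, clk, hl, ite_and,
      reset_of_not_lt hl, Finset.mul_sum, mul_assoc]
    simp only [mul_add, Finset.mul_sum]
    conv_lhs => rw [Finset.sum_comm (γ := Fin N₁) (α := Fin N₂)]
    ring_nf
  · simp [dotProduct, sum_yState, startWeight, Pi.single_apply, sampleVal, clk, hl, ite_and,
      reset_of_lt hl]
  · simp [dotProduct, sum_yState, startWeight, Pi.single_apply, sampleVal, clk, hl, ite_and,
      reset_of_not_lt hl, Finset.mul_sum, mul_assoc]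
    simp only [mul_add, Finset.mul_sum]
    rw [Finset.sum_comm (γ := Fin N₂) (α := Fin N₁)]
    ring_nf

theorem Priority.ind_add (π : Priority) : π.ind1 + π.ind2 = 1 := by
  cases π <;> simp [Priority.ind1, Priority.ind2]

/-- A sampling does not affect the age of information. -/
theorem settle_aoi (g : ℕ → ℝ) (l : Fin k) (δ : ℕ) (s₁ : Option (Fin N₁ × ℕ))
    (s₂ : Option (Fin N₂ × ℕ)) :
    settle D₁ D₂ π (fun y : SysState N₁ N₂ k => g y.aoi) l δ s₁ s₂ = g δ := by
  cases s₁ <;> cases s₂ <;>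
    simp [settle, ← Finset.sum_mul, D₁.α_sum, D₂.α_sum, clk_const, ← add_mul, Priority.ind_add]

/-- The absorbing chain of the packet of age `h` is absorbed successfully in the next slot if this
packet is the freshest received one and a newer packet is received. -/
theorem op_upToDate {h : ℕ} {x : SysState N₁ N₂ k} (hx : Regular h x) :
    (sysChain D₁ D₂ π).op (fun y => if x.aoi = h ∧ y.aoi < x.aoi + 1 then 1 else 0) x =
      trackVal h (successVec D₁ D₂) x := by
  have hB₁ : ∀ i, ∑ i', D₁.B i i' = 1 - D₁.b i := fun i => by rw [D₁.b_eq]; ring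
  have hB₂ : ∀ j, ∑ j', D₂.B j j' = 1 - D₂.b j := fun j => by rw [D₂.b_eq]; ring
  obtain ⟨g, hg⟩ : ∃ g : ℕ → ℝ, g = fun n => if x.aoi = h ∧ n < x.aoi + 1 then 1 else 0 := ⟨_, rfl⟩
  have hop : (sysChain D₁ D₂ π).op (fun y => if x.aoi = h ∧ y.aoi < x.aoi + 1 then 1 else 0) x =
      (sysChain D₁ D₂ π).op (fun y => g y.aoi) x := by rw [hg]
  have hG := settle_aoi D₁ D₂ π (k := k) g
  have hg1 : ∀ n, x.aoi = h → n < x.aoi + 1 → g n = 1 := fun n h1 h2 => by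
    rw [hg]
    exact if_pos ⟨h1, h2⟩
  have hg0 : ∀ n, x.aoi ≠ h ∨ x.aoi + 1 ≤ n → g n = 0 := fun n h1 => by
    simp only [hg, ite_eq_right_iff]
    omega
  rw [hop]
  clear hg hop
  obtain ⟨_ | ⟨i, a⟩, _ | ⟨j, b⟩, l, δ⟩ := x <;> simp only at hg0 hg1
  · simp only [op_idle, hG]
    rcases eq_or_ne δ h with e | e <;>
    simp (disch := omega) [hg0, trackVal, track_idle, track_idle_none, successVec]
  · simp only [op_busy2, hG]
    rcases lt_trichotomy δ h with e | e | e <;> rcases lt_trichotomy b h with eb | eb | eb <;>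
    simp (disch := omega) [hg0, hg1, trackVal, track_c14, track_c10, track_c6,
      track_busy2_none, successVec]
  · simp only [op_busy1, hG]
    rcases lt_trichotomy δ h with e | e | e <;> rcases lt_trichotomy a h with ea | ea | ea <;>
    simp (disch := omega) [hg0, hg1, trackVal, track_c13, track_c9, track_c5,
      track_busy1_none, successVec]
  · simp only [Regular] at hx
    simp only [op_both, hG]
    rcases lt_trichotomy δ h with e | e | e <;> rcases lt_trichotomy a h with ea | ea | ea <;>
      rcases lt_trichotomy b h with eb | eb | eb <;> first | omega | skip
    all_goals
    simp (disch := omega) [hg0, hg1, trackVal, track_c8, track_c11, track_c12,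
      track_c2, track_c1, track_c3, track_c4, track_both_none, successVec, ← Finset.mul_sum,
      hB₁, hB₂]
    all_goals try ring

theorem trackVal_leftVec {h : ℕ} {x : SysState N₁ N₂ k} (hx : Regular h x) :
    trackVal h leftVec x = if x.aoi = h then 1 else 0 := by
  obtain ⟨_ | ⟨i, a⟩, _ | ⟨j, b⟩, l, δ⟩ := x
  · simp only [trackVal, track]
    split_ifs <;> simp [leftVec]
  · simp only [trackVal, track]
    split_ifs <;> simp [leftVec]
  · simp only [trackVal, track]
    split_ifs <;> simp [leftVec]
  · simp only [Regular] at hx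
    simp only [trackVal, track]
    split_ifs <;> simp [leftVec]
    omega

/-- Every state of the absorbing chain occurs in the system, so that properties of its matrix follow
from those of the one-step operator. -/
theorem exists_track_eq (hk : 1 ≤ k) (y : YState N₁ N₂ k) :
    ∃ x : SysState N₁ N₂ k, Regular 1 x ∧ track 1 x = some y := by
  cases y with
  | c1 i j l => exact ⟨⟨some (i, 1), some (j, 2), l, 2⟩, by simp [Regular], by simp [track]⟩
  | c2 i j l => exact ⟨⟨some (i, 1), some (j, 0), l, 2⟩, by simp [Regular], by simp [track]⟩
  | c3 i j l => exact ⟨⟨some (i, 0), some (j, 1), l, 2⟩, by simp [Regular], by simp [track]⟩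
  | c4 i j l => exact ⟨⟨some (i, 2), some (j, 1), l, 2⟩, by simp [Regular], by simp [track]⟩
  | c5 i l => exact ⟨⟨some (i, 1), none, l, 2⟩, by simp [Regular], by simp [track]⟩
  | c6 j l => exact ⟨⟨none, some (j, 1), l, 2⟩, by simp [Regular], by simp [track]⟩
  | c7 l => exact ⟨⟨none, none, l, 1⟩, by simp [Regular], by simp [track]⟩
  | c8 i j => exact ⟨⟨some (i, 0), some (j, 0), ⟨0, hk⟩, 1⟩, by simp [Regular], by simp [track]⟩
  | c9 i l => exact ⟨⟨some (i, 1), none, l, 1⟩, by simp [Regular], by simp [track]⟩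
  | c10 j l => exact ⟨⟨none, some (j, 1), l, 1⟩, by simp [Regular], by simp [track]⟩
  | c11 i j l => exact ⟨⟨some (i, 0), some (j, 1), l, 1⟩, by simp [Regular], by simp [track]⟩
  | c12 i j l => exact ⟨⟨some (i, 1), some (j, 0), l, 1⟩, by simp [Regular], by simp [track]⟩
  | c13 i l => exact ⟨⟨some (i, 0), none, l, 1⟩, by simp [Regular], by simp [track]⟩
  | c14 j l => exact ⟨⟨none, some (j, 0), l, 1⟩, by simp [Regular], by simp [track]⟩

end Track

/-! ### Power series of a transient sub-stochastic matrix -/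

section Transient

variable {Y : Type*} [Fintype Y] {A : Matrix Y Y ℝ}

/-- `A` is a sub-stochastic matrix without nonzero fixed vectors, which characterizes the matrices
of transition probabilities among the transient states of an absorbing chain. -/
structure IsTransient (A : Matrix Y Y ℝ) : Prop where
  nonneg : ∀ y y', 0 ≤ A y y'
  row_le : ∀ y, (A *ᵥ 1) y ≤ 1
  fixed : ∀ u : Y → ℝ, A *ᵥ u = u → u = 0

theorem mulVec_mono_of_nonneg (hA : ∀ y y', 0 ≤ A y y') {f g : Y → ℝ} (h : ∀ y, f y ≤ g y) (y : Y) :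
    (A *ᵥ f) y ≤ (A *ᵥ g) y :=
  Finset.sum_le_sum fun y' _ => mul_le_mul_of_nonneg_left (h y') (hA y y')

theorem abs_mulVec_le_of_nonneg (hA : ∀ y y', 0 ≤ A y y') {f : Y → ℝ} {c : ℝ}
    (hf : ∀ y, |f y| ≤ c) (y : Y) : |(A *ᵥ f) y| ≤ c * (A *ᵥ 1) y := by
  simp only [Matrix.mulVec, dotProduct, Finset.mul_sum]
  refine (Finset.abs_sum_le_sum_abs _ _).trans (Finset.sum_le_sum fun y' _ => ?_)
  rw [abs_mul, abs_of_nonneg (hA y y'), mul_comm, Pi.one_apply, mul_one]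
  exact mul_le_mul_of_nonneg_right (hf y') (hA y y')

theorem exists_abs_le (f : Y → ℝ) : ∃ c, 0 ≤ c ∧ ∀ y, |f y| ≤ c :=
  ⟨∑ y, |f y|, Finset.sum_nonneg fun _ _ => abs_nonneg _, fun y =>
    Finset.single_le_sum (f := fun y => |f y|) (fun _ _ => abs_nonneg _) (Finset.mem_univ y)⟩

variable [DecidableEq Y]

theorem pow_nonneg_apply (hA : ∀ y y', 0 ≤ A y y') (n : ℕ) (y y' : Y) : 0 ≤ (A ^ n) y y' := by
  induction n generalizing y y' with
  | zero =>
    rw [pow_zero, Matrix.one_apply]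
    split_ifs <;> norm_num
  | succ n ih =>
    rw [pow_succ, Matrix.mul_apply]
    exact Finset.sum_nonneg fun z _ => mul_nonneg (ih y z) (hA z y')

theorem IsTransient.isUnit_one_sub (h : IsTransient A) : IsUnit (1 - A) := by
  rw [← Matrix.mulVec_injective_iff_isUnit]
  refine (injective_iff_map_eq_zero (Matrix.mulVecLin (1 - A))).2 fun u hu => h.fixed u ?_
  simp only [Matrix.mulVecLin_apply, Matrix.sub_mulVec, Matrix.one_mulVec] at hu
  exact (sub_eq_zero.1 hu).symm

theorem IsTransient.one_sub_mul_inv (h : IsTransient A) : (1 - A) * (1 - A)⁻¹ = 1 :=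
  Matrix.mul_nonsing_inv _ ((Matrix.isUnit_iff_isUnit_det _).1 h.isUnit_one_sub)

theorem IsTransient.inv_mul_one_sub (h : IsTransient A) : (1 - A)⁻¹ * (1 - A) = 1 :=
  Matrix.nonsing_inv_mul _ ((Matrix.isUnit_iff_isUnit_det _).1 h.isUnit_one_sub)

/-- If `1` is not an eigenvalue of a sub-stochastic matrix `A`, then `A ^ n 1` decreases to `0`,
since its limit is a fixed vector. -/
theorem IsTransient.tendsto_pow_mulVec_one (h : IsTransient A) (y : Y) :
    Tendsto (fun n : ℕ => (A ^ n *ᵥ 1) y) atTop (𝓝 0) := by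
  have hanti : ∀ y, Antitone fun n : ℕ => (A ^ n *ᵥ 1) y := fun y =>
    antitone_nat_of_succ_le fun n => by
      rw [pow_succ, ← Matrix.mulVec_mulVec]
      exact mulVec_mono_of_nonneg (pow_nonneg_apply h.nonneg n) h.row_le y
  have hpos : ∀ y (n : ℕ), 0 ≤ (A ^ n *ᵥ 1) y := fun y n =>
    Finset.sum_nonneg fun y' _ => mul_nonneg (pow_nonneg_apply h.nonneg n y y') zero_le_one
  have hlim : ∀ y, Tendsto (fun n : ℕ => (A ^ n *ᵥ 1) y) atTop (𝓝 (⨅ n : ℕ, (A ^ n *ᵥ 1) y)) :=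
    fun y => tendsto_atTop_ciInf (hanti y) ⟨0, by rintro _ ⟨n, rfl⟩; exact hpos y n⟩
  have h0 : (fun y => ⨅ n : ℕ, (A ^ n *ᵥ 1) y) = 0 := by
    refine h.fixed _ (funext fun y => ?_)
    have h1 : Tendsto (fun n : ℕ => (A ^ (n + 1) *ᵥ 1) y) atTop
        (𝓝 ((A *ᵥ fun y => ⨅ n : ℕ, (A ^ n *ᵥ 1) y) y)) := by
      simp only [pow_succ', ← Matrix.mulVec_mulVec]
      exact tendsto_finsetSum _ fun y' _ => (hlim y').const_mul _
    exact tendsto_nhds_unique h1 ((tendsto_add_atTop_iff_nat 1).2 (hlim y))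
  have := hlim y
  rwa [congrFun h0 y] at this

/-- The decay is geometric: `g = (1 - A)⁻¹ 1` satisfies `g ≥ 1` and `A g = g - 1 ≤ r g` for some
`r < 1`. -/
theorem IsTransient.exists_pow_mulVec_one_le (h : IsTransient A) :
    ∃ c r : ℝ, 0 ≤ c ∧ 0 ≤ r ∧ r < 1 ∧ ∀ (n : ℕ) y, (A ^ n *ᵥ 1) y ≤ c * r ^ n := by
  set g : Y → ℝ := (1 - A)⁻¹ *ᵥ 1 with hg
  have hAg : A *ᵥ g = g - 1 := by
    have : (1 - A) *ᵥ g = 1 := by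
      rw [hg, Matrix.mulVec_mulVec, h.one_sub_mul_inv, Matrix.one_mulVec]
    rw [Matrix.sub_mulVec, Matrix.one_mulVec] at this
    rw [← this, sub_sub_cancel]
  obtain ⟨c, hc0, hc⟩ := exists_abs_le g
  have hpos : ∀ (n : ℕ) y, 0 ≤ (A ^ n *ᵥ 1) y := fun n y =>
    Finset.sum_nonneg fun y' _ => mul_nonneg (pow_nonneg_apply h.nonneg n y y') zero_le_one
  have hiter : ∀ (n : ℕ) y, 1 + (A ^ (n + 1) *ᵥ g) y ≤ g y := by
    intro n
    induction n with
    | zero =>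
      intro y
      rw [zero_add, pow_one, hAg]
      simp
    | succ n ih =>
      intro y
      have h1 : A ^ (n + 1 + 1) *ᵥ g = A ^ (n + 1) *ᵥ g - A ^ (n + 1) *ᵥ 1 := by
        rw [pow_succ, ← Matrix.mulVec_mulVec, hAg, Matrix.mulVec_sub]
      rw [h1, Pi.sub_apply]
      linarith [ih y, hpos (n + 1) y]
  have hg1 : ∀ y, 1 ≤ g y := by
    intro y
    have h1 : Tendsto (fun n : ℕ => 1 + (A ^ (n + 1) *ᵥ g) y) atTop (𝓝 (1 + 0)) := by
      refine tendsto_const_nhds.add ?_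
      refine squeeze_zero_norm (a := fun n : ℕ => c * (A ^ (n + 1) *ᵥ 1) y) (fun n => ?_) ?_
      · exact abs_mulVec_le_of_nonneg (pow_nonneg_apply h.nonneg _) hc y
      · rw [← mul_zero c]
        exact ((tendsto_add_atTop_iff_nat 1).2 (h.tendsto_pow_mulVec_one y)).const_mul c
    simpa using le_of_tendsto h1 (Eventually.of_forall fun n => hiter n y)
  set r : ℝ := 1 - (c + 1)⁻¹ with hr
  have hinv : (c + 1)⁻¹ ≤ 1 := inv_le_one_of_one_le₀ (by linarith)
  have hr0 : 0 ≤ r := by linarith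
  have hAgr : ∀ y, (A *ᵥ g) y ≤ (r • g) y := by
    intro y
    have h1 : (c + 1)⁻¹ * g y ≤ 1 := by
      rw [inv_mul_le_iff₀ (by linarith)]
      linarith [le_abs_self (g y), hc y]
    rw [hAg, Pi.sub_apply, Pi.one_apply, Pi.smul_apply, smul_eq_mul, hr]
    linarith
  refine ⟨c, r, hc0, hr0, ?_, fun n y => ?_⟩
  · have : 0 < (c + 1)⁻¹ := by positivity
    linarith
  · have h1 : ∀ (n : ℕ) y, (A ^ n *ᵥ g) y ≤ r ^ n * g y := by
      intro n
      induction n with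
      | zero => simp
      | succ n ih =>
        intro y
        rw [pow_succ, ← Matrix.mulVec_mulVec]
        refine (mulVec_mono_of_nonneg (pow_nonneg_apply h.nonneg n) hAgr y).trans ?_
        rw [Matrix.mulVec_smul, Pi.smul_apply, smul_eq_mul, pow_succ]
        have := mul_le_mul_of_nonneg_left (ih y) hr0
        linarith
    calc (A ^ n *ᵥ 1) y ≤ (A ^ n *ᵥ g) y :=
          mulVec_mono_of_nonneg (pow_nonneg_apply h.nonneg n) hg1 y
      _ ≤ r ^ n * g y := h1 n y
      _ ≤ r ^ n * c := mul_le_mul_of_nonneg_left ((le_abs_self _).trans (hc y)) (pow_nonneg hr0 n)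
      _ = c * r ^ n := mul_comm _ _

/-- The sums `∑ n ^ m (s A ^ n f)` converge. -/
theorem IsTransient.summable_pow_mul_dotProduct (h : IsTransient A) (s f : Y → ℝ) (m : ℕ) :
    Summable fun n : ℕ => (n : ℝ) ^ m * (s ⬝ᵥ A ^ n *ᵥ f) := by
  obtain ⟨c, r, hc, hr0, hr1, hle⟩ := h.exists_pow_mulVec_one_le
  obtain ⟨b, hb0, hb⟩ := exists_abs_le f
  have hgeo : Summable fun n : ℕ => (n : ℝ) ^ m * r ^ n :=
    summable_pow_mul_geometric_of_norm_lt_one m (by rwa [Real.norm_of_nonneg hr0])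
  refine Summable.of_norm_bounded (hgeo.mul_left ((∑ y, |s y|) * (b * c))) fun n => ?_
  have h1 : |s ⬝ᵥ A ^ n *ᵥ f| ≤ (∑ y, |s y|) * (b * c) * r ^ n := by
    rw [mul_assoc, Finset.sum_mul]
    refine (Finset.abs_sum_le_sum_abs _ _).trans (Finset.sum_le_sum fun y _ => ?_)
    rw [abs_mul]
    refine mul_le_mul_of_nonneg_left ?_ (abs_nonneg _)
    refine (abs_mulVec_le_of_nonneg (pow_nonneg_apply h.nonneg n) hb y).trans ?_
    rw [mul_assoc]
    exact mul_le_mul_of_nonneg_left (hle n y) hb0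
  rw [Real.norm_eq_abs, abs_mul, abs_of_nonneg (by positivity : (0 : ℝ) ≤ (n : ℝ) ^ m)]
  calc (n : ℝ) ^ m * |s ⬝ᵥ A ^ n *ᵥ f| ≤ (n : ℝ) ^ m * ((∑ y, |s y|) * (b * c) * r ^ n) :=
        mul_le_mul_of_nonneg_left h1 (by positivity)
    _ = _ := by ring

theorem hasSum_sub_succ {z : ℕ → ℝ} (hz : Summable z) :
    HasSum (fun n => z n - z (n + 1)) (z 0) := by
  simpa using hz.hasSum.sub ((hasSum_nat_add_iff' 1).2 hz.hasSum)

/-- Telescoping form of `s A ^ n f` in terms of `g = (1 - A)⁻¹ f`. -/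
theorem IsTransient.dotProduct_pow_eq (h : IsTransient A) (s f : Y → ℝ) (n : ℕ) :
    s ⬝ᵥ A ^ n *ᵥ f =
      s ⬝ᵥ A ^ n *ᵥ ((1 - A)⁻¹ *ᵥ f) - s ⬝ᵥ A ^ (n + 1) *ᵥ ((1 - A)⁻¹ *ᵥ f) := by
  rw [← dotProduct_sub, ← Matrix.sub_mulVec, pow_succ]
  have h1 : A ^ n - A ^ n * A = A ^ n * (1 - A) := by noncomm_ring
  rw [h1, ← Matrix.mulVec_mulVec, Matrix.mulVec_mulVec (v := f), h.one_sub_mul_inv,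
    Matrix.one_mulVec]

theorem IsTransient.hasSum_dotProduct_pow (h : IsTransient A) (s f : Y → ℝ) :
    HasSum (fun n : ℕ => s ⬝ᵥ A ^ n *ᵥ f) (s ⬝ᵥ (1 - A)⁻¹ *ᵥ f) := by
  have h0 := hasSum_sub_succ
    (by simpa using h.summable_pow_mul_dotProduct s ((1 - A)⁻¹ *ᵥ f) 0 :
      Summable fun n : ℕ => s ⬝ᵥ A ^ n *ᵥ ((1 - A)⁻¹ *ᵥ f))
  rw [pow_zero, Matrix.one_mulVec] at h0
  exact h0.congr_fun fun n => h.dotProduct_pow_eq s f n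

theorem IsTransient.commute_inv (h : IsTransient A) : Commute A (1 - A)⁻¹ := by
  have h1 : Commute A (1 - A) := (Commute.one_right A).sub_right (Commute.refl A)
  calc A * (1 - A)⁻¹ = (1 - A)⁻¹ * (1 - A) * A * (1 - A)⁻¹ := by rw [h.inv_mul_one_sub, one_mul]
    _ = (1 - A)⁻¹ * (A * (1 - A)) * (1 - A)⁻¹ := by rw [h1.eq, mul_assoc (1 - A)⁻¹]
    _ = (1 - A)⁻¹ * A := by rw [mul_assoc, mul_assoc A, h.one_sub_mul_inv, mul_one]

theorem IsTransient.hasSum_dotProduct_pow_succ (h : IsTransient A) (s f : Y → ℝ) :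
    HasSum (fun n : ℕ => s ⬝ᵥ A ^ (n + 1) *ᵥ f) (s ⬝ᵥ (A * (1 - A)⁻¹) *ᵥ f) := by
  have := h.hasSum_dotProduct_pow s (A *ᵥ f)
  simp only [Matrix.mulVec_mulVec, ← pow_succ] at this
  rwa [h.commute_inv.eq]

/-- Summation by parts: `n (z n - z (n + 1))` is `n z n - (n + 1) z (n + 1)` plus `z (n + 1)`. -/
theorem IsTransient.hasSum_mul_dotProduct_pow (h : IsTransient A) (s f : Y → ℝ) :
    HasSum (fun n : ℕ => (n : ℝ) * (s ⬝ᵥ A ^ n *ᵥ f)) (s ⬝ᵥ (A * (1 - A)⁻¹ ^ 2) *ᵥ f) := by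
  set g := (1 - A)⁻¹ *ᵥ f with hg
  have h0 := hasSum_sub_succ
    (by simpa using h.summable_pow_mul_dotProduct s g 1 :
      Summable fun n : ℕ => (n : ℝ) * (s ⬝ᵥ A ^ n *ᵥ g))
  have h1 := h0.add (h.hasSum_dotProduct_pow_succ s g)
  have hv : ((0 : ℕ) : ℝ) * (s ⬝ᵥ A ^ 0 *ᵥ g) + s ⬝ᵥ (A * (1 - A)⁻¹) *ᵥ g =
      s ⬝ᵥ (A * (1 - A)⁻¹ ^ 2) *ᵥ f := by
    rw [Nat.cast_zero, zero_mul, zero_add, hg, Matrix.mulVec_mulVec, mul_assoc, ← sq]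
  rw [hv] at h1
  refine h1.congr_fun fun n => ?_
  rw [h.dotProduct_pow_eq s f n, ← hg]
  push_cast
  ring

/-- Summation by parts: `n ^ 2 (z n - z (n + 1))` is `n ^ 2 z n - (n + 1) ^ 2 z (n + 1)` plus
`2 (n + 1) z (n + 1) - z (n + 1)`. -/
theorem IsTransient.hasSum_sq_mul_dotProduct_pow (h : IsTransient A) (s f : Y → ℝ) :
    HasSum (fun n : ℕ => (n : ℝ) ^ 2 * (s ⬝ᵥ A ^ n *ᵥ f))
      (s ⬝ᵥ (A * (1 - A)⁻¹ ^ 3 * (A + 1)) *ᵥ f) := by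
  set g := (1 - A)⁻¹ *ᵥ f with hg
  have h0 := hasSum_sub_succ (h.summable_pow_mul_dotProduct s g 2)
  have h2 : HasSum (fun n : ℕ => ((n + 1 : ℕ) : ℝ) * (s ⬝ᵥ A ^ (n + 1) *ᵥ g))
      (s ⬝ᵥ (A * (1 - A)⁻¹ ^ 2) *ᵥ g) := by
    simpa using (hasSum_nat_add_iff' 1).2 (h.hasSum_mul_dotProduct_pow s g)
  have h1 := (h0.add (h2.mul_left 2)).sub (h.hasSum_dotProduct_pow_succ s g)
  have hv : ((0 : ℕ) : ℝ) ^ 2 * (s ⬝ᵥ A ^ 0 *ᵥ g) + 2 * (s ⬝ᵥ (A * (1 - A)⁻¹ ^ 2) *ᵥ g) -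
      s ⬝ᵥ (A * (1 - A)⁻¹) *ᵥ g = s ⬝ᵥ (A * (1 - A)⁻¹ ^ 3 * (A + 1)) *ᵥ f := by
    have hA : A + 1 = 2 - (1 - A) := by noncomm_ring; norm_num
    have hm : A * (1 - A)⁻¹ ^ 3 * (A + 1) =
        (2 : ℝ) • (A * (1 - A)⁻¹ ^ 2 * (1 - A)⁻¹) - A * (1 - A)⁻¹ * (1 - A)⁻¹ := by
      have h3 : (1 - A)⁻¹ ^ 3 * (1 - A) = (1 - A)⁻¹ ^ 2 := by
        rw [pow_succ, mul_assoc, h.inv_mul_one_sub, mul_one]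
      rw [hA, mul_sub, mul_assoc A _ (1 - A), h3, two_smul, mul_two, mul_assoc A _ (1 - A)⁻¹,
        ← pow_succ, mul_assoc A _ (1 - A)⁻¹, ← sq]
    rw [hm, Matrix.sub_mulVec, Matrix.smul_mulVec, dotProduct_sub, dotProduct_smul, smul_eq_mul,
      hg, Matrix.mulVec_mulVec, Matrix.mulVec_mulVec]
    simp
  rw [hv] at h1
  refine h1.congr_fun fun n => ?_
  rw [h.dotProduct_pow_eq s f n, ← hg]
  push_cast
  ring

end Transient

/-! ### Transience of the absorbing chain -/

section YTransient

variable {N₁ N₂ k : ℕ} (D₁ : DPH N₁) (D₂ : DPH N₂) (π : Priority)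

/-- While both packets stay in service, the phases die out, because `u = B₁ ^ n u (B₂ ^ n)ᵀ → 0`. -/
theorem eq_zero_of_service {u : Fin N₁ → Fin N₂ → ℝ}
    (hu : ∀ i j, u i j = ∑ i', ∑ j', D₁.B i i' * D₂.B j j' * u i' j') : ∀ i j, u i j = 0 := by
  set U : Matrix (Fin N₁) (Fin N₂) ℝ := Matrix.of u with hU
  have h1 : U = D₁.B * U * D₂.Bᵀ := by
    ext i j
    rw [hU, Matrix.of_apply, hu i j]
    simp only [Matrix.mul_apply, Matrix.of_apply, Matrix.transpose_apply, Finset.sum_mul]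
    rw [Finset.sum_comm]
    exact Finset.sum_congr rfl fun j' _ => Finset.sum_congr rfl fun i' _ => by ring
  have h2 : ∀ n : ℕ, U = D₁.B ^ n * U * (D₂.B ^ n)ᵀ := by
    intro n
    induction n with
    | zero => simp
    | succ n ih =>
      calc U = D₁.B ^ n * (D₁.B * U * D₂.Bᵀ) * (D₂.B ^ n)ᵀ := by rw [← h1]; exact ih
        _ = _ := by
          rw [pow_succ, pow_succ, Matrix.transpose_mul]
          simp only [Matrix.mul_assoc]
  intro i j
  have h3 := tendsto_finsetSum (Finset.univ : Finset (Fin N₂)) fun j' _ =>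
    (tendsto_finsetSum (Finset.univ : Finset (Fin N₁)) fun i' _ =>
      (D₁.transient i i').mul_const (U i' j')).mul (D₂.transient j j')
  simp only [mul_zero, Finset.sum_const_zero] at h3
  refine tendsto_nhds_unique tendsto_const_nhds (h3.congr fun n => ?_)
  have h4 := congrFun (congrFun (h2 n) i) j
  simp only [Matrix.mul_apply, Matrix.transpose_apply] at h4
  exact h4.symm

/-- Induction along the freezing period, backwards from its end. -/
theorem clock_induction {P : Fin k → Prop}
    (h : ∀ l : Fin k, (∀ hl : (l : ℕ) + 1 < k, P ⟨l + 1, hl⟩) → P l) (l : Fin k) : P l := by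
  obtain ⟨l, hlk⟩ := l
  induction hm : k - l generalizing l with
  | zero => omega
  | succ m ih => exact h _ fun hl => ih (l + 1) hl (by omega)

/-- The classes with an idle server are left at the end of the freezing period at the latest. -/
theorem eq_zero_of_single {N : ℕ} (B : Matrix (Fin N) (Fin N) ℝ) {u : Fin N → Fin k → ℝ}
    (hu : ∀ i l, u i l = ∑ i', B i i' * clk l (fun l' => u i' l') 0) : ∀ i l, u i l = 0 := by
  intro i l
  induction l using clock_induction generalizing i with
  | h l ih =>
    rw [hu]
    refine Finset.sum_eq_zero fun i' _ => ?_
    by_cases hl : (l : ℕ) + 1 < k <;> simp [clk, hl]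
    exact Or.inr (ih hl i')

/-- The classes with two busy servers are left after the end of the freezing period, since the
phases die out. -/
theorem eq_zero_of_both {u : Fin N₁ → Fin N₂ → Fin k → ℝ}
    (hu : ∀ i j l, u i j l = ∑ i', ∑ j', D₁.B i i' * D₂.B j j' *
      clk l (fun l' => u i' j' l') (u i' j' l)) : ∀ i j l, u i j l = 0 := by
  intro i j l
  induction l using clock_induction generalizing i j with
  | h l ih =>
    by_cases hl : (l : ℕ) + 1 < k
    · rw [hu]
      refine Finset.sum_eq_zero fun i' _ => Finset.sum_eq_zero fun j' _ => ?_
      simp [clk, hl, ih hl]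
    · refine eq_zero_of_service D₁ D₂ (u := fun i j => u i j l) (fun i j => ?_) i j
      simpa [clk, hl] using hu i j l

/-- The classes of the absorbing chain can be ordered so that it never returns to a class that it
has left, and within each class the chain dies out. -/
theorem eq_zero_of_yMatrix_mulVec_eq {u : YState N₁ N₂ k → ℝ}
    (hu : yMatrix D₁ D₂ π *ᵥ u = u) : u = 0 := by
  have h : ∀ y, u y = (yMatrix D₁ D₂ π *ᵥ u) y := fun y => (congrFun hu y).symm
  have h8 : ∀ i j, u (.c8 i j) = 0 := eq_zero_of_service D₁ D₂ fun i j => by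
    rw [h, yMatrix_mulVec_c8]
  have h13 : ∀ i l, u (.c13 i l) = 0 := eq_zero_of_single D₁.B fun i l => by
    rw [h, yMatrix_mulVec_c13]; simp [h8]
  have h14 : ∀ j l, u (.c14 j l) = 0 := eq_zero_of_single D₂.B fun j l => by
    rw [h, yMatrix_mulVec_c14]; simp [h8]
  have h7' : ∀ l, (yMatrix D₁ D₂ π *ᵥ u) (.c7 l) = 0 := fun l => by
    induction l using clock_induction with
    | h l ih =>
      rw [yMatrix_mulVec_c7]
      by_cases hl : (l : ℕ) + 1 < k
      · simp [clk, hl, h (.c7 _), ih hl]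
      · simp [clk, hl, h13, h14]
  have h7 : ∀ l, u (.c7 l) = 0 := fun l => by rw [h, h7']
  have h12 : ∀ i j l, u (.c12 i j l) = 0 := eq_zero_of_both D₁ D₂ fun i j l => by
    rw [h, yMatrix_mulVec_c12]; simp [h8, h14, clk_const]
  have h11 : ∀ i j l, u (.c11 i j l) = 0 := eq_zero_of_both D₁ D₂ fun i j l => by
    rw [h, yMatrix_mulVec_c11]; simp [h8, h13, clk_const]
  have h2 : ∀ i j l, u (.c2 i j l) = 0 := eq_zero_of_both D₁ D₂ fun i j l => by
    rw [h, yMatrix_mulVec_c2]; simp [h8, h14, clk_const]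
  have h3 : ∀ i j l, u (.c3 i j l) = 0 := eq_zero_of_both D₁ D₂ fun i j l => by
    rw [h, yMatrix_mulVec_c3]; simp [h8, h13, clk_const]
  have h9 : ∀ i l, u (.c9 i l) = 0 := eq_zero_of_single D₁.B fun i l => by
    rw [h, yMatrix_mulVec_c9]; simp [h7', h12]
  have h10 : ∀ j l, u (.c10 j l) = 0 := eq_zero_of_single D₂.B fun j l => by
    rw [h, yMatrix_mulVec_c10]; simp [h7', h11]
  have h5 : ∀ i l, u (.c5 i l) = 0 := eq_zero_of_single D₁.B fun i l => by
    rw [h, yMatrix_mulVec_c5]; simp [h7', h2]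
  have h6 : ∀ j l, u (.c6 j l) = 0 := eq_zero_of_single D₂.B fun j l => by
    rw [h, yMatrix_mulVec_c6]; simp [h7', h3]
  have h1 : ∀ i j l, u (.c1 i j l) = 0 := eq_zero_of_both D₁ D₂ fun i j l => by
    rw [h, yMatrix_mulVec_c1]; simp [h7', h10, h11, h5, h2, clk_const]
  have h4 : ∀ i j l, u (.c4 i j l) = 0 := eq_zero_of_both D₁ D₂ fun i j l => by
    rw [h, yMatrix_mulVec_c4]; simp [h7', h6, h3, h9, h12, clk_const]
  funext y
  cases y
  exacts [h1 _ _ _, h2 _ _ _, h3 _ _ _, h4 _ _ _, h5 _ _, h6 _ _, h7 _, h8 _ _, h9 _ _, h10 _ _,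
    h11 _ _ _, h12 _ _ _, h13 _ _, h14 _ _]

variable {D₁ D₂ π}

theorem mulVec_eq_op (x : SysState N₁ N₂ k) {y : YState N₁ N₂ k} (hx : Regular 1 x)
    (hy : track 1 x = some y) (f : YState N₁ N₂ k → ℝ) :
    (yMatrix D₁ D₂ π *ᵥ f) y = (sysChain D₁ D₂ π).op (trackVal 2 f) x := by
  rw [op_trackVal D₁ D₂ π hx, trackVal, hy, Option.elim_some]

theorem trackVal_le (h : ℕ) {f : YState N₁ N₂ k → ℝ} {c : ℝ} (hc : 0 ≤ c) (hf : ∀ y, f y ≤ c)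
    (x : SysState N₁ N₂ k) : trackVal h f x ≤ c := by
  unfold trackVal
  cases track h x with
  | none => exact hc
  | some y => exact hf y

theorem isTransient_yMatrix (hk : 1 ≤ k) :
    IsTransient (yMatrix D₁ D₂ π : Matrix (YState N₁ N₂ k) (YState N₁ N₂ k) ℝ) where
  nonneg y y' := by
    obtain ⟨x, hx, hy⟩ := exists_track_eq hk y
    have h1 := mulVec_eq_op (D₁ := D₁) (D₂ := D₂) (π := π) x hx hy (Pi.single y' 1)
    rw [Matrix.mulVec_single_one, Matrix.col_apply] at h1
    rw [h1, ← NoiseChain.op_const (sysChain D₁ D₂ π) 0 x]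
    refine NoiseChain.op_mono _ fun e => ?_
    unfold trackVal
    cases track 2 ((sysChain D₁ D₂ π).move x e) with
    | none => exact le_rfl
    | some z =>
      rw [Option.elim_some, Pi.single_apply]
      split_ifs <;> norm_num
  row_le y := by
    obtain ⟨x, hx, hy⟩ := exists_track_eq hk y
    rw [mulVec_eq_op x hx hy, ← NoiseChain.op_const (sysChain D₁ D₂ π) 1 x]
    exact NoiseChain.op_mono _ fun e => trackVal_le 2 zero_le_one (fun _ => le_rfl) _
  fixed u hu := eq_zero_of_yMatrix_mulVec_eq D₁ D₂ π hu

theorem next_aoi_le (x : SysState N₁ N₂ k) (o₁ : Option (Fin N₁)) (o₂ : Option (Fin N₂))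
    (i : Fin N₁) (j : Fin N₂) : (next π x o₁ o₂ i j).aoi ≤ x.aoi + 1 := by
  obtain ⟨_ | ⟨i, a⟩, _ | ⟨j, b⟩, l, δ⟩ := x <;> cases o₁ <;> cases o₂ <;> cases π <;>
    simp only [next, afterSlot, received] <;> split_ifs <;> simp only <;> omega

/-- Once its packet has been received, the absorbing chain stays in the support of `leftVec` until
it is absorbed successfully. -/
theorem leftVec_le (hk : 1 ≤ k) (y : YState N₁ N₂ k) :
    leftVec y ≤ (yMatrix D₁ D₂ π *ᵥ leftVec) y + successVec D₁ D₂ y := by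
  obtain ⟨x, hx, hy⟩ := exists_track_eq hk y
  have h1 : leftVec y = if x.aoi = 1 then 1 else 0 := by
    rw [← trackVal_leftVec hx, trackVal, hy, Option.elim_some]
  have h2 : successVec D₁ D₂ y = (sysChain D₁ D₂ π).op
      (fun z => if x.aoi = 1 ∧ z.aoi < x.aoi + 1 then 1 else 0) x := by
    rw [op_upToDate D₁ D₂ π hx, trackVal, hy, Option.elim_some]
  rw [h1, h2, mulVec_eq_op x hx hy, ← NoiseChain.op_add,
    ← NoiseChain.op_const (sysChain D₁ D₂ π) (if x.aoi = 1 then 1 else 0) x]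
  refine NoiseChain.op_mono _ fun e => ?_
  have h3 : Regular 2 ((sysChain D₁ D₂ π).move x e) := regular_next π hx _ _ _ _
  have h4 : ((sysChain D₁ D₂ π).move x e).aoi ≤ x.aoi + 1 := next_aoi_le x _ _ _ _
  rw [trackVal_leftVec h3]
  split_ifs with e1 e2 e3 <;> first | omega | norm_num

/-! ### Tightness of the age -/

/-- The contents of a server coincide except that ages of at least `n` are not distinguished. -/
def SrvAgree {N : ℕ} (n : ℕ) : Option (Fin N × ℕ) → Option (Fin N × ℕ) → Prop
  | none, none => True
  | some (i, a), some (i', a') => i = i' ∧ min a n = min a' n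
  | _, _ => False

/-- Two states of the system coincide except that ages of at least `n` are not distinguished. -/
structure Agree (n : ℕ) (x x' : SysState N₁ N₂ k) : Prop where
  srv1 : SrvAgree n x.srv1 x'.srv1
  srv2 : SrvAgree n x.srv2 x'.srv2
  clock : x.clock = x'.clock
  aoi : min x.aoi n = min x'.aoi n

theorem SrvAgree.afterSlot {N n : ℕ} {s s' : Option (Fin N × ℕ)} (h : SrvAgree n s s')
    (o : Option (Fin N)) : SrvAgree (n + 1) (afterSlot s o) (afterSlot s' o) := by
  rcases s with _ | ⟨i, a⟩ <;> rcases s' with _ | ⟨i', a'⟩ <;> cases o <;>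
    simp only [SrvAgree, DTDQ.afterSlot, true_and] at h ⊢
  omega

theorem SrvAgree.received {N n : ℕ} {s s' : Option (Fin N × ℕ)} (h : SrvAgree n s s')
    (o : Option (Fin N)) {δ δ' : ℕ} (hδ : min δ (n + 1) = min δ' (n + 1)) :
    min (received s o δ) (n + 1) = min (received s' o δ') (n + 1) := by
  rcases s with _ | ⟨i, a⟩ <;> rcases s' with _ | ⟨i', a'⟩ <;> cases o <;>
    simp only [SrvAgree, DTDQ.received] at h ⊢ <;> omega

theorem SrvAgree.serveProb_eq {N n : ℕ} {s s' : Option (Fin N × ℕ)} (h : SrvAgree n s s')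
    (D : DPH N) (o : Option (Fin N)) : serveProb D s o = serveProb D s' o := by
  rcases s with _ | ⟨i, a⟩ <;> rcases s' with _ | ⟨i', a'⟩ <;> simp only [SrvAgree] at h
  · rfl
  · rw [h.1]
    cases o <;> rfl

theorem Agree.next {n : ℕ} {x x' : SysState N₁ N₂ k} (h : Agree n x x') (o₁ : Option (Fin N₁))
    (o₂ : Option (Fin N₂)) (i : Fin N₁) (j : Fin N₂) :
    Agree (n + 1) (next π x o₁ o₂ i j) (next π x' o₁ o₂ i j) := by
  have h1 := h.srv1.afterSlot o₁
  have h2 := h.srv2.afterSlot o₂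
  have hδ := h.srv1.received o₁ (h.srv2.received o₂
    (by have := h.aoi; omega : min (x.aoi + 1) (n + 1) = min (x'.aoi + 1) (n + 1)))
  have hc := h.clock
  unfold DTDQ.next
  generalize DTDQ.received x.srv1 o₁ (DTDQ.received x.srv2 o₂ (x.aoi + 1)) = δ at *
  generalize DTDQ.received x'.srv1 o₁ (DTDQ.received x'.srv2 o₂ (x'.aoi + 1)) = δ' at *
  generalize DTDQ.afterSlot x.srv1 o₁ = s₁ at *
  generalize DTDQ.afterSlot x'.srv1 o₁ = s₁' at *
  generalize DTDQ.afterSlot x.srv2 o₂ = s₂ at *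
  generalize DTDQ.afterSlot x'.srv2 o₂ = s₂' at *
  rw [hc]
  by_cases hl : (x'.clock : ℕ) + 1 < k
  · simp only [hl, dite_true]
    exact ⟨h1, h2, rfl, hδ⟩
  · simp only [hl, dite_false]
    rcases s₁ with _ | ⟨i₁, a₁⟩ <;> rcases s₁' with _ | ⟨i₁', a₁'⟩ <;>
      rcases s₂ with _ | ⟨i₂, a₂⟩ <;> rcases s₂' with _ | ⟨i₂', a₂'⟩ <;>
      first | exact absurd h1 id | exact absurd h2 id | skip
    · cases π <;> exact ⟨by simp [SrvAgree], by simp [SrvAgree], rfl, hδ⟩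
    · exact ⟨by simp [SrvAgree], h2, rfl, hδ⟩
    · exact ⟨h1, by simp [SrvAgree], rfl, hδ⟩
    · exact ⟨h1, h2, rfl, hδ⟩

/-- The evolution does not depend on the ages, except through the age of information. -/
theorem Agree.op_iterate_eq (n : ℕ) {h : ℕ} {x x' : SysState N₁ N₂ k} (hxx' : Agree h x x') :
    (sysChain D₁ D₂ π).op^[n] (fun y => if h + n ≤ y.aoi then 1 else 0) x =
      (sysChain D₁ D₂ π).op^[n] (fun y => if h + n ≤ y.aoi then 1 else 0) x' := by
  induction n generalizing h x x' with
  | zero =>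
    have := hxx'.aoi
    simp only [add_zero, Function.iterate_zero, id_eq]
    congr 1
    apply propext
    omega
  | succ n ih =>
    simp only [Function.iterate_succ_apply']
    refine Finset.sum_congr rfl fun e _ => ?_
    have h1 := ih (hxx'.next (π := π) e.1 e.2.1 e.2.2.1 e.2.2.2)
    rw [show h + 1 + n = h + (n + 1) by ring] at h1
    have h2 : (sysChain D₁ D₂ π).weight x e = (sysChain D₁ D₂ π).weight x' e := by
      simp only [sysChain, hxx'.srv1.serveProb_eq, hxx'.srv2.serveProb_eq]
    rw [h2]
    exact congrArg _ h1

/-- The packet of age `h` is being followed, or a newer packet has been received. -/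
def Decided (h : ℕ) : SysState N₁ N₂ k → Prop
  | ⟨none, none, _, δ⟩ => δ ≤ h
  | ⟨some (_, a), none, _, δ⟩ => δ ≤ h ∨ a = h
  | ⟨none, some (_, b), _, δ⟩ => δ ≤ h ∨ b = h
  | ⟨some (_, a), some (_, b), _, δ⟩ =>
    δ < h ∨ (δ = h ∧ (a < h ∨ b < h)) ∨ (h < δ ∧ (a = h ∧ b ≠ h ∨ a ≠ h ∧ b = h))

theorem Decided.le_trackVal {h : ℕ} {x : SysState N₁ N₂ k} (hx : Decided h x) :
    (if h ≤ x.aoi then 1 else 0) ≤ trackVal h 1 x := by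
  obtain ⟨_ | ⟨i, a⟩, _ | ⟨j, b⟩, l, δ⟩ := x <;> simp only [Decided] at hx <;>
    simp only [trackVal, track] <;> split_ifs <;>
    simp only [Option.elim_some, Option.elim_none, Pi.one_apply, le_refl, zero_le_one] <;> omega

theorem Decided.next {h : ℕ} {x : SysState N₁ N₂ k} (hx : Decided h x) (o₁ : Option (Fin N₁))
    (o₂ : Option (Fin N₂)) (i : Fin N₁) (j : Fin N₂) :
    Decided (h + 1) (next π x o₁ o₂ i j) := by
  obtain ⟨_ | ⟨i, a⟩, _ | ⟨j, b⟩, l, δ⟩ := x <;> cases o₁ <;> cases o₂ <;> cases π <;>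
    simp only [DTDQ.next, afterSlot, received] <;> split_ifs <;>
    simp only [Decided] at hx ⊢ <;> omega

theorem Decided.op_iterate_le (n : ℕ) {h : ℕ} {x : SysState N₁ N₂ k} (hx : Decided h x) :
    (sysChain D₁ D₂ π).op^[n] (fun y => if h + n ≤ y.aoi then 1 else 0) x ≤
      (sysChain D₁ D₂ π).op^[n] (trackVal (h + n) 1) x := by
  induction n generalizing h x with
  | zero => exact hx.le_trackVal
  | succ n ih =>
    rw [Function.iterate_succ_apply', Function.iterate_succ_apply']
    refine NoiseChain.op_mono _ fun e => ?_
    have h1 := ih (hx.next (π := π) e.1 e.2.1 e.2.2.1 e.2.2.2)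
    rw [show h + 1 + n = h + (n + 1) by ring] at h1
    exact h1

/-- The age is at least `n` after `n` slots only if nothing sampled in these slots has been
received. The present ages do not influence this event, so that a packet in service (or, in an idle
system, the freshest received one) may be taken to have just been sampled; its absorbing chain has
then survived for `n` slots. -/
theorem exists_op_iterate_aoi_le (n : ℕ) (x : SysState N₁ N₂ k) :
    ∃ x' : SysState N₁ N₂ k, (sysChain D₁ D₂ π).op^[n] (fun y => if n ≤ y.aoi then 1 else 0) x ≤
      trackVal 0 (yMatrix D₁ D₂ π ^ n *ᵥ 1) x' := by
  obtain ⟨x', h1, h2, h3⟩ : ∃ x' : SysState N₁ N₂ k,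
      Agree 0 x x' ∧ Decided 0 x' ∧ Regular 0 x' := by
    obtain ⟨_ | ⟨i, a⟩, _ | ⟨j, b⟩, l, δ⟩ := x
    · exact ⟨⟨none, none, l, 0⟩, by constructor <;> simp [SrvAgree], by simp [Decided],
        by simp [Regular]⟩
    · exact ⟨⟨none, some (j, 0), l, 1⟩, by constructor <;> simp [SrvAgree], by simp [Decided],
        by simp [Regular]⟩
    · exact ⟨⟨some (i, 0), none, l, 1⟩, by constructor <;> simp [SrvAgree], by simp [Decided],
        by simp [Regular]⟩
    · exact ⟨⟨some (i, 1), some (j, 0), l, 1⟩, by constructor <;> simp [SrvAgree],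
        by simp [Decided], by simp [Regular]⟩
  refine ⟨x', ?_⟩
  have h4 := h1.op_iterate_eq (D₁ := D₁) (D₂ := D₂) (π := π) n
  have h5 := h2.op_iterate_le (D₁ := D₁) (D₂ := D₂) (π := π) n
  rw [op_iterate_trackVal D₁ D₂ π n h3 (fun _ _ => rfl)] at h5
  rw [zero_add] at h4 h5
  exact h4.trans_le h5

end YTransient

/-! ### Long-run averages of the system -/

namespace Negligible

/-- A process that is close to a negligible one, up to an error whose averages are small, is
negligible. -/
theorem of_approx {Ω : Type*} [MeasurableSpace Ω] {μ : Measure Ω} [IsProbabilityMeasure μ]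
    {Z : ℕ → Ω → ℝ} (hm : ∀ t, Measurable (Z t)) (hb : ∃ c, ∀ t ω, |Z t ω| ≤ c)
    (h : ∀ ε > 0, ∃ Z₁ Z₂ : ℕ → Ω → ℝ, Negligible μ Z₁ ∧ Negligible μ Z₂ ∧
      ∀ t ω, |Z t ω - Z₁ t ω| ≤ Z₂ t ω + ε) : Negligible μ Z := by
  refine ⟨hm, hb, ?_⟩
  rw [Metric.tendsto_atTop']
  intro ε hε
  obtain ⟨Z₁, Z₂, h₁, h₂, hle⟩ := h (ε / 2) (half_pos hε)
  have hlim := h₁.tendsto.add h₂.tendsto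
  rw [add_zero] at hlim
  obtain ⟨T₀, hT₀⟩ := eventually_atTop.1 (hlim.eventually_lt_const (half_pos hε))
  refine ⟨T₀, fun T hT => ?_⟩
  have hT' : (0 : ℝ) < T := by exact_mod_cast (Nat.zero_le T₀).trans_lt hT
  have hpt : ∀ ω, |(T : ℝ)⁻¹ * ∑ t ∈ Finset.range T, Z t ω| ≤
      |(T : ℝ)⁻¹ * ∑ t ∈ Finset.range T, Z₁ t ω| +
        |(T : ℝ)⁻¹ * ∑ t ∈ Finset.range T, Z₂ t ω| + ε / 2 := by
    intro ω
    have h1 : |(T : ℝ)⁻¹ * ∑ t ∈ Finset.range T, (Z t ω - Z₁ t ω)| ≤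
        (T : ℝ)⁻¹ * ∑ t ∈ Finset.range T, Z₂ t ω + ε / 2 := by
      rw [abs_mul, abs_of_pos (inv_pos.2 hT'), inv_mul_le_iff₀ hT', mul_add,
        mul_inv_cancel_left₀ hT'.ne']
      refine (Finset.abs_sum_le_sum_abs _ _).trans
        ((Finset.sum_le_sum fun t _ => hle t ω).trans (le_of_eq ?_))
      simp [Finset.sum_add_distrib]
    have h2 : (T : ℝ)⁻¹ * ∑ t ∈ Finset.range T, Z t ω =
        (T : ℝ)⁻¹ * ∑ t ∈ Finset.range T, Z₁ t ω +
          (T : ℝ)⁻¹ * ∑ t ∈ Finset.range T, (Z t ω - Z₁ t ω) := by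
      rw [← mul_add, ← Finset.sum_add_distrib]
      simp
    rw [h2]
    have h3 := abs_add_le ((T : ℝ)⁻¹ * ∑ t ∈ Finset.range T, Z₁ t ω)
      ((T : ℝ)⁻¹ * ∑ t ∈ Finset.range T, (Z t ω - Z₁ t ω))
    have h4 := le_abs_self ((T : ℝ)⁻¹ * ∑ t ∈ Finset.range T, Z₂ t ω)
    linarith
  have hi₁ := (integrable_average (μ := μ) h₁.measurable h₁.bounded T).abs
  have hi₂ := (integrable_average (μ := μ) h₂.measurable h₂.bounded T).abs
  have hi := integral_mono ((integrable_average (μ := μ) hm hb T).abs)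
    ((hi₁.add hi₂).add (integrable_const (ε / 2))) hpt
  have hadd : ∫ ω, (|(T : ℝ)⁻¹ * ∑ t ∈ Finset.range T, Z₁ t ω| +
        |(T : ℝ)⁻¹ * ∑ t ∈ Finset.range T, Z₂ t ω| + ε / 2) ∂μ =
      ∫ ω, |(T : ℝ)⁻¹ * ∑ t ∈ Finset.range T, Z₁ t ω| ∂μ +
        ∫ ω, |(T : ℝ)⁻¹ * ∑ t ∈ Finset.range T, Z₂ t ω| ∂μ + ε / 2 := by
    have hi₁₂ : Integrable (fun ω => |(T : ℝ)⁻¹ * ∑ t ∈ Finset.range T, Z₁ t ω| +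
        |(T : ℝ)⁻¹ * ∑ t ∈ Finset.range T, Z₂ t ω|) μ := hi₁.add hi₂
    rw [integral_add hi₁₂ (integrable_const _), integral_add hi₁ hi₂]
    simp
  have hlt := hT₀ T hT.le
  rw [Real.dist_0_eq_abs, abs_of_nonneg (integral_nonneg fun ω => abs_nonneg _)]
  refine (hi.trans_eq hadd).trans_lt ?_
  linarith

end Negligible

section System

variable {N₁ N₂ k : ℕ} {D₁ : DPH N₁} {D₂ : DPH N₂} {π : Priority}

theorem exists_occupancy_eq (w : WState N₁ N₂ k) : ∃ x : SysState N₁ N₂ k, occupancy x = w := by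
  cases w with
  | idle l => exact ⟨⟨none, none, l, 0⟩, rfl⟩
  | busy1 i l => exact ⟨⟨some (i, 0), none, l, 0⟩, rfl⟩
  | busy2 j l => exact ⟨⟨none, some (j, 0), l, 0⟩, rfl⟩
  | both i j l => exact ⟨⟨some (i, 0), some (j, 0), l, 0⟩, rfl⟩

theorem wMatrix_nonneg (w w' : WState N₁ N₂ k) : 0 ≤ wMatrix D₁ D₂ π w w' := by
  obtain ⟨x, rfl⟩ := exists_occupancy_eq w
  have h1 := op_comp_occupancy D₁ D₂ π (Pi.single w' 1) x
  rw [Matrix.mulVec_single_one, Matrix.col_apply] at h1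
  rw [← h1, ← NoiseChain.op_const (sysChain D₁ D₂ π) 0 x]
  refine NoiseChain.op_mono _ fun e => ?_
  rw [Pi.single_apply]
  split_ifs <;> norm_num

theorem wMatrix_sum (w : WState N₁ N₂ k) : ∑ w', wMatrix D₁ D₂ π w w' = 1 := by
  obtain ⟨x, rfl⟩ := exists_occupancy_eq w
  have h1 := op_comp_occupancy D₁ D₂ π (fun _ => 1) x
  rw [NoiseChain.op_const] at h1
  simpa [mulVec, dotProduct] using h1.symm

variable {p : WState N₁ N₂ k → ℝ}
  {Ω : Type*} [MeasurableSpace Ω] {μ : Measure Ω} [IsProbabilityMeasure μ]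
  {X : ℕ → Ω → SysState N₁ N₂ k}

/-- The ergodic theorem for the occupancy chain, through the Poisson equation. -/
theorem negligible_occupancy
    (hp : IsStationary (wMatrix D₁ D₂ π) p)
    (hu : ∀ p' : WState N₁ N₂ k → ℝ, IsStationary (wMatrix D₁ D₂ π) p' → p' = p)
    (hX : IsDTDQ D₁ D₂ π μ X) (g : WState N₁ N₂ k → ℝ) :
    Negligible μ fun t ω => g (occupancy (X t ω)) - p ⬝ᵥ g := by
  obtain ⟨u, hug⟩ := exists_poisson_solution (wMatrix_nonneg (D₁ := D₁) (D₂ := D₂) (π := π))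
    wMatrix_sum hp hu g
  obtain ⟨c, -, hc⟩ := exists_abs_le u
  refine (hX.isPath.negligible_sub_op (F := fun x => u (occupancy x))
    fun x => hc _).congr fun t ω => ?_
  rw [op_comp_occupancy, hug]

/-- The ergodic theorem for a function of the state that depends on the absorbing chain of the
packet of age `h`: conditioning on the state `h + 1` slots earlier reduces it to the occupancy
chain. -/
theorem negligible_trackVal
    (hp : IsStationary (wMatrix D₁ D₂ π) p)
    (hu : ∀ p' : WState N₁ N₂ k → ℝ, IsStationary (wMatrix D₁ D₂ π) p' → p' = p)
    (hX : IsDTDQ D₁ D₂ π μ X) (h : ℕ) (f : YState N₁ N₂ k → ℝ) {q : SysState N₁ N₂ k → ℝ} {c : ℝ}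
    (hq : ∀ x, |q x| ≤ c) (hqf : ∀ x, Regular h x → q x = trackVal h f x) :
    Negligible μ fun t ω =>
      q (X t ω) - startWeight D₁ D₂ π p ⬝ᵥ (yMatrix D₁ D₂ π ^ h *ᵥ f) := by
  have h1 := hX.isPath.negligible_sub_op_iterate hq (h + 1)
  have h2 := negligible_occupancy hp hu hX (sampleVal D₁ D₂ π (yMatrix D₁ D₂ π ^ h *ᵥ f))
  refine (h1.add h2).congr fun t ω => ?_
  have h3 : (sysChain D₁ D₂ π).op^[h + 1] q (X t ω) =
      sampleVal D₁ D₂ π (yMatrix D₁ D₂ π ^ h *ᵥ f) (occupancy (X t ω)) := by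
    rw [Function.iterate_succ_apply', ← op_trackVal_zero]
    refine NoiseChain.op_congr _ fun e =>
      op_iterate_trackVal D₁ D₂ π h (regular_zero_next π _ _ _ _ _) fun y hy => ?_
    rw [zero_add] at hy ⊢
    exact hqf y hy
  rw [h3, startWeight_dotProduct]
  ring

theorem negligible_age_eq
    (hp : IsStationary (wMatrix D₁ D₂ π) p)
    (hu : ∀ p' : WState N₁ N₂ k → ℝ, IsStationary (wMatrix D₁ D₂ π) p' → p' = p)
    (hX : IsDTDQ D₁ D₂ π μ X) (h : ℕ) :
    Negligible μ fun t ω => (if age X t ω = h then 1 else 0) -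
      startWeight D₁ D₂ π p ⬝ᵥ (yMatrix D₁ D₂ π ^ h *ᵥ leftVec) :=
  negligible_trackVal hp hu hX h leftVec (q := fun x => if x.aoi = h then 1 else 0) (c := 1)
    (fun x => by split_ifs <;> simp) fun x hx => (trackVal_leftVec hx).symm

theorem negligible_age_lt
    (hp : IsStationary (wMatrix D₁ D₂ π) p)
    (hu : ∀ p' : WState N₁ N₂ k → ℝ, IsStationary (wMatrix D₁ D₂ π) p' → p' = p)
    (hX : IsDTDQ D₁ D₂ π μ X) (H : ℕ) :
    Negligible μ fun t ω => (if age X t ω < H then 1 else 0) -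
      ∑ h ∈ Finset.range H, startWeight D₁ D₂ π p ⬝ᵥ (yMatrix D₁ D₂ π ^ h *ᵥ leftVec) := by
  refine (Negligible.sum (Finset.range H) fun h _ => negligible_age_eq hp hu hX h).congr
    fun t ω => ?_
  rw [Finset.sum_sub_distrib]
  simp

/-- In the long run, a reception of an up-to-date packet at the peak age `h` occurs with the
frequency of a successful absorption after `h` slots. -/
theorem negligible_reception_eq
    (hp : IsStationary (wMatrix D₁ D₂ π) p)
    (hu : ∀ p' : WState N₁ N₂ k → ℝ, IsStationary (wMatrix D₁ D₂ π) p' → p' = p)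
    (hX : IsDTDQ D₁ D₂ π μ X) (h : ℕ) :
    Negligible μ fun t ω =>
      (if age X t ω = h ∧ age X (t + 1) ω < age X t ω + 1 then 1 else 0) -
        startWeight D₁ D₂ π p ⬝ᵥ (yMatrix D₁ D₂ π ^ h *ᵥ successVec D₁ D₂) := by
  have hb : ∀ x y : SysState N₁ N₂ k,
      |(if x.aoi = h ∧ y.aoi < x.aoi + 1 then 1 else 0 : ℝ)| ≤ 1 := fun x y => by
    split_ifs <;> simp
  have h1 := hX.isPath.negligible_increment hb
  have h2 := negligible_trackVal hp hu hX h (successVec D₁ D₂)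
    (q := fun x => (sysChain D₁ D₂ π).op
      (fun y => if x.aoi = h ∧ y.aoi < x.aoi + 1 then 1 else 0) x)
    (fun x => NoiseChain.abs_op_le _ (hb x) x) fun x hx => op_upToDate D₁ D₂ π hx
  refine (h1.add h2).congr fun t ω => ?_
  simp only [age]
  ring_nf

/-- The age is tight, so that the limiting frequencies of its values sum to `1`. -/
theorem dotProduct_leftVec_eq_one
    (hp : IsStationary (wMatrix D₁ D₂ π) p)
    (hu : ∀ p' : WState N₁ N₂ k → ℝ, IsStationary (wMatrix D₁ D₂ π) p' → p' = p)
    (hX : IsDTDQ D₁ D₂ π μ X) (hk : 1 ≤ k) :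
    startWeight D₁ D₂ π p ⬝ᵥ ((1 - yMatrix D₁ D₂ π)⁻¹ *ᵥ leftVec) = 1 := by
  have hA := isTransient_yMatrix (D₁ := D₁) (D₂ := D₂) (π := π) hk
  have hsum := (hA.hasSum_dotProduct_pow (startWeight D₁ D₂ π p) leftVec).tendsto_sum_nat
  refine le_antisymm (le_of_tendsto' hsum fun H => ?_) ?_
  · have h1 := (negligible_age_lt hp hu hX H).neg.nonpos_of_le
      (δ := ∑ h ∈ Finset.range H, startWeight D₁ D₂ π p ⬝ᵥ
        (yMatrix D₁ D₂ π ^ h *ᵥ leftVec) - 1) fun t ω => by split_ifs <;> linarith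
    linarith
  · obtain ⟨c, r, hc, hr0, hr1, hle⟩ := hA.exists_pow_mulVec_one_le
    have hlim := hsum.add ((tendsto_pow_atTop_nhds_zero_of_lt_one hr0 hr1).const_mul c)
    rw [mul_zero, add_zero] at hlim
    refine ge_of_tendsto' hlim fun H => ?_
    have h1 := hX.isPath.negligible_sub_op_iterate
      (F := fun y : SysState N₁ N₂ k => if H ≤ y.aoi then (1 : ℝ) else 0) (c := 1)
      (fun x => by split_ifs <;> simp) H
    have h2 := ((negligible_age_lt hp hu hX H).add h1).nonpos_of_le
      (δ := 1 - ∑ h ∈ Finset.range H, startWeight D₁ D₂ π p ⬝ᵥ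
        (yMatrix D₁ D₂ π ^ h *ᵥ leftVec) - c * r ^ H) fun t ω => by
      obtain ⟨x', hx'⟩ := exists_op_iterate_aoi_le (D₁ := D₁) (D₂ := D₂) (π := π) H (X t ω)
      have h3 := hx'.trans (trackVal_le 0 (mul_nonneg hc (pow_nonneg hr0 H)) (hle H) x')
      simp only [age]
      by_cases hH : (X t ω).aoi < H
      · simp only [hH, if_true, not_le.2 hH, if_false]
        linarith
      · simp only [hH, if_false, not_lt.1 hH, if_true]
        linarith
    linarith

end System

/-! ### Averages along the successive occurrences of an event -/

theorem sum_range_count_nth (P : ℕ → Prop) [DecidablePred P] (g : ℕ → ℝ) (M : ℕ) :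
    ∑ n ∈ Finset.range (Nat.count P M), g (Nat.nth P n) =
      ∑ t ∈ Finset.range M, if P t then g t else 0 := by
  induction M with
  | zero => simp
  | succ M ih =>
    rw [Nat.count_succ, Finset.sum_range_succ _ M, ← ih]
    split_ifs with h
    · rw [Finset.sum_range_succ, Nat.nth_count h]
    · simp

theorem abs_sum_range_sub_le {f : ℕ → ℝ} (hf : ∀ n, |f n| ≤ 1) (K N : ℕ) :
    |∑ n ∈ Finset.range K, f n - ∑ n ∈ Finset.range N, f n| ≤ |(N : ℝ) - K| := by
  wlog h : K ≤ N generalizing K N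
  · rw [abs_sub_comm, abs_sub_comm (N : ℝ)]
    exact this N K (le_of_not_ge h)
  have hc : (K : ℝ) ≤ N := by exact_mod_cast h
  rw [abs_sub_comm, ← Finset.sum_Ico_eq_sub _ h, abs_of_nonneg (sub_nonneg.2 hc)]
  refine (Finset.abs_sum_le_sum_abs _ _).trans
    ((Finset.sum_le_card_nsmul _ _ 1 fun n _ => hf n).trans ?_)
  simp [Nat.cast_sub h]

theorem integral_indicator_eq {Ω : Type*} [MeasurableSpace Ω] {μ : Measure Ω} {Z : Ω → ℕ}
    (hZ : Measurable Z) (h : ℕ) :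
    ∫ ω, (if Z ω = h then 1 else 0 : ℝ) ∂μ = μ.real {ω | Z ω = h} := by
  have hm : MeasurableSet {ω | Z ω = h} := hZ (measurableSet_singleton h)
  rw [← integral_indicator_one hm]
  exact integral_congr_ae (Eventually.of_forall fun ω => by simp [Set.indicator_apply])

theorem measurable_nth {Ω : Type*} [MeasurableSpace Ω] {P : Ω → ℕ → Prop}
    (hP : ∀ t, MeasurableSet {ω | P ω t}) (n : ℕ) : Measurable fun ω => Nat.nth (P ω) n := by
  classical
  have hcount : ∀ t, Measurable fun ω => Nat.count (P ω) t := by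
    intro t
    induction t with
    | zero => simp
    | succ t ih =>
      simp only [Nat.count_succ]
      exact ih.add (Measurable.ite (hP t) measurable_const measurable_const)
  have hpos : ∀ t, MeasurableSet {ω | Nat.nth (P ω) n = t + 1} := by
    intro t
    have h : {ω | Nat.nth (P ω) n = t + 1} =
        {ω | P ω (t + 1)} ∩ (fun ω => Nat.count (P ω) (t + 1)) ⁻¹' {n} := by
      ext ω
      simp only [Set.mem_ofPred_eq, Set.mem_inter_iff, Set.mem_preimage, Set.mem_singleton_iff]
      constructor
      · intro h
        have h0 : Nat.nth (P ω) n ≠ 0 := by simp [h]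
        rw [← h]
        exact ⟨Nat.nth_mem_of_ne_zero h0,
          Nat.count_nth fun hf => Nat.lt_card_toFinset_of_nth_ne_zero h0 hf⟩
      · rintro ⟨h1, h2⟩
        rw [← h2, Nat.nth_count h1]
    rw [h]
    exact (hP _).inter (hcount _ (measurableSet_singleton n))
  refine measurable_to_countable' fun t => ?_
  cases t with
  | succ t => exact hpos t
  | zero =>
    -- the value `0` is also taken when the event occurs at most `n` times
    have h : (fun ω => Nat.nth (P ω) n) ⁻¹' {0} = (⋃ t, {ω | Nat.nth (P ω) n = t + 1})ᶜ := by
      ext ω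
      simp only [Set.mem_preimage, Set.mem_singleton_iff, Set.mem_compl_iff, Set.mem_iUnion,
        Set.mem_ofPred_eq, not_exists]
      exact ⟨fun h t => by simp [h], fun h => by
        by_contra h0
        exact h _ (Nat.succ_pred_eq_of_ne_zero h0).symm⟩
    rw [h]
    exact (MeasurableSet.iUnion hpos).compl

open Classical in
/-- If an event occurs with the long-run frequency `c > 0`, and if the values that a process takes
at its occurrences have the average `m` per unit of time, then they have the average `m / c` per
occurrence. -/
theorem tendsto_average_nth {Ω : Type*} [MeasurableSpace Ω] {μ : Measure Ω} [IsProbabilityMeasure μ]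
    {P : Ω → ℕ → Prop} (hP0 : ∀ ω, ¬ P ω 0) (hP : ∀ t, MeasurableSet {ω | P ω t})
    {g : ℕ → Ω → ℝ} (hgm : ∀ t, Measurable (g t)) (hg : ∀ t ω, |g t ω| ≤ 1) {c m : ℝ} (hc : 0 < c)
    (h₁ : Negligible μ fun t ω => (if P ω (t + 1) then 1 else 0) - c)
    (h₂ : Negligible μ fun t ω => (if P ω (t + 1) then g (t + 1) ω else 0) - m) :
    Tendsto (fun K : ℕ => (K : ℝ)⁻¹ * ∑ n ∈ Finset.range K, ∫ ω, g (Nat.nth (P ω) n) ω ∂μ)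
      atTop (𝓝 (m / c)) := by
  have hmeas : ∀ n, Measurable fun ω => g (Nat.nth (P ω) n) ω := fun n =>
    (measurable_from_prod_countable_right (f := fun q : ℕ × Ω => g q.1 q.2) hgm).comp
      ((measurable_nth hP n).prodMk measurable_id)
  set Z₁ : ℕ → Ω → ℝ := fun t ω => (if P ω (t + 1) then 1 else 0) - c with hZ₁
  set Z₂ : ℕ → Ω → ℝ := fun t ω => (if P ω (t + 1) then g (t + 1) ω else 0) - m with hZ₂
  set E : (ℕ → Ω → ℝ) → ℕ → ℝ := fun Z T =>
    ∫ ω, |(T : ℝ)⁻¹ * ∑ t ∈ Finset.range T, Z t ω| ∂μ with hE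
  have habs : ∀ (Z : ℕ → Ω → ℝ) (T : ℕ) (ω : Ω), |∑ t ∈ Finset.range T, Z t ω| =
      T * |(T : ℝ)⁻¹ * ∑ t ∈ Finset.range T, Z t ω| := by
    intro Z T ω
    rcases Nat.eq_zero_or_pos T with rfl | hT
    · simp
    · have hT' : (0 : ℝ) < T := by exact_mod_cast hT
      rw [abs_mul, abs_of_pos (inv_pos.2 hT'), mul_inv_cancel_left₀ hT'.ne']
  -- the number of terms is off by the number of occurrences up to `T`, minus `K`
  have hpt : ∀ (K T : ℕ) (ω : Ω),
      |∑ n ∈ Finset.range K, g (Nat.nth (P ω) n) ω - m * T| ≤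
        T * |(T : ℝ)⁻¹ * ∑ t ∈ Finset.range T, Z₁ t ω| +
          T * |(T : ℝ)⁻¹ * ∑ t ∈ Finset.range T, Z₂ t ω| + |c * T - K| := by
    intro K T ω
    rw [← habs, ← habs]
    have hshift : ∀ f : ℕ → ℝ, ∑ n ∈ Finset.range (Nat.count (P ω) (T + 1)), f (Nat.nth (P ω) n) =
        ∑ t ∈ Finset.range T, if P ω (t + 1) then f (t + 1) else 0 := by
      intro f
      rw [sum_range_count_nth, Finset.sum_range_succ', if_neg (hP0 ω), add_zero]
    have hN : (Nat.count (P ω) (T + 1) : ℝ) = ∑ t ∈ Finset.range T, Z₁ t ω + c * T := by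
      have := hshift fun _ => 1
      simp only [Finset.sum_const, Finset.card_range, nsmul_eq_mul, mul_one] at this
      rw [this]
      simp only [hZ₁, Finset.sum_sub_distrib, Finset.sum_const, Finset.card_range, nsmul_eq_mul]
      ring
    have hM : ∑ n ∈ Finset.range (Nat.count (P ω) (T + 1)), g (Nat.nth (P ω) n) ω =
        ∑ t ∈ Finset.range T, Z₂ t ω + m * T := by
      rw [hshift fun t => g t ω]
      simp only [hZ₂, Finset.sum_sub_distrib, Finset.sum_const, Finset.card_range, nsmul_eq_mul]
      ring
    have h3 := abs_sum_range_sub_le (fun n => hg (Nat.nth (P ω) n) ω) K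
      (Nat.count (P ω) (T + 1))
    rw [hN, hM] at h3
    have h4 : ∑ n ∈ Finset.range K, g (Nat.nth (P ω) n) ω - m * T =
        (∑ n ∈ Finset.range K, g (Nat.nth (P ω) n) ω - (∑ t ∈ Finset.range T, Z₂ t ω + m * T)) +
          ∑ t ∈ Finset.range T, Z₂ t ω := by ring
    have h5 := abs_add_le (∑ n ∈ Finset.range K, g (Nat.nth (P ω) n) ω -
      (∑ t ∈ Finset.range T, Z₂ t ω + m * T)) (∑ t ∈ Finset.range T, Z₂ t ω)
    have h6 := abs_add_le (∑ t ∈ Finset.range T, Z₁ t ω) (c * T - K)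
    rw [← h4] at h5
    rw [← add_sub_assoc] at h6
    linarith
  have hint : ∀ K T : ℕ, |∑ n ∈ Finset.range K, ∫ ω, g (Nat.nth (P ω) n) ω ∂μ - m * T| ≤
      T * E Z₁ T + T * E Z₂ T + |c * T - K| := by
    intro K T
    have hi : ∀ n, Integrable (fun ω => g (Nat.nth (P ω) n) ω) μ := fun n =>
      integrable_of_abs_le (hmeas n) fun ω => hg _ ω
    have hi₁ := (Negligible.integrable_average (μ := μ) h₁.measurable h₁.bounded T).abs.const_mul
      (T : ℝ)
    have hi₂ := (Negligible.integrable_average (μ := μ) h₂.measurable h₂.bounded T).abs.const_mul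
      (T : ℝ)
    have hs : Integrable (fun ω => ∑ n ∈ Finset.range K, g (Nat.nth (P ω) n) ω) μ :=
      integrable_finsetSum _ fun n _ => hi n
    have h3 : ∑ n ∈ Finset.range K, ∫ ω, g (Nat.nth (P ω) n) ω ∂μ - m * T =
        ∫ ω, (∑ n ∈ Finset.range K, g (Nat.nth (P ω) n) ω - m * T) ∂μ := by
      rw [integral_sub hs (integrable_const _), integral_finsetSum _ fun n _ => hi n]
      simp
    rw [h3]
    refine (norm_integral_le_integral_norm (μ := μ)
      fun ω => ∑ n ∈ Finset.range K, g (Nat.nth (P ω) n) ω - m * T).trans ?_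
    refine (integral_mono (hs.sub (integrable_const _)).norm
      ((hi₁.add hi₂).add (integrable_const |c * T - K|)) fun ω => hpt K T ω).trans (le_of_eq ?_)
    rw [integral_add' (hi₁.add hi₂) (integrable_const _), integral_add' hi₁ hi₂,
      integral_const_mul, integral_const_mul]
    simp [hE]
  -- the time by which about `K` occurrences are expected
  let T : ℕ → ℕ := fun K => ⌊c⁻¹ * K⌋₊
  have hTK : Tendsto (fun K : ℕ => (T K : ℝ) / K) atTop (𝓝 c⁻¹) :=
    (tendsto_nat_floor_mul_div_atTop (inv_pos.2 hc).le).comp tendsto_natCast_atTop_atTop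
  have hT : Tendsto T atTop atTop :=
    tendsto_nat_floor_atTop.comp
      (tendsto_natCast_atTop_atTop.const_mul_atTop (inv_pos.2 hc))
  have hb : Tendsto (fun K : ℕ => (T K : ℝ) / K * (E Z₁ (T K) + E Z₂ (T K)) +
      |c * ((T K : ℝ) / K) - 1| + |m * ((T K : ℝ) / K) - m / c|) atTop (𝓝 0) := by
    have h3 := ((hTK.mul ((h₁.tendsto.comp hT).add (h₂.tendsto.comp hT))).add
      ((hTK.const_mul c).sub_const 1).abs).add ((hTK.const_mul m).sub_const (m / c)).abs
    have h4 : c * c⁻¹ - 1 = 0 := by rw [mul_inv_cancel₀ hc.ne', sub_self]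
    have h5 : m * c⁻¹ - m / c = 0 := by rw [div_eq_mul_inv, sub_self]
    rwa [h4, h5, abs_zero, add_zero, add_zero, add_zero, mul_zero] at h3
  rw [tendsto_iff_norm_sub_tendsto_zero]
  refine squeeze_zero' (Eventually.of_forall fun _ => norm_nonneg _) ?_ hb
  filter_upwards [eventually_gt_atTop 0] with K hK
  have hK' : (0 : ℝ) < K := by exact_mod_cast hK
  have h3 : (K : ℝ)⁻¹ * ∑ n ∈ Finset.range K, ∫ ω, g (Nat.nth (P ω) n) ω ∂μ - m / c =
      (K : ℝ)⁻¹ * (∑ n ∈ Finset.range K, ∫ ω, g (Nat.nth (P ω) n) ω ∂μ - m * T K) +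
        (m * ((T K : ℝ) / K) - m / c) := by ring
  have h4 : (K : ℝ)⁻¹ * (T K * E Z₁ (T K) + T K * E Z₂ (T K) + |c * T K - K|) =
      (T K : ℝ) / K * (E Z₁ (T K) + E Z₂ (T K)) + |c * ((T K : ℝ) / K) - 1| := by
    have h5 : c * ((T K : ℝ) / K) - 1 = (K : ℝ)⁻¹ * (c * T K - K) := by field_simp
    rw [h5, abs_mul, abs_of_pos (inv_pos.2 hK')]
    ring
  rw [Real.norm_eq_abs, h3]
  refine (abs_add_le _ _).trans (add_le_add_left ?_ _)
  rw [← h4, abs_mul, abs_of_pos (inv_pos.2 hK')]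
  exact mul_le_mul_of_nonneg_left (hint K (T K)) (inv_pos.2 hK').le

/-! ### The initial vector and the rate of receptions -/

variable {N₁ N₂ k : ℕ} {D₁ : DPH N₁} {D₂ : DPH N₂} {π : Priority}

theorem startWeight_nonneg {p : WState N₁ N₂ k → ℝ} (hp : ∀ w, 0 ≤ p w) (y : YState N₁ N₂ k) :
    0 ≤ startWeight D₁ D₂ π p y := by
  have hr : ∀ l l' : Fin k, 0 ≤ reset l l' := fun l l' => by
    rw [reset]; split_ifs <;> norm_num
  have h1 : 0 ≤ π.ind1 := by cases π <;> simp [Priority.ind1]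
  have h2 : 0 ≤ π.ind2 := by cases π <;> simp [Priority.ind2]
  have := D₁.α_nonneg
  have := D₂.α_nonneg
  have := D₁.B_nonneg
  have := D₂.B_nonneg
  have := D₁.b_nonneg
  have := D₂.b_nonneg
  have ha : ∀ {a b : ℝ}, 0 ≤ a → 0 ≤ b → 0 ≤ a + b := add_nonneg
  have hm : ∀ {a b : ℝ}, 0 ≤ a → 0 ≤ b → 0 ≤ a * b := mul_nonneg
  have hs : ∀ {ι : Type} [Fintype ι] {f : ι → ℝ}, (∀ i, 0 ≤ f i) → 0 ≤ ∑ i, f i :=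
    fun h => Finset.sum_nonneg fun i _ => h i
  cases y <;> simp only [startWeight, le_refl] <;>
    repeat' first
      | apply_assumption
      | intro

theorem successVec_nonneg (y : YState N₁ N₂ k) : 0 ≤ successVec D₁ D₂ y := by
  have h1 : ∀ i, D₁.b i ≤ 1 := fun i => by
    rw [D₁.b_eq]
    linarith [Finset.sum_nonneg fun j (_ : j ∈ Finset.univ) => D₁.B_nonneg i j]
  cases y with
  | c8 i j =>
    simp only [successVec]
    nlinarith [D₁.b_nonneg i, D₂.b_nonneg j, h1 i]
  | _ => simp [successVec, D₁.b_nonneg, D₂.b_nonneg]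

theorem startWeight_dotProduct_leftVec (p : WState N₁ N₂ k → ℝ) :
    startWeight D₁ D₂ π p ⬝ᵥ leftVec = 0 :=
  Finset.sum_eq_zero fun y _ => by cases y <;> simp [startWeight, leftVec]

theorem startWeight_dotProduct_successVec (p : WState N₁ N₂ k → ℝ) :
    startWeight D₁ D₂ π p ⬝ᵥ successVec D₁ D₂ = 0 :=
  Finset.sum_eq_zero fun y _ => by cases y <;> simp [startWeight, successVec]

theorem IsTransient.dotProduct_mul_inv_eq {Y : Type*} [Fintype Y] [DecidableEq Y]
    {A : Matrix Y Y ℝ} (hA : IsTransient A) {s f : Y → ℝ} (h : s ⬝ᵥ f = 0) :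
    s ⬝ᵥ (A * (1 - A)⁻¹) *ᵥ f = s ⬝ᵥ (1 - A)⁻¹ *ᵥ f := by
  have h1 : (1 - A)⁻¹ = 1 + A * (1 - A)⁻¹ := by
    have := hA.one_sub_mul_inv
    rw [sub_mul, one_mul, sub_eq_iff_eq_add] at this
    exact this
  conv_rhs => rw [h1]
  rw [Matrix.add_mulVec, Matrix.one_mulVec, dotProduct_add, h, zero_add]

theorem IsTransient.dotProduct_pow_mono {Y : Type*} [Fintype Y] [DecidableEq Y]
    {A : Matrix Y Y ℝ} (hA : IsTransient A) {s f g : Y → ℝ} (hs : ∀ y, 0 ≤ s y)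
    (h : ∀ y, f y ≤ g y) (n : ℕ) : s ⬝ᵥ A ^ n *ᵥ f ≤ s ⬝ᵥ A ^ n *ᵥ g :=
  Finset.sum_le_sum fun y _ => mul_le_mul_of_nonneg_left
    (mulVec_mono_of_nonneg (pow_nonneg_apply hA.nonneg n) h y) (hs y)

theorem IsTransient.dotProduct_pow_nonneg {Y : Type*} [Fintype Y] [DecidableEq Y]
    {A : Matrix Y Y ℝ} (hA : IsTransient A) {s f : Y → ℝ} (hs : ∀ y, 0 ≤ s y)
    (hf : ∀ y, 0 ≤ f y) (n : ℕ) : 0 ≤ s ⬝ᵥ A ^ n *ᵥ f := by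
  simpa using hA.dotProduct_pow_mono hs (f := 0) hf n

variable {p : WState N₁ N₂ k → ℝ}
  {Ω : Type*} [MeasurableSpace Ω] {μ : Measure Ω} [IsProbabilityMeasure μ]
  {X : ℕ → Ω → SysState N₁ N₂ k}

/-- The rate of receptions of up-to-date packets is positive: otherwise the chain would never
leave the states in which the tracked packet is the freshest received one, so that the
probabilities of the ages would increase with the age. -/
theorem dotProduct_successVec_pos
    (hp : IsStationary (wMatrix D₁ D₂ π) p)
    (hu : ∀ p' : WState N₁ N₂ k → ℝ, IsStationary (wMatrix D₁ D₂ π) p' → p' = p)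
    (hX : IsDTDQ D₁ D₂ π μ X) (hk : 1 ≤ k) :
    0 < startWeight D₁ D₂ π p ⬝ᵥ ((1 - yMatrix D₁ D₂ π)⁻¹ *ᵥ successVec D₁ D₂) := by
  have hA := isTransient_yMatrix (D₁ := D₁) (D₂ := D₂) (π := π) hk
  have hs : ∀ y, 0 ≤ startWeight D₁ D₂ π p y := startWeight_nonneg hp.nonneg
  have hm := hA.hasSum_dotProduct_pow (startWeight D₁ D₂ π p) (successVec D₁ D₂)
  have ha := hA.hasSum_dotProduct_pow (startWeight D₁ D₂ π p) leftVec
  have hm0 := hA.dotProduct_pow_nonneg hs (successVec_nonneg (D₁ := D₁) (D₂ := D₂))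
  rw [dotProduct_leftVec_eq_one hp hu hX hk] at ha
  by_contra hcon
  have hmz : ∀ n, startWeight D₁ D₂ π p ⬝ᵥ (yMatrix D₁ D₂ π ^ n *ᵥ successVec D₁ D₂) = 0 :=
    fun n => le_antisymm ((le_hasSum hm n fun i _ => hm0 i).trans (not_lt.1 hcon)) (hm0 n)
  have hmono : Monotone fun n =>
      startWeight D₁ D₂ π p ⬝ᵥ (yMatrix D₁ D₂ π ^ n *ᵥ leftVec) := by
    refine monotone_nat_of_le_succ fun n => ?_
    have h1 := hA.dotProduct_pow_mono hs (leftVec_le (D₁ := D₁) (D₂ := D₂) (π := π) hk) n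
    have h2 : yMatrix D₁ D₂ π ^ n *ᵥ
        (fun y : YState N₁ N₂ k => (yMatrix D₁ D₂ π *ᵥ leftVec) y + successVec D₁ D₂ y) =
        yMatrix D₁ D₂ π ^ (n + 1) *ᵥ leftVec + yMatrix D₁ D₂ π ^ n *ᵥ successVec D₁ D₂ := by
      rw [pow_succ, ← Matrix.mulVec_mulVec, ← Matrix.mulVec_add]
      rfl
    rwa [h2, dotProduct_add, hmz, add_zero] at h1
  have hle : ∀ n, startWeight D₁ D₂ π p ⬝ᵥ (yMatrix D₁ D₂ π ^ n *ᵥ leftVec) ≤ 0 := fun n =>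
    hmono.ge_of_tendsto ha.summable.tendsto_atTop_zero n
  linarith [hasSum_le hle ha hasSum_zero]

theorem negligible_reception
    (hp : IsStationary (wMatrix D₁ D₂ π) p)
    (hu : ∀ p' : WState N₁ N₂ k → ℝ, IsStationary (wMatrix D₁ D₂ π) p' → p' = p)
    (hX : IsDTDQ D₁ D₂ π μ X) (hk : 1 ≤ k) :
    Negligible μ fun t ω => (if age X (t + 1) ω < age X t ω + 1 then 1 else 0) -
      startWeight D₁ D₂ π p ⬝ᵥ ((1 - yMatrix D₁ D₂ π)⁻¹ *ᵥ successVec D₁ D₂) := by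
  have hA := isTransient_yMatrix (D₁ := D₁) (D₂ := D₂) (π := π) hk
  have hm := (hA.hasSum_dotProduct_pow (startWeight D₁ D₂ π p) (successVec D₁ D₂)).tendsto_sum_nat
  have ha := (hA.hasSum_dotProduct_pow (startWeight D₁ D₂ π p) leftVec).tendsto_sum_nat
  rw [dotProduct_leftVec_eq_one hp hu hX hk] at ha
  obtain ⟨c, hc⟩ : ∃ c, c = startWeight D₁ D₂ π p ⬝ᵥ
    ((1 - yMatrix D₁ D₂ π)⁻¹ *ᵥ successVec D₁ D₂) := ⟨_, rfl⟩
  rw [← hc] at hm ⊢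
  refine Negligible.of_approx (fun t => ?_) ⟨1 + |c|, fun t ω => ?_⟩ fun ε hε => ?_
  · exact measurable_comp₂ hX.measurable (fun x y : SysState N₁ N₂ k =>
      (if y.aoi < x.aoi + 1 then 1 else 0 : ℝ) - c) t (t + 1)
  · refine (abs_sub _ _).trans (add_le_add_left ?_ _)
    split_ifs <;> simp
  · have hlim := ((tendsto_const_nhds (x := c)).sub hm).abs.add
      ((tendsto_const_nhds (x := (1 : ℝ))).sub ha)
    simp only [sub_self, abs_zero, add_zero] at hlim
    obtain ⟨H, hH⟩ := (hlim.eventually_lt_const hε).exists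
    refine ⟨_, _, Negligible.sum (Finset.range H) fun h _ => negligible_reception_eq hp hu hX h,
      (negligible_age_lt hp hu hX H).neg, fun t ω => ?_⟩
    rw [Finset.sum_sub_distrib]
    have h1 : ∑ h ∈ Finset.range H,
        (if age X t ω = h ∧ age X (t + 1) ω < age X t ω + 1 then 1 else 0 : ℝ) =
        if age X t ω < H ∧ age X (t + 1) ω < age X t ω + 1 then 1 else 0 := by
      simp only [ite_and]
      simp
    rw [h1]
    set M := ∑ h ∈ Finset.range H,
      startWeight D₁ D₂ π p ⬝ᵥ (yMatrix D₁ D₂ π ^ h *ᵥ successVec D₁ D₂)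
    set S := ∑ h ∈ Finset.range H, startWeight D₁ D₂ π p ⬝ᵥ (yMatrix D₁ D₂ π ^ h *ᵥ leftVec)
    -- the indicators differ only if the age is at least `H`
    have h2 : |(if age X (t + 1) ω < age X t ω + 1 then 1 else 0 : ℝ) -
        (if age X t ω < H ∧ age X (t + 1) ω < age X t ω + 1 then 1 else 0)| ≤
        1 - if age X t ω < H then 1 else 0 := by
      by_cases h3 : age X t ω < H <;> by_cases h4 : age X (t + 1) ω < age X t ω + 1 <;>
        simp [h3, h4]
    have h5 := abs_sub ((if age X (t + 1) ω < age X t ω + 1 then 1 else 0 : ℝ) -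
      (if age X t ω < H ∧ age X (t + 1) ω < age X t ω + 1 then 1 else 0)) (c - M)
    rw [sub_sub_sub_comm] at h5
    linarith

/-! ### Steady-state laws -/

theorem hasSteadyStateLaw_age
    (hp : IsStationary (wMatrix D₁ D₂ π) p)
    (hu : ∀ p' : WState N₁ N₂ k → ℝ, IsStationary (wMatrix D₁ D₂ π) p' → p' = p)
    (hX : IsDTDQ D₁ D₂ π μ X) :
    HasSteadyStateLaw μ (age X) fun h =>
      startWeight D₁ D₂ π p ⬝ᵥ (yMatrix D₁ D₂ π ^ h *ᵥ leftVec) := by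
  intro h
  beta_reduce
  have h1 := (negligible_age_eq hp hu hX h).tendsto_integral
  obtain ⟨a, ha⟩ : ∃ a, a = startWeight D₁ D₂ π p ⬝ᵥ (yMatrix D₁ D₂ π ^ h *ᵥ leftVec) := ⟨_, rfl⟩
  rw [← ha] at h1 ⊢
  have h2 : ∀ t, ∫ ω, ((if age X t ω = h then 1 else 0 : ℝ) - a) ∂μ =
      μ.real {ω | age X t ω = h} - a := by
    intro t
    have hm : Measurable (age X t) := measurable_comp hX.measurable (fun x => x.aoi) t
    rw [integral_sub _ (integrable_const _), integral_indicator_eq hm]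
    · simp
    · exact integrable_of_abs_le (c := 1)
        (Measurable.ite (hm (measurableSet_singleton h)) measurable_const measurable_const)
        fun ω => by split_ifs <;> simp
  simp only [h2, Finset.sum_sub_distrib, Finset.sum_const, Finset.card_range, nsmul_eq_mul] at h1
  have h3 := h1.add_const a
  rw [zero_add] at h3
  refine h3.congr' ?_
  filter_upwards [eventually_gt_atTop 0] with T hT
  have hT' : (T : ℝ) ≠ 0 := by exact_mod_cast hT.ne'
  field_simp
  ring

theorem hasSteadyStateLaw_peakAge
    (hp : IsStationary (wMatrix D₁ D₂ π) p)
    (hu : ∀ p' : WState N₁ N₂ k → ℝ, IsStationary (wMatrix D₁ D₂ π) p' → p' = p)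
    (hX : IsDTDQ D₁ D₂ π μ X) (hk : 1 ≤ k) :
    HasSteadyStateLaw μ (peakAge X) fun h =>
      startWeight D₁ D₂ π p ⬝ᵥ (yMatrix D₁ D₂ π ^ h *ᵥ successVec D₁ D₂) /
        startWeight D₁ D₂ π p ⬝ᵥ ((1 - yMatrix D₁ D₂ π)⁻¹ *ᵥ successVec D₁ D₂) := by
  classical
  intro h
  have hage : ∀ t, Measurable (age X t) := fun t =>
    measurable_comp hX.measurable (fun x => x.aoi) t
  have hP : ∀ t, MeasurableSet {ω | UpToDate X ω t} := by
    intro t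
    exact (MeasurableSet.const (1 ≤ t)).inter
      (measurableSet_lt (hage t) ((hage (t - 1)).add_const 1))
  have hpeak : ∀ n, Measurable (peakAge X n) := fun n =>
    (measurable_from_prod_countable_right (f := fun q : ℕ × Ω => age X (q.1 - 1) q.2)
      fun t => hage (t - 1)).comp ((measurable_nth hP n).prodMk measurable_id)
  have hmain := tendsto_average_nth (μ := μ) (P := UpToDate X)
    (g := fun t ω => if age X (t - 1) ω = h then 1 else 0)
    (fun ω h0 => absurd h0.1 (by norm_num)) hP
    (fun t => Measurable.ite (hage (t - 1) (measurableSet_singleton h)) measurable_const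
      measurable_const) (fun t ω => by split_ifs <;> simp)
    (m := startWeight D₁ D₂ π p ⬝ᵥ (yMatrix D₁ D₂ π ^ h *ᵥ successVec D₁ D₂))
    (dotProduct_successVec_pos hp hu hX hk)
    ((negligible_reception hp hu hX hk).congr fun t ω => by simp [UpToDate])
    ((negligible_reception_eq hp hu hX h).congr fun t ω => by
      rw [← ite_and]
      simp [UpToDate, and_comm])
  refine hmain.congr fun K => ?_
  congr 1
  exact Finset.sum_congr rfl fun n _ => integral_indicator_eq (hpeak n) h

end DTDQ

theorem mainTheorem3 {N₁ N₂ k : ℕ} (hk : 1 ≤ k) (D₁ : DTDQ.DPH N₁) (D₂ : DTDQ.DPH N₂)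
    (π : DTDQ.Priority) (p : DTDQ.WState N₁ N₂ k → ℝ)
    (hp : DTDQ.IsStationary (DTDQ.wMatrix D₁ D₂ π) p)
    (hp_unique : ∀ p' : DTDQ.WState N₁ N₂ k → ℝ,
      DTDQ.IsStationary (DTDQ.wMatrix D₁ D₂ π) p' → p' = p)
    {Ω : Type*} [MeasurableSpace Ω] (μ : MeasureTheory.Measure Ω)
    [MeasureTheory.IsProbabilityMeasure μ]
    (X : ℕ → Ω → DTDQ.SysState N₁ N₂ k) (hX : DTDQ.IsDTDQ D₁ D₂ π μ X)
    (A : Matrix (DTDQ.YState N₁ N₂ k) (DTDQ.YState N₁ N₂ k) ℝ) (hA : A = DTDQ.yMatrix D₁ D₂ π)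
    (cs : DTDQ.YState N₁ N₂ k → ℝ) (hcs : cs = DTDQ.successVec D₁ D₂)
    (v : DTDQ.YState N₁ N₂ k → ℝ) (hv : v = DTDQ.leftVec)
    (σ : DTDQ.YState N₁ N₂ k → ℝ) (hσ : σ = DTDQ.startVec D₁ D₂ π p) :
    IsUnit (1 - A) ∧
    0 < σ ⬝ᵥ (A * (1 - A)⁻¹) *ᵥ v ∧
    0 < σ ⬝ᵥ (A * (1 - A)⁻¹) *ᵥ cs ∧
    ∃ uΔ uΦ : ℕ → ℝ,
      DTDQ.HasSteadyStateLaw μ (DTDQ.age X) uΔ ∧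
      DTDQ.HasSteadyStateLaw μ (DTDQ.peakAge X) uΦ ∧
      HasSum uΔ 1 ∧
      HasSum uΦ 1 ∧
      (∀ h : ℕ, uΔ h = (σ ⬝ᵥ (A ^ h) *ᵥ v) / (σ ⬝ᵥ (A * (1 - A)⁻¹) *ᵥ v)) ∧
      (∀ h : ℕ, uΦ h = (σ ⬝ᵥ (A ^ h) *ᵥ cs) / (σ ⬝ᵥ (A * (1 - A)⁻¹) *ᵥ cs)) ∧
      HasSum (fun h : ℕ => (h : ℝ) * uΔ h)
        ((σ ⬝ᵥ (A * (1 - A)⁻¹ ^ 2) *ᵥ v) / (σ ⬝ᵥ (A * (1 - A)⁻¹) *ᵥ v)) ∧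
      HasSum (fun h : ℕ => (h : ℝ) ^ 2 * uΔ h)
        ((σ ⬝ᵥ (A * (1 - A)⁻¹ ^ 3 * (A + 1)) *ᵥ v) / (σ ⬝ᵥ (A * (1 - A)⁻¹) *ᵥ v)) ∧
      HasSum (fun h : ℕ => (h : ℝ) * uΦ h)
        ((σ ⬝ᵥ (A * (1 - A)⁻¹ ^ 2) *ᵥ cs) / (σ ⬝ᵥ (A * (1 - A)⁻¹) *ᵥ cs)) := by
  subst hA hcs hv
  have hT := DTDQ.isTransient_yMatrix (D₁ := D₁) (D₂ := D₂) (π := π) hk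
  have ha1 := DTDQ.dotProduct_leftVec_eq_one hp hp_unique hX hk
  have hc0 := DTDQ.dotProduct_successVec_pos hp hp_unique hX hk
  have hΔ := DTDQ.hasSteadyStateLaw_age hp hp_unique hX
  have hΦ := DTDQ.hasSteadyStateLaw_peakAge hp hp_unique hX hk
  have hs0 : ∀ y, 0 ≤ DTDQ.startWeight D₁ D₂ π p y := DTDQ.startWeight_nonneg hp.nonneg
  have hv := hT.dotProduct_mul_inv_eq
    (DTDQ.startWeight_dotProduct_leftVec (D₁ := D₁) (D₂ := D₂) (π := π) p)
  have hcs := hT.dotProduct_mul_inv_eq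
    (DTDQ.startWeight_dotProduct_successVec (D₁ := D₁) (D₂ := D₂) (π := π) p)
  set A : Matrix (DTDQ.YState N₁ N₂ k) (DTDQ.YState N₁ N₂ k) ℝ := DTDQ.yMatrix D₁ D₂ π
  set cs : DTDQ.YState N₁ N₂ k → ℝ := DTDQ.successVec D₁ D₂
  set v : DTDQ.YState N₁ N₂ k → ℝ := DTDQ.leftVec
  set s : DTDQ.YState N₁ N₂ k → ℝ := DTDQ.startWeight D₁ D₂ π p with hs
  rw [← hv] at ha1
  rw [← hcs] at hc0 hΦ
  -- the normalization of the initial vector cancels in all the quotients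
  obtain ⟨S, hS⟩ : ∃ S, S = ∑ y, s y := ⟨_, rfl⟩
  have hS0 : 0 < S := by
    refine hS ▸ (Finset.sum_nonneg fun y _ => hs0 y).lt_of_ne' fun h0 => ?_
    have hz : s = 0 := funext fun y =>
      (Finset.sum_eq_zero_iff_of_nonneg fun y _ => hs0 y).1 h0 y (Finset.mem_univ y)
    rw [hz, zero_dotProduct] at ha1
    exact zero_ne_one ha1
  have hσs : σ = S⁻¹ • s := by
    rw [hσ, hS]
    exact funext fun y => div_eq_inv_mul _ _
  have hdiv : ∀ f g : DTDQ.YState N₁ N₂ k → ℝ, σ ⬝ᵥ f / σ ⬝ᵥ g = s ⬝ᵥ f / s ⬝ᵥ g := by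
    intro f g
    rw [hσs, smul_dotProduct, smul_dotProduct, smul_eq_mul, smul_eq_mul,
      mul_div_mul_left _ _ (inv_ne_zero hS0.ne')]
  have hpos : ∀ f : DTDQ.YState N₁ N₂ k → ℝ, 0 < s ⬝ᵥ f → 0 < σ ⬝ᵥ f := by
    intro f hf
    rw [hσs, smul_dotProduct]
    exact mul_pos (inv_pos.2 hS0) hf
  simp only [hdiv]
  refine ⟨hT.isUnit_one_sub, hpos _ (ha1 ▸ one_pos), hpos _ hc0, _, _, hΔ, hΦ, ?_, ?_,
    fun h => ?_, fun h => rfl, ?_, ?_, ?_⟩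
  · rw [← ha1, hv]
    exact hT.hasSum_dotProduct_pow s v
  · have hsum := hT.hasSum_dotProduct_pow s cs
    rw [← hcs] at hsum
    exact div_self hc0.ne' ▸ hsum.div_const _
  · rw [ha1, div_one]
  · rw [ha1, div_one]
    exact hT.hasSum_mul_dotProduct_pow s v
  · rw [ha1, div_one]
    exact hT.hasSum_sq_mul_dotProduct_pow s v
  · simp only [← mul_div_assoc]
    exact (hT.hasSum_mul_dotProduct_pow s cs).div_const _
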